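/- Let $n\ge 1$ and $\tfrac12<s<1$. For $u:\mathbb R^n\to\mathbb R$ put $\delta(u,x,y)=u(x+y)+u(x-y)-2u(x)$ and, for a symmetric positive definite matrix $A$ with $\det A=1$, $$L_Au(x)=\frac12\int_{\mathbb R^n}\frac{\delta(u,x,y)}{|A^{-1}y|^{n+2s}}\,dy .$$ Let $\mathcal D_su(x)\in[-\infty,\infty]$ be the infimum of $L_Au(x)$ over all symmetric $A>0$ with $\det A=1$, and let $\mathcal D_s^\theta u(x)$ be the infimum over those $A$ that satisfy in addition $\lambda_{\min}(A)\ge\theta$. For an open set $\Omega\subset\mathbb R^n$, $\mathcal D_su\ge f$ in $\Omega$ in the viscosity sense means that $u$ is upper semicontinuous on $\overline\Omega$ and that $\mathcal D_sv(x)\ge f(x)$ whenever $x\in\Omega$, $N\subset\Omega$ is a bounded open neighbourhood of $x$, $\psi$ is $C^2$ on $\overline N$, $\psi(x)=u(x)$, $\psi>u$ on $N\setminus\{x\}$, and $v=\psi$ in $N$, $v=u$ outside $N$; $\mathcal D_su\le f$ is defined analogously (lower semicontinuous, $\psi<u$ on $N\setminus\{x\}$, $\mathcal D_sv(x)\le f(x)$),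 and a solution of $\mathcal D_su=f$ is a function satisfying both. Let $\phi\in C^{2,\alpha}_{\rm loc}(\mathbb R^n)$, $0<\alpha\le1$, be strictly convex, and suppose that $\phi=\Gamma+\eta$ outside some ball, where the graph of $\Gamma$ is a cone (for some vertex $(p,h)\in\mathbb R^n\times\mathbb R$, $\Gamma(p+tx)-h=t(\Gamma(p+x)-h)$ for all $x$ and all $t>0$), $\eta$ is $C^2$ there, and $|\eta(x)|\le a|x|^{-\epsilon}$, $|\nabla\eta(x)|\le a|x|^{-(1+\epsilon)}$, $|D^2\eta(x)|\le a|x|^{-(2+\epsilon)}$ for some $a>0$ and $0<\epsilon<n$. Let $u$ be a viscosity solution of $\mathcal D_su=u-\phi$ in $\mathbb R^n$ with $(u-\phi)(x)\to0$ as $|x|\to\infty$. Then: 1. $u>\phi$ in $\mathbb R^n$. 2. $u$ is Lipschitz continuous, and $u$ is semiconcave (for some $C$, $\delta(u,x,y)\le C|y|^2$ for all $x,y$). 3. For every bounded open $\Omega$ there is $\eta_0>0$ with $(1-s)\mathcal D_su\ge\eta_0$ in $\Omega$ in the viscosity sense. 4. If $n\ge2$, let $L,C,\eta_0>0$ and let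 $\Omega$ be an open set such that $u$ is Lipschitz with constant $L$ and semiconcave with constant $C$, and $(1-s)\mathcal D_su\ge\eta_0$ in $\Omega$ in the viscosity sense. Then for every $x\in\Omega$ and every $$0<\theta<\Big(\frac{\mu_0}{n\mu_1}\Big)^{\frac{n-1}{2s}}$$ the integrals $L_Au(x)$ ($A>0$ symmetric, $\det A=1$) converge absolutely and $\mathcal D_su(x)=\mathcal D_s^\theta u(x)$. Here $\omega_k=2\pi^{k/2}/\Gamma(k/2)$ and $$\mu_1=\frac{L^{2-2s}}{2s-1}\Big(\frac C2\Big)^{2s-1},\qquad \mu_0=C_1^{1-n}C_2^{-1}\Big(\frac{\eta_0}2\Big)^n,$$ $$C_1=\frac{\sqrt\pi\,\Gamma(\frac{n-1}2+s)}{\Gamma(\frac n2+s)}\cdot\frac{\mu_1\omega_{n-1}}2,\qquad C_2=\omega_{n-1}\cdot\frac{\Gamma(\frac{n-1}2)\,\Gamma(s+\frac12)}{2\,\Gamma(\frac n2+s)} .$$ 5. The operator is uniformly elliptic along $u$ on bounded sets: for every bounded $\Omega\subset\mathbb R^n$ there is $\theta_0>0$ such that for all $0<\theta\le\theta_0$ and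 all $x\in\Omega$ the integrals $L_Au(x)$ converge absolutely and $\mathcal D_su(x)=\mathcal D_s^\theta u(x)$. -/

import Mathlib

open scoped NNReal

noncomputable section

namespace FracMA

/-- Second-order increment `δ(u,x,y) = u(x+y) + u(x-y) - 2u(x)`. -/
def secondIncr {n : ℕ} (u : EuclideanSpace ℝ (Fin n) → ℝ) (x y : EuclideanSpace ℝ (Fin n)) : ℝ :=
  u (x + y) + u (x - y) - 2 * u x

/-- The integrand `δ(u,x,y) / |A⁻¹ y|^(n+2s)`. -/
def integrand {n : ℕ} (s : ℝ) (A : Matrix (Fin n) (Fin n) ℝ) (u : EuclideanSpace ℝ (Fin n) → ℝ)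
    (x y : EuclideanSpace ℝ (Fin n)) : ℝ :=
  secondIncr u x y / ‖Matrix.toEuclideanLin A⁻¹ y‖ ^ ((n : ℝ) + 2 * s)

/-- The linear operator `L_A u(x) = (1/2) ∫ δ(u,x,y) / |A⁻¹ y|^(n+2s) dy`. -/
def linOp {n : ℕ} (s : ℝ) (A : Matrix (Fin n) (Fin n) ℝ) (u : EuclideanSpace ℝ (Fin n) → ℝ)
    (x : EuclideanSpace ℝ (Fin n)) : ℝ :=
  (1 / 2) * ∫ y, integrand s A u x y

/-- All the integrals `L_A u(x)`, with `A > 0` and `det A = 1`, converge absolutely, so that the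
operators below can be evaluated at `x` in the classical sense. -/
def ClassicalAt {n : ℕ} (s : ℝ) (u : EuclideanSpace ℝ (Fin n) → ℝ)
    (x : EuclideanSpace ℝ (Fin n)) : Prop :=
  ∀ A : Matrix (Fin n) (Fin n) ℝ, A.PosDef → A.det = 1 → MeasureTheory.Integrable (integrand s A u x)

/-- The fractional Monge–Ampère operator: the infimum of `L_A u(x)` over symmetric `A > 0` with
`det A = 1`. It takes values in `[-∞,∞]`, since the infimum may be `-∞`. -/
def fracMA {n : ℕ} (s : ℝ) (u : EuclideanSpace ℝ (Fin n) → ℝ)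
    (x : EuclideanSpace ℝ (Fin n)) : EReal :=
  ⨅ A ∈ {A : Matrix (Fin n) (Fin n) ℝ | A.PosDef ∧ A.det = 1}, (linOp s A u x : EReal)

/-- The non-degenerate operator: the infimum of `L_A u(x)` over symmetric `A > 0` with `det A = 1`
all of whose eigenvalues are at least `θ`. -/
def fracMATrunc {n : ℕ} (s θ : ℝ) (u : EuclideanSpace ℝ (Fin n) → ℝ)
    (x : EuclideanSpace ℝ (Fin n)) : EReal :=
  ⨅ A ∈ {A : Matrix (Fin n) (Fin n) ℝ |
      ∃ hA : A.PosDef, A.det = 1 ∧ ∀ i, θ ≤ hA.isHermitian.eigenvalues i},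
    (linOp s A u x : EReal)

open Classical in
/-- The function equal to `ψ` in `N` and to `u` outside `N`. -/
def glue {n : ℕ} (N : Set (EuclideanSpace ℝ (Fin n))) (ψ u : EuclideanSpace ℝ (Fin n) → ℝ) :
    EuclideanSpace ℝ (Fin n) → ℝ :=
  fun y => if y ∈ N then ψ y else u y

/-- `ψ` is `C²` in the closure of `N`, that is, in an open set containing it. -/
def C2OnClosure {n : ℕ} (N : Set (EuclideanSpace ℝ (Fin n)))
    (ψ : EuclideanSpace ℝ (Fin n) → ℝ) : Prop :=
  ∃ U, IsOpen U ∧ closure N ⊆ U ∧ ContDiffOn ℝ 2 ψ U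

/-- `D_s u ≥ f` in the open set `Ω`, in the viscosity sense. The neighbourhoods `N` are taken
bounded, so that for continuous `u` of linear growth and `s > 1/2` the integrals defining the
operator at the glued function converge absolutely. Nothing is lost: shrinking `N` lowers the glued
function away from `x`, so that smaller neighbourhoods give stronger conditions. -/
def IsSubsolutionOn {n : ℕ} (s : ℝ) (Ω : Set (EuclideanSpace ℝ (Fin n)))
    (f u : EuclideanSpace ℝ (Fin n) → ℝ) : Prop :=
  UpperSemicontinuousOn u (closure Ω) ∧
  ∀ x ∈ Ω, ∀ N : Set (EuclideanSpace ℝ (Fin n)), IsOpen N → Bornology.IsBounded N → N ⊆ Ω → x ∈ N →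
    ∀ ψ : EuclideanSpace ℝ (Fin n) → ℝ, C2OnClosure N ψ → ψ x = u x →
      (∀ y ∈ N, y ≠ x → u y < ψ y) → (f x : EReal) ≤ fracMA s (glue N ψ u) x

/-- `D_s u ≤ f` in the open set `Ω`, in the viscosity sense (here shrinking `N` raises the glued
function away from `x`, so that again smaller neighbourhoods give stronger conditions). -/
def IsSupersolutionOn {n : ℕ} (s : ℝ) (Ω : Set (EuclideanSpace ℝ (Fin n)))
    (f u : EuclideanSpace ℝ (Fin n) → ℝ) : Prop :=
  LowerSemicontinuousOn u (closure Ω) ∧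
  ∀ x ∈ Ω, ∀ N : Set (EuclideanSpace ℝ (Fin n)), IsOpen N → Bornology.IsBounded N → N ⊆ Ω → x ∈ N →
    ∀ ψ : EuclideanSpace ℝ (Fin n) → ℝ, C2OnClosure N ψ → ψ x = u x →
      (∀ y ∈ N, y ≠ x → ψ y < u y) → fracMA s (glue N ψ u) x ≤ (f x : EReal)

/-- `u` is a viscosity solution of `D_s u = u - φ` in `ℝⁿ` with `u - φ → 0` at infinity. -/
structure IsSolution {n : ℕ} (s : ℝ) (φ u : EuclideanSpace ℝ (Fin n) → ℝ) : Prop where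
  sub : IsSubsolutionOn s Set.univ (fun x => u x - φ x) u
  super : IsSupersolutionOn s Set.univ (fun x => u x - φ x) u
  tendsto : Filter.Tendsto (fun x => u x - φ x)
    (Bornology.cobounded (EuclideanSpace ℝ (Fin n))) (nhds 0)

/-- The graph of `Γ` is a cone, with vertex `(p, h)`. -/
def IsCone {n : ℕ} (Γ : EuclideanSpace ℝ (Fin n) → ℝ) : Prop :=
  ∃ (p : EuclideanSpace ℝ (Fin n)) (h : ℝ),
    ∀ (x : EuclideanSpace ℝ (Fin n)) (t : ℝ), 0 < t → Γ (p + t • x) - h = t * (Γ (p + x) - h)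

/-- The class of data at infinity: `φ` is (locally) `C^{2,α}`, strictly convex, and equal near
infinity to a cone plus a decaying `C²` function with decaying derivatives. -/
structure IsDatum {n : ℕ} (α : ℝ≥0) (φ : EuclideanSpace ℝ (Fin n) → ℝ) : Prop where
  contDiff : ContDiff ℝ 2 φ
  holder : ∀ K : Set (EuclideanSpace ℝ (Fin n)), IsCompact K →
    ∃ H : ℝ≥0, HolderOnWith H α (iteratedFDeriv ℝ 2 φ) K
  strictConvex : StrictConvexOn ℝ Set.univ φ
  asymptotic : ∃ (Γ η : EuclideanSpace ℝ (Fin n) → ℝ) (a ε R : ℝ),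
    0 < a ∧ 0 < ε ∧ ε < n ∧ 0 < R ∧ IsCone Γ ∧
    ContDiffOn ℝ 2 η {x | R < ‖x‖} ∧
    ∀ x, R < ‖x‖ →
      φ x = Γ x + η x ∧
      |η x| ≤ a * ‖x‖ ^ (-ε) ∧
      ‖fderiv ℝ η x‖ ≤ a * ‖x‖ ^ (-(1 + ε)) ∧
      ‖iteratedFDeriv ℝ 2 η x‖ ≤ a * ‖x‖ ^ (-(2 + ε))

/-- `u` is semiconcave in `ℝⁿ` with constant `C`. -/
def IsSemiconcave {n : ℕ} (C : ℝ) (u : EuclideanSpace ℝ (Fin n) → ℝ) : Prop :=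
  Continuous u ∧ ∀ x y, secondIncr u x y ≤ C * ‖y‖ ^ 2

/-- `ω_k = 2 π^(k/2) / Γ(k/2)`, the area of the unit sphere of `ℝᵏ`. -/
def sphereArea (k : ℕ) : ℝ := 2 * Real.pi ^ ((k : ℝ) / 2) / Real.Gamma ((k : ℝ) / 2)

/-- The constant `μ₁`. -/
def mu1 (s L C : ℝ) : ℝ := L ^ (2 - 2 * s) / (2 * s - 1) * (C / 2) ^ (2 * s - 1)

/-- The constant `C₁`. -/
def const1 (n : ℕ) (s L C : ℝ) : ℝ :=
  √Real.pi * Real.Gamma (((n : ℝ) - 1) / 2 + s) / Real.Gamma ((n : ℝ) / 2 + s) *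
    (mu1 s L C * sphereArea (n - 1) / 2)

/-- The constant `C₂`. -/
def const2 (n : ℕ) (s : ℝ) : ℝ :=
  sphereArea (n - 1) * (Real.Gamma (((n : ℝ) - 1) / 2) * Real.Gamma (s + 1 / 2) /
    (2 * Real.Gamma ((n : ℝ) / 2 + s)))

/-- The constant `μ₀ = C₁^(1-n) C₂⁻¹ (η₀/2)ⁿ`. -/
def mu0 (n : ℕ) (s L C η₀ : ℝ) : ℝ :=
  const1 n s L C ^ (1 - (n : ℤ)) * (const2 n s)⁻¹ * (η₀ / 2) ^ n

/-- The ellipticity threshold `(μ₀ / (n μ₁))^((n-1)/(2s))`. -/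
def threshold (n : ℕ) (s L C η₀ : ℝ) : ℝ :=
  (mu0 n s L C η₀ / (n * mu1 s L C)) ^ (((n : ℝ) - 1) / (2 * s))

end FracMA

end

/-! Everything is reduced to integrals over rays. The kernel |z|^(-n-2s) is a mixture of centred
Gaussians, so Γ(n/2+s) L_A u(x) is the integral of I(Az) against exp(-|z|²), where I(v) = ∫₀^∞
δ(u,x,tv) t^(-1-2s) dt (`lineOp`, `gamma_mul_linOp`). I is even and homogeneous of degree 2s, and
the Gaussian factors along orthogonal directions, which produces the Gamma quotients in the
constants.

Ellipticity. If u is Lipschitz and semiconcave, then I(v) ≤ μ₁|v|^(2s)/(1-s), and I inherits the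
midpoint inequality I(a+b) + I(a-b) ≤ 2 I(a) + 2 μ₁|b|^(2s)/(1-s). Suppose (1-s) L_A u(x) ≥ η₀ for
all A. Testing with ellipsoids elongated along a unit vector e, the midpoint inequality bounds the
average by a multiple of I(e) plus an error; choosing the elongation so that the error eats half of
η₀ leaves I(e) ≥ μ₀/(1-s) (`mu0_le_lineOp`). Hence L_A u(x) grows with the largest eigenvalue of A.
A matrix of determinant one with a tiny eigenvalue has a huge one, so it cannot beat the identity
(`fracMA_eq_fracMATrunc`). The hypothesis holds classically because a semiconcave Lipschitz function
is touched from above by a paraboloid at every point (`exists_supergradient`,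
`IsSubsolutionOn.pointwise`).

Supersolutions. The infimum runs over a noncompact set, so a test on a shrinking ball does not
obviously pass to the limit. If a semiconcave Lipschitz comparison function has all its L_A bounded
below by F > 0, its ray integrals are bounded below, and the error of the test becomes a relative
error, uniform in A; this gives F ≤ u - φ at the contact point (`IsSupersolutionOn.ge_of_touching`).

Strict inequality. At a nonpositive minimum of u - φ the function φ is such a comparison function,
since strict convexity makes its operator positive; this is a contradiction
(`lt_of_isSupersolutionOn`).

Semiconcavity. If δ(u,·,h) exceeded the bound valid for φ, a doubling functional in (x₁,x₂,y) would
have a maximum. The inf-convolution of u, taken at the midpoint of x₁ and x₂, has increments between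
the average of those of u at x₁, x₂ and those of u at y. So the equation gives average (u-φ)(x₁),
(u-φ)(x₂) ≤ (u-φ)(y), against maximality; positivity of u - φ is what permits the supersolution test
(`IsSolution.secondIncr_le`). The Lipschitz bound follows from semiconcavity and the bounded
distance to φ. -/

noncomputable section

namespace FracMA

open MeasureTheory Set Filter Topology Module
open scoped RealInnerProductSpace

/-! ### The homogeneous kernel as a mixture of Gaussians. -/

section GaussianAverages

variable {E : Type*} [NormedAddCommGroup E] [InnerProductSpace ℝ E] [FiniteDimensional ℝ E]
  [MeasurableSpace E] [BorelSpace E]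

/-- The integral of `G` over the ray through `v`, against the homogeneous kernel of order `2s`,
written in the variable inverse to the distance. -/
def lineOp (s : ℝ) (G : E → ℝ) (v : E) : ℝ := ∫ τ in Ioi (0 : ℝ), G (τ⁻¹ • v) * τ ^ (2 * s - 1)

/-- The integral of `G` over the ray through `v` converges absolutely. -/
def LineIntegrable (s : ℝ) (G : E → ℝ) (v : E) : Prop :=
  IntegrableOn (fun τ : ℝ => G (τ⁻¹ • v) * τ ^ (2 * s - 1)) (Ioi 0)

/-- With p = n + 2s - 1 and b = |z| the right side is a constant times |z|^(-n-2s): this is the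
mixture formula for the kernel. -/
lemma integral_rpow_mul_exp_sq {p b : ℝ} (hp : -1 < p) (hb : 0 < b) :
    ∫ τ in Ioi (0 : ℝ), τ ^ p * Real.exp (-b ^ 2 * τ ^ 2) =
      1 / 2 * Real.Gamma ((p + 1) / 2) / b ^ (p + 1) := by
  have := integral_rpow_mul_exp_neg_mul_rpow (p := 2) two_pos hp (pow_pos hb 2)
  simp only [Real.rpow_two] at this
  rw [this, ← Real.rpow_natCast b 2, ← Real.rpow_mul hb.le,
    show ((2 : ℕ) : ℝ) * (-(p + 1) / 2) = -(p + 1) by push_cast; ring, Real.rpow_neg hb.le]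
  field_simp

lemma integrableOn_rpow_mul_exp_sq {p b : ℝ} (hp : -1 < p) (hb : 0 < b) :
    IntegrableOn (fun τ : ℝ => τ ^ p * Real.exp (-b ^ 2 * τ ^ 2)) (Ioi 0) := by
  have := integrableOn_rpow_mul_exp_neg_mul_rpow (p := 2) hp two_pos (pow_pos hb 2)
  simpa only [Real.rpow_two] using this

/-- The integrand of the Gaussian average, on the product of the space with the half-line. -/
lemma integrable_prod_gaussian [Nontrivial E] {s : ℝ} (hs : 0 < s) {G : E → ℝ} (hG : Measurable G)
    (h : Integrable (fun z => G z / ‖z‖ ^ ((finrank ℝ E : ℝ) + 2 * s))) :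
    Integrable (fun p : E × ℝ =>
        G p.1 * (p.2 ^ ((finrank ℝ E : ℝ) + 2 * s - 1) * Real.exp (-‖p.1‖ ^ 2 * p.2 ^ 2)))
      (volume.prod (volume.restrict (Ioi 0))) := by
  have hp : -1 < (finrank ℝ E : ℝ) + 2 * s - 1 := by
    have : (0 : ℝ) ≤ finrank ℝ E := Nat.cast_nonneg _
    linarith
  have hm : AEStronglyMeasurable (fun p : E × ℝ =>
        G p.1 * (p.2 ^ ((finrank ℝ E : ℝ) + 2 * s - 1) * Real.exp (-‖p.1‖ ^ 2 * p.2 ^ 2)))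
      (volume.prod (volume.restrict (Ioi 0))) := by
    refine Measurable.aestronglyMeasurable ?_
    fun_prop
  rw [integrable_prod_iff hm]
  have h0 : ∀ᵐ z : E, z ≠ 0 := by simp [ae_iff]
  refine ⟨?_, ?_⟩
  · filter_upwards [h0] with z hz
    exact (integrableOn_rpow_mul_exp_sq hp (norm_pos_iff.2 hz)).const_mul _
  · refine (h.norm.const_mul (1 / 2 * Real.Gamma ((finrank ℝ E : ℝ) / 2 + s))).congr ?_
    filter_upwards [h0] with z hz
    have hz' := norm_pos_iff.2 hz
    have : ∀ τ ∈ Ioi (0 : ℝ), ‖G z * (τ ^ ((finrank ℝ E : ℝ) + 2 * s - 1) *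
        Real.exp (-‖z‖ ^ 2 * τ ^ 2))‖ = ‖G z‖ * (τ ^ ((finrank ℝ E : ℝ) + 2 * s - 1) *
        Real.exp (-‖z‖ ^ 2 * τ ^ 2)) := by
      intro τ hτ
      have hτ : 0 < τ := hτ
      rw [norm_mul, Real.norm_of_nonneg (r := _ * _) (by positivity)]
    rw [setIntegral_congr_fun measurableSet_Ioi this, integral_const_mul,
      integral_rpow_mul_exp_sq hp hz', norm_div,
      Real.norm_of_nonneg (r := ‖z‖ ^ _) (Real.rpow_nonneg (norm_nonneg _) _)]
    rw [sub_add_cancel, show ((finrank ℝ E : ℝ) + 2 * s) / 2 = (finrank ℝ E : ℝ) / 2 + s by ring]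
    ring

/-- The dilation z ↦ τ⁻¹z frees the Gaussian from τ; its Jacobian lowers the power of τ from n + 2s
- 1 to 2s - 1, the weight of a ray integral. -/
lemma gaussian_integrand_rescale {s : ℝ} (G : E → ℝ) {τ : ℝ} (hτ : 0 < τ) (z : E) :
    G (τ⁻¹ • z) * τ ^ (2 * s - 1) * Real.exp (-‖z‖ ^ 2) =
      (τ ^ finrank ℝ E)⁻¹ * (G (τ⁻¹ • z) * (τ ^ ((finrank ℝ E : ℝ) + 2 * s - 1) *
        Real.exp (-‖τ⁻¹ • z‖ ^ 2 * τ ^ 2))) := by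
  have h1 : τ ^ ((finrank ℝ E : ℝ) + 2 * s - 1) = τ ^ finrank ℝ E * τ ^ (2 * s - 1) := by
    rw [add_sub_assoc, Real.rpow_add hτ, Real.rpow_natCast]
  have h2 : ‖τ⁻¹ • z‖ ^ 2 * τ ^ 2 = ‖z‖ ^ 2 := by
    rw [norm_smul, Real.norm_of_nonneg (by positivity)]
    field_simp
  rw [neg_mul, h2, h1]
  field_simp

/-- For each fixed τ the dilation preserves the L¹ norm of the slice, so integrability carries over
from the undilated integrand. -/
lemma integrable_prod_lines [Nontrivial E] {s : ℝ} (hs : 0 < s) {G : E → ℝ} (hG : Measurable G)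
    (h : Integrable (fun z => G z / ‖z‖ ^ ((finrank ℝ E : ℝ) + 2 * s))) :
    Integrable (fun p : E × ℝ => G (p.2⁻¹ • p.1) * p.2 ^ (2 * s - 1) * Real.exp (-‖p.1‖ ^ 2))
      (volume.prod (volume.restrict (Ioi 0))) := by
  have h1 := integrable_prod_gaussian hs hG h
  have hm : AEStronglyMeasurable (fun p : E × ℝ =>
        G (p.2⁻¹ • p.1) * p.2 ^ (2 * s - 1) * Real.exp (-‖p.1‖ ^ 2))
      (volume.prod (volume.restrict (Ioi 0))) := by
    refine Measurable.aestronglyMeasurable ?_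
    fun_prop
  have h2 := h1
  rw [integrable_prod_iff' h1.aestronglyMeasurable] at h2
  rw [integrable_prod_iff' hm]
  refine ⟨?_, ?_⟩
  · filter_upwards [h2.1, ae_restrict_mem measurableSet_Ioi] with τ h3 hτ
    have hτ : 0 < τ := hτ
    have h4 := (h3.comp_smul (inv_ne_zero hτ.ne')).const_mul (τ ^ finrank ℝ E)⁻¹
    refine h4.congr (Eventually.of_forall fun z => ?_)
    exact (gaussian_integrand_rescale G hτ z).symm
  · refine h2.2.congr ?_
    filter_upwards [ae_restrict_mem measurableSet_Ioi] with τ hτ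
    have hτ : 0 < τ := hτ
    simp only [gaussian_integrand_rescale G hτ, norm_mul (τ ^ finrank ℝ E)⁻¹]
    rw [integral_const_mul, Measure.integral_comp_inv_smul volume (fun z => ‖G z *
      (τ ^ ((finrank ℝ E : ℝ) + 2 * s - 1) * Real.exp (-‖z‖ ^ 2 * τ ^ 2))‖) τ,
      Real.norm_of_nonneg (by positivity), abs_of_pos (by positivity), smul_eq_mul,
      inv_mul_cancel_left₀ (by positivity)]

lemma ae_lineIntegrable [Nontrivial E] {s : ℝ} (hs : 0 < s) {G : E → ℝ} (hG : Measurable G)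
    (h : Integrable (fun z => G z / ‖z‖ ^ ((finrank ℝ E : ℝ) + 2 * s))) :
    ∀ᵐ z, LineIntegrable s G z := by
  filter_upwards [(integrable_prod_lines hs hG h).prod_right_ae] with z hz
  refine (hz.mul_const (Real.exp (‖z‖ ^ 2))).congr (Eventually.of_forall fun τ => ?_)
  simp only [mul_assoc, ← Real.exp_add]
  simp

lemma integrable_lineOp_mul_gaussian [Nontrivial E] {s : ℝ} (hs : 0 < s) {G : E → ℝ}
    (hG : Measurable G) (h : Integrable (fun z => G z / ‖z‖ ^ ((finrank ℝ E : ℝ) + 2 * s))) :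
    Integrable (fun z => lineOp s G z * Real.exp (-‖z‖ ^ 2)) := by
  refine (integrable_prod_lines hs hG h).integral_prod_left.congr
    (Eventually.of_forall fun z => ?_)
  simp only [lineOp]
  rw [← integral_mul_const]

/-- The integral of `G` against the homogeneous kernel is a Gaussian average of its integrals
over rays. -/
lemma integral_lineOp_mul_gaussian [Nontrivial E] {s : ℝ} (hs : 0 < s) {G : E → ℝ}
    (hG : Measurable G) (h : Integrable (fun z => G z / ‖z‖ ^ ((finrank ℝ E : ℝ) + 2 * s))) :
    ∫ z, lineOp s G z * Real.exp (-‖z‖ ^ 2) =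
      1 / 2 * Real.Gamma ((finrank ℝ E : ℝ) / 2 + s) *
        ∫ z, G z / ‖z‖ ^ ((finrank ℝ E : ℝ) + 2 * s) := by
  have h0 : ∀ᵐ z : E, z ≠ 0 := by simp [ae_iff]
  have hp : -1 < (finrank ℝ E : ℝ) + 2 * s - 1 := by
    have : (0 : ℝ) ≤ finrank ℝ E := Nat.cast_nonneg _
    linarith
  calc ∫ z, lineOp s G z * Real.exp (-‖z‖ ^ 2)
      = ∫ z, ∫ τ in Ioi (0 : ℝ), G (τ⁻¹ • z) * τ ^ (2 * s - 1) * Real.exp (-‖z‖ ^ 2) := by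
        simp only [lineOp, integral_mul_const]
    _ = ∫ τ in Ioi (0 : ℝ), ∫ z, G (τ⁻¹ • z) * τ ^ (2 * s - 1) * Real.exp (-‖z‖ ^ 2) :=
        integral_integral_swap (integrable_prod_lines hs hG h)
    _ = ∫ τ in Ioi (0 : ℝ), ∫ z, G z * (τ ^ ((finrank ℝ E : ℝ) + 2 * s - 1) *
          Real.exp (-‖z‖ ^ 2 * τ ^ 2)) := by
        refine setIntegral_congr_fun measurableSet_Ioi fun τ hτ => ?_
        have hτ : 0 < τ := hτ
        simp only [gaussian_integrand_rescale G hτ]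
        rw [integral_const_mul, Measure.integral_comp_inv_smul volume (fun z => G z *
          (τ ^ ((finrank ℝ E : ℝ) + 2 * s - 1) * Real.exp (-‖z‖ ^ 2 * τ ^ 2))) τ,
          abs_of_pos (by positivity), smul_eq_mul, inv_mul_cancel_left₀ (by positivity)]
    _ = ∫ z, ∫ τ in Ioi (0 : ℝ), G z * (τ ^ ((finrank ℝ E : ℝ) + 2 * s - 1) *
          Real.exp (-‖z‖ ^ 2 * τ ^ 2)) :=
        (integral_integral_swap (integrable_prod_gaussian hs hG h)).symm
    _ = _ := by
        rw [← integral_const_mul]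
        refine integral_congr_ae ?_
        filter_upwards [h0] with z hz
        rw [integral_const_mul, integral_rpow_mul_exp_sq hp (norm_pos_iff.2 hz), sub_add_cancel,
          show ((finrank ℝ E : ℝ) + 2 * s) / 2 = (finrank ℝ E : ℝ) / 2 + s by ring]
        ring

lemma pow_finrank_sub_one_mul_rpow [Nontrivial E] {p y : ℝ} (hy : 0 < y) :
    y ^ (finrank ℝ E - 1) * y ^ p = y ^ ((finrank ℝ E : ℝ) + p - 1) := by
  have hd : 0 < finrank ℝ E := finrank_pos
  rw [← Real.rpow_natCast y, ← Real.rpow_add hy, Nat.cast_pred hd]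
  ring_nf

/-- Radial moments of the Gaussian. -/
lemma integral_norm_rpow_mul_gaussian [Nontrivial E] {p : ℝ} (hp : 0 ≤ p) :
    ∫ z : E, ‖z‖ ^ p * Real.exp (-‖z‖ ^ 2) =
      Real.pi ^ ((finrank ℝ E : ℝ) / 2) * Real.Gamma (((finrank ℝ E : ℝ) + p) / 2) /
        Real.Gamma ((finrank ℝ E : ℝ) / 2) := by
  have hd : (0 : ℝ) < finrank ℝ E := Nat.cast_pos.2 finrank_pos
  rw [integral_fun_norm_addHaar volume (fun r => r ^ p * Real.exp (-r ^ 2))]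
  have h1 : ∫ y in Ioi (0 : ℝ), y ^ (finrank ℝ E - 1) • (y ^ p * Real.exp (-y ^ 2)) =
      1 / 2 * Real.Gamma (((finrank ℝ E : ℝ) + p) / 2) := by
    have := integral_rpow_mul_exp_sq (p := (finrank ℝ E : ℝ) + p - 1) (by linarith) one_pos
    rw [Real.one_rpow, sub_add_cancel, div_one] at this
    rw [← this]
    refine setIntegral_congr_fun measurableSet_Ioi fun y hy => ?_
    simp only [smul_eq_mul, ← mul_assoc, pow_finrank_sub_one_mul_rpow (E := E) (p := p) hy]
    simp
  have hΓ := Real.Gamma_pos_of_pos (half_pos hd)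
  have h2 : (volume : Measure E).real (Metric.ball 0 1) =
      Real.pi ^ ((finrank ℝ E : ℝ) / 2) / ((finrank ℝ E : ℝ) / 2 *
        Real.Gamma ((finrank ℝ E : ℝ) / 2)) := by
    rw [measureReal_def, InnerProductSpace.volume_ball, ENNReal.ofReal_one, one_pow, one_mul,
      Real.Gamma_add_one (by positivity), ENNReal.toReal_ofReal (by positivity),
      Real.sqrt_eq_rpow, ← Real.rpow_mul_natCast Real.pi_pos.le]
    ring_nf
  rw [h1, h2]
  simp only [smul_eq_mul, nsmul_eq_mul]
  field_simp

lemma integrable_norm_rpow_mul_gaussian [Nontrivial E] {p : ℝ} (hp : 0 ≤ p) :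
    Integrable fun z : E => ‖z‖ ^ p * Real.exp (-‖z‖ ^ 2) := by
  have hd : (0 : ℝ) < finrank ℝ E := Nat.cast_pos.2 finrank_pos
  rw [integrable_fun_norm_addHaar volume (f := fun r => r ^ p * Real.exp (-r ^ 2))]
  have := integrableOn_rpow_mul_exp_sq (p := (finrank ℝ E : ℝ) + p - 1) (by linarith) one_pos
  refine this.congr_fun (fun y hy => ?_) measurableSet_Ioi
  simp only [smul_eq_mul, ← mul_assoc, pow_finrank_sub_one_mul_rpow (E := E) (p := p) hy]
  simp

end GaussianAverages

/-! ### Ray integrals, their homogeneity and their upper bound. -/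

section Lines

variable {E : Type*} [NormedAddCommGroup E] [InnerProductSpace ℝ E]

/-- The smaller of the bounds of `δ(u,x,y)` given by semiconcavity and by the Lipschitz bound. -/
def capFun (C L : ℝ) (y : E) : ℝ := min (C * ‖y‖ ^ 2) (2 * L * ‖y‖)

lemma capFun_nonneg {C L : ℝ} (hC : 0 ≤ C) (hL : 0 ≤ L) (y : E) : 0 ≤ capFun C L y :=
  le_min (by positivity) (by positivity)

lemma continuous_capFun (C L : ℝ) : Continuous (capFun C L : E → ℝ) := by
  unfold capFun
  fun_prop

lemma integrableOn_Ioc_rpow {a c : ℝ} (ha : -1 < a) (hc : 0 ≤ c) :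
    IntegrableOn (fun τ : ℝ => τ ^ a) (Ioc 0 c) :=
  (intervalIntegrable_iff_integrableOn_Ioc_of_le hc).1 (intervalIntegral.intervalIntegrable_rpow' ha)

/-- The two bounds in the minimum cross at |y| = 2L/C. Since τ is the inverse distance, small τ is
the far region, where the linear bound is the smaller one. -/
lemma capFun_line_left {s C L : ℝ} (hL : 0 < L) {v : E} (hv : v ≠ 0) {τ : ℝ}
    (hτ : τ ∈ Ioc 0 (C * ‖v‖ / (2 * L))) :
    capFun C L (τ⁻¹ • v) * τ ^ (2 * s - 1) = 2 * L * ‖v‖ * τ ^ (2 * s - 2) := by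
  obtain ⟨h0, h1⟩ := hτ
  have hv' := norm_pos_iff.2 hv
  have h2 : τ ^ (2 * s - 1) = τ ^ (2 * s - 2) * τ := by
    rw [← Real.rpow_add_one h0.ne']; ring_nf
  rw [le_div_iff₀ (by positivity)] at h1
  rw [capFun, norm_smul, Real.norm_of_nonneg (by positivity), min_eq_right, h2]
  · field_simp
  · have : C * (τ⁻¹ * ‖v‖) ^ 2 = (C * ‖v‖) * (τ⁻¹ ^ 2 * ‖v‖) := by ring
    rw [this]
    calc 2 * L * (τ⁻¹ * ‖v‖) = (τ * (2 * L)) * (τ⁻¹ ^ 2 * ‖v‖) := by field_simp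
      _ ≤ _ := by gcongr

lemma capFun_line_right {s C L : ℝ} (hC : 0 < C) (hL : 0 < L) {v : E} (hv : v ≠ 0) {τ : ℝ}
    (hτ : τ ∈ Ioi (C * ‖v‖ / (2 * L))) :
    capFun C L (τ⁻¹ • v) * τ ^ (2 * s - 1) = C * ‖v‖ ^ 2 * τ ^ (2 * s - 3) := by
  have hv' := norm_pos_iff.2 hv
  have h1 : C * ‖v‖ / (2 * L) < τ := hτ
  have h0 : 0 < τ := lt_trans (by positivity) h1
  have h2 : τ ^ (2 * s - 1) = τ ^ (2 * s - 3) * τ ^ 2 := by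
    rw [← Real.rpow_add_natCast h0.ne']; push_cast; ring_nf
  rw [div_lt_iff₀ (by positivity)] at h1
  rw [capFun, norm_smul, Real.norm_of_nonneg (by positivity), min_eq_left, h2]
  · field_simp
  · have : C * (τ⁻¹ * ‖v‖) ^ 2 = (C * ‖v‖) * (τ⁻¹ ^ 2 * ‖v‖) := by ring
    rw [this]
    calc (C * ‖v‖) * (τ⁻¹ ^ 2 * ‖v‖) ≤ (τ * (2 * L)) * (τ⁻¹ ^ 2 * ‖v‖) := by gcongr
      _ = 2 * L * (τ⁻¹ * ‖v‖) := by field_simp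

lemma lineIntegrable_capFun {s C L : ℝ} (hs : 1 / 2 < s) (hs' : s < 1) (hC : 0 < C) (hL : 0 < L)
    (v : E) : LineIntegrable s (capFun C L) v := by
  by_cases hv : v = 0
  · simp [LineIntegrable, hv, capFun]
  have hv' := norm_pos_iff.2 hv
  have hc : 0 < C * ‖v‖ / (2 * L) := by positivity
  unfold LineIntegrable
  rw [← Ioc_union_Ioi_eq_Ioi hc.le]
  refine IntegrableOn.union ?_ ?_
  · refine IntegrableOn.congr_fun ?_ (fun τ hτ => (capFun_line_left hL hv hτ).symm)
      measurableSet_Ioc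
    exact (integrableOn_Ioc_rpow (by linarith) hc.le).const_mul _
  · refine IntegrableOn.congr_fun ?_ (fun τ hτ => (capFun_line_right hC hL hv hτ).symm)
      measurableSet_Ioi
    exact (integrableOn_Ioi_rpow_of_lt (by linarith) hc).const_mul _

/-- The constant `μ₁` is the integral over a ray of the bound for the second increment. -/
lemma lineOp_capFun {s C L : ℝ} (hs : 1 / 2 < s) (hs' : s < 1) (hC : 0 < C) (hL : 0 < L)
    (v : E) : lineOp s (capFun C L) v = ‖v‖ ^ (2 * s) * (mu1 s L C / (1 - s)) := by
  by_cases hv : v = 0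
  · have : (2 * s) ≠ 0 := by linarith
    simp [lineOp, hv, capFun, this]
  have hv' := norm_pos_iff.2 hv
  set c := C * ‖v‖ / (2 * L) with hcdef
  have hc : 0 < c := by positivity
  have h := lineIntegrable_capFun hs hs' hC hL v
  unfold LineIntegrable at h
  have hs1 : 2 * s - 1 ≠ 0 := by linarith
  have hs2 : 1 - s ≠ 0 := by linarith
  have hl : ∫ τ in Ioc 0 c, capFun C L (τ⁻¹ • v) * τ ^ (2 * s - 1) =
      2 * L * ‖v‖ * (c ^ (2 * s - 1) / (2 * s - 1)) := by
    rw [setIntegral_congr_fun measurableSet_Ioc (fun τ hτ => capFun_line_left hL hv hτ),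
      integral_const_mul, ← intervalIntegral.integral_of_le hc.le,
      integral_rpow (Or.inl (by linarith)), show 2 * s - 2 + 1 = 2 * s - 1 by ring,
      Real.zero_rpow hs1, sub_zero]
  have hr : ∫ τ in Ioi c, capFun C L (τ⁻¹ • v) * τ ^ (2 * s - 1) =
      C * ‖v‖ ^ 2 * (c ^ (2 * s - 2) / (2 - 2 * s)) := by
    rw [setIntegral_congr_fun measurableSet_Ioi (fun τ hτ => capFun_line_right hC hL hv hτ),
      integral_const_mul, integral_Ioi_rpow_of_lt (by linarith) hc,
      show 2 * s - 3 + 1 = 2 * s - 2 by ring, show 2 - 2 * s = -(2 * s - 2) by ring, div_neg,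
      neg_div]
  have hsplit : c ^ (2 * s - 1) = c ^ (2 * s - 2) * c := by
    rw [← Real.rpow_add_one hc.ne']; ring_nf
  have hpow : c ^ (2 * s - 2) = C ^ (2 * s - 2) * ‖v‖ ^ (2 * s - 2) * (2 * L) ^ (2 - 2 * s) := by
    rw [hcdef, Real.div_rpow (by positivity) (by positivity), Real.mul_rpow hC.le hv'.le,
      show 2 - 2 * s = -(2 * s - 2) by ring, Real.rpow_neg (by positivity), div_eq_mul_inv]
  have hv2 : ‖v‖ ^ (2 * s) = ‖v‖ ^ (2 * s - 2) * ‖v‖ ^ 2 := by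
    rw [← Real.rpow_add_natCast hv'.ne']; push_cast; ring_nf
  have h2L : (2 * L) ^ (2 - 2 * s) = 2 ^ (2 - 2 * s) * L ^ (2 - 2 * s) :=
    Real.mul_rpow zero_le_two hL.le
  have hC2 : (C / 2) ^ (2 * s - 1) = C ^ (2 * s - 2) * C * (2 ^ (2 - 2 * s) / 2) := by
    rw [Real.div_rpow hC.le zero_le_two, ← Real.rpow_add_one hC.ne',
      show 2 * s - 2 + 1 = 2 * s - 1 by ring, ← Real.rpow_sub_one two_ne_zero,
      show 2 - 2 * s - 1 = -(2 * s - 1) by ring, Real.rpow_neg zero_le_two, div_eq_mul_inv]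
  unfold lineOp
  rw [← Ioc_union_Ioi_eq_Ioi hc.le, setIntegral_union (Ioc_disjoint_Ioi le_rfl) measurableSet_Ioi
    (h.mono_set Ioc_subset_Ioi_self) (h.mono_set (Ioi_subset_Ioi hc.le)), hl, hr, hsplit, hpow,
    h2L, mu1, hC2, hv2]
  have hs3 : 2 - 2 * s ≠ 0 := by linarith
  rw [hcdef]
  generalize C ^ (2 * s - 2) = X
  generalize ‖v‖ ^ (2 * s - 2) = Y
  generalize (2 : ℝ) ^ (2 - 2 * s) = Z
  generalize L ^ (2 - 2 * s) = W
  rw [show 2 - 2 * s = 2 * (1 - s) by ring]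
  field_simp
  ring

variable [MeasurableSpace E] [BorelSpace E]

lemma measurable_line {s : ℝ} {G : E → ℝ} (hG : Measurable G) (v : E) :
    Measurable fun τ : ℝ => G (τ⁻¹ • v) * τ ^ (2 * s - 1) := by
  have : Measurable fun τ : ℝ => τ⁻¹ • v :=
    (continuous_id.smul continuous_const : Continuous fun t : ℝ => t • v).measurable.comp
      measurable_inv
  exact (hG.comp this).mul (by fun_prop)

lemma LineIntegrable.mono {s : ℝ} {G H : E → ℝ} {v : E} (hG : Measurable G)
    (hH : LineIntegrable s H v) (h : ∀ y, |G y| ≤ H y) : LineIntegrable s G v := by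
  refine Integrable.mono' hH (measurable_line hG v).aestronglyMeasurable ?_
  filter_upwards [ae_restrict_mem measurableSet_Ioi] with τ hτ
  have hτ : 0 < τ := hτ
  rw [norm_mul, Real.norm_of_nonneg (r := τ ^ _) (by positivity), Real.norm_eq_abs]
  gcongr
  exact h _

lemma lineOp_mono {s : ℝ} {G H : E → ℝ} {v : E} (hG : LineIntegrable s G v)
    (hH : LineIntegrable s H v) (h : ∀ y, G y ≤ H y) : lineOp s G v ≤ lineOp s H v := by
  refine setIntegral_mono_on hG hH measurableSet_Ioi fun τ hτ => ?_
  have hτ : 0 < τ := hτ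
  gcongr
  exact h _

lemma lineOp_smul {s : ℝ} (G : E → ℝ) (v : E) {c : ℝ} (hc : 0 < c) :
    lineOp s G (c • v) = c ^ (2 * s) * lineOp s G v := by
  have h := integral_comp_mul_left_Ioi (fun τ : ℝ => G (τ⁻¹ • c • v) * τ ^ (2 * s - 1)) 0 hc
  rw [mul_zero, smul_eq_mul, eq_inv_mul_iff_mul_eq₀ hc.ne'] at h
  have h1 : c ^ (2 * s) = c * c ^ (2 * s - 1) := by
    rw [mul_comm c, ← Real.rpow_add_one hc.ne']; ring_nf
  unfold lineOp
  rw [← h, h1, mul_assoc, ← integral_const_mul (c ^ (2 * s - 1))]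
  congr 1
  refine setIntegral_congr_fun measurableSet_Ioi fun τ hτ => ?_
  have hτ : 0 < τ := hτ
  rw [Real.mul_rpow hc.le hτ.le, smul_smul, mul_inv_rev, inv_mul_cancel_right₀ hc.ne']
  ring

lemma lineOp_smul_of_even {s : ℝ} (hs : 0 < s) {G : E → ℝ} (h0 : G 0 = 0)
    (he : ∀ y, G (-y) = G y) (v : E) (c : ℝ) :
    lineOp s G (c • v) = |c| ^ (2 * s) * lineOp s G v := by
  rcases lt_trichotomy c 0 with hc | rfl | hc
  · rw [abs_of_neg hc, ← lineOp_smul G v (neg_pos.2 hc)]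
    unfold lineOp
    congr 1
    ext τ
    rw [← he, ← smul_neg, neg_smul]
  · simp [lineOp, h0, hs.ne']
  · rw [abs_of_pos hc, lineOp_smul G v hc]

variable [FiniteDimensional ℝ E]

/-- Near the origin the quadratic bound needs s < 1; at infinity the linear bound needs s > 1/2. -/
lemma integrable_capFun_div [Nontrivial E] {s C L : ℝ} (hs : 1 / 2 < s) (hs' : s < 1)
    (hC : 0 < C) (hL : 0 < L) :
    Integrable fun z : E => capFun C L z / ‖z‖ ^ ((finrank ℝ E : ℝ) + 2 * s) := by
  have hd : 0 < finrank ℝ E := finrank_pos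
  unfold capFun
  rw [integrable_fun_norm_addHaar volume (f := fun r => min (C * r ^ 2) (2 * L * r) /
    r ^ ((finrank ℝ E : ℝ) + 2 * s)), ← Ioc_union_Ioi_eq_Ioi zero_le_one]
  have key : ∀ r : ℝ, 0 < r → r ^ (finrank ℝ E - 1) * (min (C * r ^ 2) (2 * L * r) /
      r ^ ((finrank ℝ E : ℝ) + 2 * s)) = min (C * r ^ 2) (2 * L * r) * r ^ (-1 - 2 * s) := by
    intro r hr
    rw [div_eq_mul_inv, ← Real.rpow_neg hr.le, mul_left_comm,
      pow_finrank_sub_one_mul_rpow (E := E) hr]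
    ring_nf
  have hm : Measurable fun r : ℝ => r ^ (finrank ℝ E - 1) • (min (C * r ^ 2) (2 * L * r) /
      r ^ ((finrank ℝ E : ℝ) + 2 * s)) := by
    simp only [smul_eq_mul]
    fun_prop
  refine IntegrableOn.union ?_ ?_
  · refine Integrable.mono' ((integrableOn_Ioc_rpow (a := 1 - 2 * s) (by linarith)
      zero_le_one).const_mul C) hm.aestronglyMeasurable ?_
    filter_upwards [ae_restrict_mem measurableSet_Ioc] with r hr
    have hr0 : 0 < r := hr.1
    rw [smul_eq_mul, key r hr0, Real.norm_of_nonneg (mul_nonneg (le_min (by positivity)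
      (by positivity)) (by positivity))]
    have : r ^ (1 - 2 * s) = r ^ 2 * r ^ (-1 - 2 * s) := by
      rw [mul_comm (r ^ 2), ← Real.rpow_add_natCast hr0.ne']; push_cast; ring_nf
    rw [this, ← mul_assoc]
    gcongr
    exact min_le_left _ _
  · refine Integrable.mono' ((integrableOn_Ioi_rpow_of_lt (a := - (2 * s)) (by linarith)
      one_pos).const_mul (2 * L)) hm.aestronglyMeasurable ?_
    filter_upwards [ae_restrict_mem measurableSet_Ioi] with r hr
    have hr0 : 0 < r := one_pos.trans hr
    rw [smul_eq_mul, key r hr0, Real.norm_of_nonneg (mul_nonneg (le_min (by positivity)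
      (by positivity)) (by positivity))]
    have : r ^ (-(2 * s)) = r * r ^ (-1 - 2 * s) := by
      rw [mul_comm r, ← Real.rpow_add_one hr0.ne']; ring_nf
    rw [this, ← mul_assoc]
    gcongr
    exact min_le_right _ _

/-- A function that is bounded by multiples of `|y|²` and of `|y|`. -/
def QuadLinBound (C : ℝ) (G : E → ℝ) : Prop := ∀ y, |G y| ≤ C * ‖y‖ ^ 2 ∧ |G y| ≤ C * ‖y‖

lemma QuadLinBound.le_capFun {C : ℝ} {G : E → ℝ} (h : QuadLinBound C G) (y : E) :
    |G y| ≤ capFun (max C 1) (max C 1 / 2) y := by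
  refine le_min ((h y).1.trans ?_) ((h y).2.trans ?_)
  · gcongr; exact le_max_left _ _
  · rw [mul_div_cancel₀ _ two_ne_zero]
    gcongr; exact le_max_left _ _

lemma integrable_div_of_abs_le {s : ℝ} {G H : E → ℝ} (hG : Measurable G)
    (hH : Integrable fun z : E => H z / ‖z‖ ^ ((finrank ℝ E : ℝ) + 2 * s))
    (h : ∀ y, |G y| ≤ H y) :
    Integrable fun z : E => G z / ‖z‖ ^ ((finrank ℝ E : ℝ) + 2 * s) := by
  refine hH.mono' (Measurable.aestronglyMeasurable (by fun_prop)) (Eventually.of_forall fun z => ?_)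
  rw [norm_div, Real.norm_of_nonneg (r := ‖z‖ ^ _) (Real.rpow_nonneg (norm_nonneg _) _),
    Real.norm_eq_abs]
  gcongr
  exact h z

lemma QuadLinBound.integrable_div [Nontrivial E] {s C : ℝ} (hs : 1 / 2 < s) (hs' : s < 1)
    {G : E → ℝ} (hG : Measurable G) (h : QuadLinBound C G) :
    Integrable fun z : E => G z / ‖z‖ ^ ((finrank ℝ E : ℝ) + 2 * s) :=
  integrable_div_of_abs_le hG (integrable_capFun_div hs hs' (C := max C 1) (L := max C 1 / 2)
    (by positivity) (by positivity)) h.le_capFun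

lemma QuadLinBound.lineIntegrable {s C : ℝ} (hs : 1 / 2 < s) (hs' : s < 1)
    {G : E → ℝ} (hG : Measurable G) (h : QuadLinBound C G) (v : E) : LineIntegrable s G v :=
  (lineIntegrable_capFun hs hs' (C := max C 1) (L := max C 1 / 2)
    (by positivity) (by positivity) v).mono hG h.le_capFun

/-- If `G` is a second increment of a semiconcave Lipschitz function, and is integrable against
the homogeneous kernel, then it is integrable along every ray. -/
lemma lineIntegrable_of_midpoint [Nontrivial E] {s C L : ℝ} (hs : 1 / 2 < s) (hs' : s < 1)
    (hC : 0 < C) (hL : 0 < L) {G : E → ℝ} (hG : Measurable G)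
    (h : Integrable fun z : E => G z / ‖z‖ ^ ((finrank ℝ E : ℝ) + 2 * s))
    (hle : ∀ y, G y ≤ capFun C L y)
    (hmid : ∀ y y', G (y + y') + G (y - y') ≤ 2 * G y + 2 * capFun C L y') (v : E) :
    LineIntegrable s G v := by
  have hae := ae_lineIntegrable (by linarith) hG h
  -- Translation and point reflection preserve null sets, so some y puts both v + y and v - y on
  -- good rays. The midpoint inequality then bounds G from below on the ray of v, and the cap bounds
  -- it from above.
  have h1 : ∀ᵐ y : E, LineIntegrable s G (v + y) :=
    (measurePreserving_add_left volume v).quasiMeasurePreserving.ae hae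
  have h2 : ∀ᵐ y : E, LineIntegrable s G (v - y) :=
    (Measure.measurePreserving_sub_left volume v).quasiMeasurePreserving.ae hae
  obtain ⟨y, hy1, hy2⟩ := (h1.and h2).exists
  have hcy := lineIntegrable_capFun hs hs' hC hL y
  have hcv := lineIntegrable_capFun hs hs' hC hL v
  refine Integrable.mono' ((((hy1.norm.add hy2.norm).const_mul (1 / 2)).add hcy).add hcv)
    (measurable_line hG v).aestronglyMeasurable ?_
  filter_upwards [ae_restrict_mem measurableSet_Ioi] with τ hτ
  have hτ : 0 < τ := hτ
  have hp : 0 < τ ^ (2 * s - 1) := by positivity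
  have h3 := hmid (τ⁻¹ • v) (τ⁻¹ • y)
  rw [← smul_add, ← smul_sub] at h3
  have h4 := hle (τ⁻¹ • v)
  have h5 := capFun_nonneg hC.le hL.le (τ⁻¹ • v)
  have h6 := capFun_nonneg hC.le hL.le (τ⁻¹ • y)
  have h7 := neg_abs_le (G (τ⁻¹ • (v + y)))
  have h8 := neg_abs_le (G (τ⁻¹ • (v - y)))
  have h9 := abs_nonneg (G (τ⁻¹ • (v + y)))
  have h10 := abs_nonneg (G (τ⁻¹ • (v - y)))
  simp only [Pi.add_apply, norm_mul, Real.norm_eq_abs, abs_of_pos hp]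
  have : |G (τ⁻¹ • v)| ≤ 1 / 2 * (|G (τ⁻¹ • (v + y))| + |G (τ⁻¹ • (v - y))|) +
      capFun C L (τ⁻¹ • y) + capFun C L (τ⁻¹ • v) := by
    rw [abs_le]
    constructor <;> linarith
  calc |G (τ⁻¹ • v)| * τ ^ (2 * s - 1) ≤ (1 / 2 * (|G (τ⁻¹ • (v + y))| + |G (τ⁻¹ • (v - y))|) +
      capFun C L (τ⁻¹ • y) + capFun C L (τ⁻¹ • v)) * τ ^ (2 * s - 1) := by gcongr
    _ = _ := by ring

end Lines

/-! ### Gaussian moments along and across a direction, and averages over elongated ellipsoids. -/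

section Marginals

variable {E : Type*} [NormedAddCommGroup E] [InnerProductSpace ℝ E] [FiniteDimensional ℝ E]
  [MeasurableSpace E] [BorelSpace E]

lemma norm_sq_eq_inner_sq_add {e : E} (he : ‖e‖ = 1) (z : E) :
    ‖z‖ ^ 2 = |⟪e, z⟫| ^ 2 + ‖z - ⟪e, z⟫ • e‖ ^ 2 := by
  rw [norm_sub_sq_real, norm_smul, he, inner_smul_right, real_inner_comm, sq_abs, mul_one,
    Real.norm_eq_abs, sq_abs, real_inner_comm]
  ring

/-- Fubini for a function of the components of a vector along and across a unit vector. -/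
lemma integral_along_mul_across {e : E} (he : ‖e‖ = 1) (f g : ℝ → ℝ) :
    ∫ z : E, f |⟪e, z⟫| * g ‖z - ⟪e, z⟫ • e‖ =
      (∫ x : (ℝ ∙ e : Submodule ℝ E), f ‖x‖) * ∫ y : (ℝ ∙ e : Submodule ℝ E)ᗮ, g ‖y‖ := by
  set K : Submodule ℝ E := ℝ ∙ e
  have h1 : MeasurePreserving (fun z => WithLp.ofLp (K.orthogonalDecomposition z)) :=
    (WithLp.volume_preserving_ofLp K Kᗮ).comp K.orthogonalDecomposition.measurePreserving
  have h2 : MeasurableEmbedding (fun z => WithLp.ofLp (K.orthogonalDecomposition z)) :=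
    (MeasurableEquiv.toLp 2 (K × Kᗮ)).symm.measurableEmbedding.comp
      K.orthogonalDecomposition.toHomeomorph.measurableEmbedding
  rw [← integral_prod_mul, ← Measure.volume_eq_prod,
    ← h1.integral_comp h2 fun p : K × Kᗮ => f ‖p.1‖ * g ‖p.2‖]
  congr 1
  ext z
  have h3 : ((K.orthogonalProjectionOnto z : K) : E) = ⟪e, z⟫ • e :=
    Submodule.starProjection_unit_singleton ℝ he z
  have h4 : ((Kᗮ.orthogonalProjectionOnto z : Kᗮ) : E) = z - ⟪e, z⟫ • e := by
    have := Submodule.starProjection_orthogonal_val (K := K) z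
    rw [← Submodule.starProjection_unit_singleton ℝ he z]
    exact this
  simp only [Submodule.orthogonalDecomposition_apply]
  rw [Submodule.coe_norm, Submodule.coe_norm, h3, h4, norm_smul, he, mul_one,
    Real.norm_eq_abs]

lemma finrank_span_unit {e : E} (he : ‖e‖ = 1) : finrank ℝ (ℝ ∙ e : Submodule ℝ E) = 1 :=
  finrank_span_singleton (by rintro rfl; simp at he)

lemma finrank_orthogonal_unit {e : E} (he : ‖e‖ = 1) :
    finrank ℝ (ℝ ∙ e : Submodule ℝ E)ᗮ = finrank ℝ E - 1 := by
  have := (ℝ ∙ e : Submodule ℝ E).finrank_add_finrank_orthogonal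
  rw [finrank_span_unit he] at this
  omega

lemma integral_gaussian_line {e : E} (he : ‖e‖ = 1) {p : ℝ} (hp : 0 ≤ p) :
    ∫ x : (ℝ ∙ e : Submodule ℝ E), ‖x‖ ^ p * Real.exp (-‖x‖ ^ 2) = Real.Gamma ((1 + p) / 2) := by
  have : Nontrivial (ℝ ∙ e : Submodule ℝ E) :=
    nontrivial_of_finrank_pos (R := ℝ) (by rw [finrank_span_unit he]; exact one_pos)
  rw [integral_norm_rpow_mul_gaussian hp, finrank_span_unit he, Nat.cast_one,
    Real.Gamma_one_half_eq, ← Real.sqrt_eq_rpow,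
    mul_div_cancel_left₀ _ (Real.sqrt_pos.2 Real.pi_pos).ne']

lemma integral_gaussian_hyperplane (hd : 2 ≤ finrank ℝ E) {e : E} (he : ‖e‖ = 1) {p : ℝ}
    (hp : 0 ≤ p) :
    ∫ x : (ℝ ∙ e : Submodule ℝ E)ᗮ, ‖x‖ ^ p * Real.exp (-‖x‖ ^ 2) =
      Real.pi ^ (((finrank ℝ E : ℝ) - 1) / 2) * Real.Gamma (((finrank ℝ E : ℝ) - 1 + p) / 2) /
        Real.Gamma (((finrank ℝ E : ℝ) - 1) / 2) := by
  have : Nontrivial (ℝ ∙ e : Submodule ℝ E)ᗮ :=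
    nontrivial_of_finrank_pos (R := ℝ) (by rw [finrank_orthogonal_unit he]; omega)
  rw [integral_norm_rpow_mul_gaussian hp, finrank_orthogonal_unit he, Nat.cast_pred (by omega)]

/-- Moments of the Gaussian along a unit vector. -/
lemma integral_along_rpow_mul_gaussian (hd : 2 ≤ finrank ℝ E) {e : E} (he : ‖e‖ = 1) {p : ℝ}
    (hp : 0 ≤ p) :
    ∫ z : E, |⟪e, z⟫| ^ p * Real.exp (-‖z‖ ^ 2) =
      Real.pi ^ (((finrank ℝ E : ℝ) - 1) / 2) * Real.Gamma ((1 + p) / 2) := by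
  have h := integral_along_mul_across he (fun r => r ^ p * Real.exp (-r ^ 2))
    (fun r => r ^ (0 : ℝ) * Real.exp (-r ^ 2))
  have hd' : (2 : ℝ) ≤ finrank ℝ E := by exact_mod_cast hd
  have hΓ : Real.Gamma (((finrank ℝ E : ℝ) - 1) / 2) ≠ 0 :=
    (Real.Gamma_pos_of_pos (by linarith)).ne'
  rw [integral_gaussian_line he hp, integral_gaussian_hyperplane hd he le_rfl, add_zero,
    mul_div_cancel_right₀ _ hΓ] at h
  rw [mul_comm (Real.pi ^ _), ← h]
  congr 1
  ext z
  rw [norm_sq_eq_inner_sq_add he z, neg_add, Real.exp_add, Real.rpow_zero]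
  ring

/-- Moments of the Gaussian across a unit vector. -/
lemma integral_across_rpow_mul_gaussian (hd : 2 ≤ finrank ℝ E) {e : E} (he : ‖e‖ = 1) {p : ℝ}
    (hp : 0 ≤ p) :
    ∫ z : E, ‖z - ⟪e, z⟫ • e‖ ^ p * Real.exp (-‖z‖ ^ 2) =
      √Real.pi * (Real.pi ^ (((finrank ℝ E : ℝ) - 1) / 2) *
        Real.Gamma (((finrank ℝ E : ℝ) - 1 + p) / 2) /
        Real.Gamma (((finrank ℝ E : ℝ) - 1) / 2)) := by
  have h := integral_along_mul_across he (fun r => r ^ (0 : ℝ) * Real.exp (-r ^ 2))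
    (fun r => r ^ p * Real.exp (-r ^ 2))
  rw [integral_gaussian_line he le_rfl, integral_gaussian_hyperplane hd he hp, add_zero,
    Real.Gamma_one_half_eq] at h
  rw [← h]
  congr 1
  ext z
  rw [norm_sq_eq_inner_sq_add he z, neg_add, Real.exp_add, Real.rpow_zero]
  ring

lemma norm_across_le {e : E} (he : ‖e‖ = 1) (z : E) : ‖z - ⟪e, z⟫ • e‖ ≤ ‖z‖ := by
  refine le_of_sq_le_sq ?_ (norm_nonneg _)
  rw [norm_sq_eq_inner_sq_add he z]
  nlinarith [sq_nonneg |⟪e, z⟫|]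

lemma abs_along_le {e : E} (he : ‖e‖ = 1) (z : E) : |⟪e, z⟫| ≤ ‖z‖ := by
  simpa [he] using abs_real_inner_le_norm e z

lemma integrable_along_rpow_mul_gaussian [Nontrivial E] {e : E} (he : ‖e‖ = 1) {p : ℝ}
    (hp : 0 ≤ p) : Integrable fun z : E => |⟪e, z⟫| ^ p * Real.exp (-‖z‖ ^ 2) := by
  refine (integrable_norm_rpow_mul_gaussian hp).mono'
    (Measurable.aestronglyMeasurable (by fun_prop)) (Eventually.of_forall fun z => ?_)
  rw [Real.norm_of_nonneg (by positivity)]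
  gcongr
  exact abs_along_le he z

lemma integrable_across_rpow_mul_gaussian [Nontrivial E] {e : E} (he : ‖e‖ = 1) {p : ℝ}
    (hp : 0 ≤ p) : Integrable fun z : E => ‖z - ⟪e, z⟫ • e‖ ^ p * Real.exp (-‖z‖ ^ 2) := by
  refine (integrable_norm_rpow_mul_gaussian hp).mono'
    (Measurable.aestronglyMeasurable (by fun_prop)) (Eventually.of_forall fun z => ?_)
  rw [Real.norm_of_nonneg (by positivity)]
  gcongr
  exact norm_across_le he z

/-- The Gaussian average of `|⟨e,z⟩|^p` does not depend on the unit vector `e`. -/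
lemma integral_along_eq {e e' : E} (he : ‖e‖ = 1) (he' : ‖e'‖ = 1) (p : ℝ) :
    ∫ z : E, |⟪e, z⟫| ^ p * Real.exp (-‖z‖ ^ 2) =
      ∫ z : E, |⟪e', z⟫| ^ p * Real.exp (-‖z‖ ^ 2) := by
  set T := (ℝ ∙ (e - e') : Submodule ℝ E)ᗮ.reflection
  have hT : T e = e' := Submodule.reflection_sub (he.trans he'.symm)
  rw [← T.measurePreserving.integral_comp T.toHomeomorph.measurableEmbedding
    fun z : E => |⟪e', z⟫| ^ p * Real.exp (-‖z‖ ^ 2)]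
  simp_rw [← hT, T.inner_map_map, T.norm_map]

lemma rpow_sum_le_sum_rpow {ι : Type*} (t : Finset ι) (f : ι → ℝ) (hf : ∀ i, 0 ≤ f i) {p : ℝ}
    (hp : 0 < p) (hp1 : p ≤ 1) : (∑ i ∈ t, f i) ^ p ≤ ∑ i ∈ t, f i ^ p := by
  classical
  induction t using Finset.induction_on with
  | empty => simp [hp.ne']
  | insert a t ha ih =>
    rw [Finset.sum_insert ha, Finset.sum_insert ha]
    exact (Real.rpow_add_le_add_rpow (hf a) (Finset.sum_nonneg fun i _ => hf i) hp.le hp1).trans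
      (by gcongr)

/-- A unit vector carries at least its share of the radial moment of the Gaussian. -/
lemma integral_norm_le_mul_integral_along [Nontrivial E] {s : ℝ} (hs : 0 < s) (hs' : s ≤ 1) {e : E}
    (he : ‖e‖ = 1) :
    ∫ z : E, ‖z‖ ^ (2 * s) * Real.exp (-‖z‖ ^ 2) ≤
      finrank ℝ E * ∫ z : E, |⟪e, z⟫| ^ (2 * s) * Real.exp (-‖z‖ ^ 2) := by
  set b := stdOrthonormalBasis ℝ E
  have hs2 : 0 ≤ 2 * s := by linarith
  -- Since s ≤ 1, the power t ↦ t^s is subadditive; it is applied to the sum of squared coordinates.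
  have h1 : ∀ z : E, ‖z‖ ^ (2 * s) ≤ ∑ i, |⟪b i, z⟫| ^ (2 * s) := by
    intro z
    calc ‖z‖ ^ (2 * s) = (∑ i, ‖⟪b i, z⟫‖ ^ 2) ^ s := by
          rw [b.sum_sq_norm_inner_right, Real.rpow_mul (norm_nonneg z), Real.rpow_two]
      _ ≤ ∑ i, (‖⟪b i, z⟫‖ ^ 2) ^ s :=
          rpow_sum_le_sum_rpow _ _ (fun i => by positivity) hs hs'
      _ = _ := by
          refine Finset.sum_congr rfl fun i _ => ?_
          rw [Real.norm_eq_abs, Real.rpow_mul (abs_nonneg _), Real.rpow_two]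
  have hint : ∀ i ∈ Finset.univ, Integrable fun z : E =>
      |⟪b i, z⟫| ^ (2 * s) * Real.exp (-‖z‖ ^ 2) := fun i _ =>
    integrable_along_rpow_mul_gaussian (b.norm_eq_one i) hs2
  calc ∫ z : E, ‖z‖ ^ (2 * s) * Real.exp (-‖z‖ ^ 2)
      ≤ ∫ z : E, ∑ i, |⟪b i, z⟫| ^ (2 * s) * Real.exp (-‖z‖ ^ 2) := by
        refine integral_mono (integrable_norm_rpow_mul_gaussian hs2)
          (integrable_finsetSum _ hint) fun z => ?_
        simp only [← Finset.sum_mul]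
        gcongr
        exact h1 z
    _ = ∑ i, ∫ z : E, |⟪b i, z⟫| ^ (2 * s) * Real.exp (-‖z‖ ^ 2) := integral_finsetSum _ hint
    _ = ∑ _i : Fin (finrank ℝ E), ∫ z : E, |⟪e, z⟫| ^ (2 * s) * Real.exp (-‖z‖ ^ 2) :=
        Finset.sum_congr rfl fun i _ => integral_along_eq (b.norm_eq_one i) he _
    _ = _ := by simp

lemma integral_norm_rpow_mul_gaussian_pos [Nontrivial E] {p : ℝ} (hp : 0 ≤ p) :
    0 < ∫ z : E, ‖z‖ ^ p * Real.exp (-‖z‖ ^ 2) := by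
  have hd : (0 : ℝ) < finrank ℝ E := Nat.cast_pos.2 finrank_pos
  rw [integral_norm_rpow_mul_gaussian hp]
  have h1 := Real.Gamma_pos_of_pos (half_pos hd)
  have h2 : 0 < Real.Gamma (((finrank ℝ E : ℝ) + p) / 2) := Real.Gamma_pos_of_pos (by positivity)
  have := Real.pi_pos
  positivity

lemma integral_along_pos [Nontrivial E] {s : ℝ} (hs : 0 < s) (hs' : s ≤ 1) {e : E}
    (he : ‖e‖ = 1) : 0 < ∫ z : E, |⟪e, z⟫| ^ (2 * s) * Real.exp (-‖z‖ ^ 2) := by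
  have h1 := integral_norm_le_mul_integral_along hs hs' he
  have h2 := integral_norm_rpow_mul_gaussian_pos (E := E) (p := 2 * s) (by linarith)
  have hd : (0 : ℝ) < finrank ℝ E := Nat.cast_pos.2 finrank_pos
  exact pos_of_mul_pos_right (h2.trans_le h1) hd.le

/-- The linear map that stretches by `l` along the unit vector `e` and by `b` across it. -/
def stretch (e : E) (l b : ℝ) (z : E) : E := (l * ⟪e, z⟫) • e + b • (z - ⟪e, z⟫ • e)

lemma stretch_smul (e : E) (l b t : ℝ) (z : E) : stretch e l b (t • z) = t • stretch e l b z := by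
  simp only [stretch, inner_smul_right]
  module

lemma continuous_stretch (e : E) (l b : ℝ) : Continuous (stretch e l b) := by
  unfold stretch
  fun_prop

/-- The midpoint inequality for G is integrated over the parallel family τ⁻¹y, τ⁻¹y'. The error is
the ray integral of the cap, hence a power of |y'| with the constant μ₁. -/
lemma lineOp_midpoint {s C L : ℝ} (hs : 1 / 2 < s) (hs' : s < 1) (hC : 0 < C) (hL : 0 < L)
    {G : E → ℝ} (hmid : ∀ y y', G (y + y') + G (y - y') ≤ 2 * G y + 2 * capFun C L y')
    (hline : ∀ v, LineIntegrable s G v) (y y' : E) :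
    lineOp s G (y + y') + lineOp s G (y - y') ≤
      2 * lineOp s G y + 2 * (‖y'‖ ^ (2 * s) * (mu1 s L C / (1 - s))) := by
  rw [← lineOp_capFun hs hs' hC hL y']
  unfold lineOp
  rw [← integral_add (hline _) (hline _), ← integral_const_mul, ← integral_const_mul,
    ← integral_add ((hline _).const_mul _)
      ((lineIntegrable_capFun hs hs' hC hL y').const_mul _)]
  refine setIntegral_mono_on ((hline _).add (hline _)) (((hline _).const_mul _).add
      ((lineIntegrable_capFun hs hs' hC hL y').const_mul _)) measurableSet_Ioi fun τ hτ => ?_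
  have hτ : 0 < τ := hτ
  rw [← add_mul, smul_add, smul_sub]
  calc _ ≤ (2 * G (τ⁻¹ • y) + 2 * capFun C L (τ⁻¹ • y')) * τ ^ (2 * s - 1) :=
        mul_le_mul_of_nonneg_right (hmid _ _) (by positivity)
    _ = _ := by ring

/-- The main estimate: the average of `G` over the ellipsoids elongated along `e` is controlled by
the integral of `G` over the ray through `e`. -/
lemma average_stretch_le (hd : 2 ≤ finrank ℝ E) {s C L : ℝ} (hs : 1 / 2 < s) (hs' : s < 1)
    (hC : 0 < C) (hL : 0 < L) {G : E → ℝ} (hG : Measurable G) (h0 : G 0 = 0)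
    (heven : ∀ y, G (-y) = G y)
    (hmid : ∀ y y', G (y + y') + G (y - y') ≤ 2 * G y + 2 * capFun C L y')
    (hline : ∀ v, LineIntegrable s G v) {e : E} (he : ‖e‖ = 1) {l b : ℝ} (hl : 0 < l) (hb : 0 < b)
    (hint : Integrable fun z => G (stretch e l b z) / ‖z‖ ^ ((finrank ℝ E : ℝ) + 2 * s)) :
    Real.Gamma ((finrank ℝ E : ℝ) / 2 + s) *
        (1 / 2 * ∫ z, G (stretch e l b z) / ‖z‖ ^ ((finrank ℝ E : ℝ) + 2 * s)) ≤
      l ^ (2 * s) * lineOp s G e *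
          (Real.pi ^ (((finrank ℝ E : ℝ) - 1) / 2) * Real.Gamma (s + 1 / 2)) +
        b ^ (2 * s) * (mu1 s L C / (1 - s)) *
          (√Real.pi * (Real.pi ^ (((finrank ℝ E : ℝ) - 1) / 2) *
            Real.Gamma (((finrank ℝ E : ℝ) - 1) / 2 + s) /
            Real.Gamma (((finrank ℝ E : ℝ) - 1) / 2))) := by
  have : Nontrivial E := nontrivial_of_finrank_pos (R := ℝ) (by omega)
  have hs0 : 0 < s := by linarith
  set D := stretch e l b
  have hGD : Measurable fun z => G (D z) := hG.comp (continuous_stretch e l b).measurable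
  have hlineD : ∀ z, lineOp s (fun z => G (D z)) z = lineOp s G (D z) := by
    intro z
    simp only [lineOp, D, stretch_smul]
  have h1 := integral_lineOp_mul_gaussian hs0 hGD hint
  have h2 := integrable_lineOp_mul_gaussian hs0 hGD hint
  simp only [hlineD] at h1 h2
  -- Reflection in the line of e preserves the Gaussian and flips only the component across e.
  -- Averaging over z and Tz therefore produces the two outer points of the midpoint inequality,
  -- centred at (l⟨e,z⟩)e.
  set T := (ℝ ∙ e : Submodule ℝ E).reflection
  have hT : ∀ z, T z = (2 * ⟪e, z⟫) • e - z := by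
    intro z
    simp [T, Submodule.reflection_apply, Submodule.starProjection_unit_singleton ℝ he, mul_smul,
      two_smul]
  have hee : ⟪e, e⟫ = 1 := by rw [real_inner_self_eq_norm_sq, he, one_pow]
  have hDT : ∀ z, D (T z) = (l * ⟪e, z⟫) • e - b • (z - ⟪e, z⟫ • e) := by
    intro z
    have : ⟪e, T z⟫ = ⟪e, z⟫ := by
      rw [hT, inner_sub_right, inner_smul_right, hee]; ring
    simp only [D, stretch, this]
    rw [hT]
    module
  have h3 : ∫ z, lineOp s G (D (T z)) * Real.exp (-‖z‖ ^ 2) =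
      ∫ z, lineOp s G (D z) * Real.exp (-‖z‖ ^ 2) := by
    rw [← T.measurePreserving.integral_comp T.toHomeomorph.measurableEmbedding
      fun z => lineOp s G (D z) * Real.exp (-‖z‖ ^ 2)]
    simp_rw [T.norm_map]
  have h4 : Integrable fun z => lineOp s G (D (T z)) * Real.exp (-‖z‖ ^ 2) := by
    have := (T.measurePreserving.integrable_comp_emb T.toHomeomorph.measurableEmbedding).2 h2
    refine this.congr (Eventually.of_forall fun z => ?_)
    simp only [Function.comp, T.norm_map]
  have hI1 := integral_along_rpow_mul_gaussian hd he (p := 2 * s) (by linarith)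
  have hI2 := integral_across_rpow_mul_gaussian hd he (p := 2 * s) (by linarith)
  have hi1 := integrable_along_rpow_mul_gaussian he (p := 2 * s) (by linarith)
  have hi2 := integrable_across_rpow_mul_gaussian he (p := 2 * s) (by linarith)
  have key : ∫ z, (lineOp s G (D z) * Real.exp (-‖z‖ ^ 2) +
        lineOp s G (D (T z)) * Real.exp (-‖z‖ ^ 2)) ≤
      ∫ z : E, (2 * (l ^ (2 * s) * lineOp s G e) *
          (|⟪e, z⟫| ^ (2 * s) * Real.exp (-‖z‖ ^ 2)) +
        2 * (b ^ (2 * s) * (mu1 s L C / (1 - s))) *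
          (‖z - ⟪e, z⟫ • e‖ ^ (2 * s) * Real.exp (-‖z‖ ^ 2))) := by
    refine integral_mono (h2.add h4) ((hi1.const_mul _).add (hi2.const_mul _)) fun z => ?_
    -- The centre is a multiple of e, so by evenness and homogeneity its ray integral is
    -- |l⟨e,z⟩|^(2s) times that of e. Only the moments along and across e remain to be integrated.
    have h5 := lineOp_midpoint hs hs' hC hL hmid hline ((l * ⟪e, z⟫) • e)
      (b • (z - ⟪e, z⟫ • e))
    rw [← hDT, lineOp_smul_of_even hs0 h0 heven, norm_smul, abs_mul, abs_of_pos hl,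
      Real.norm_of_nonneg hb.le, Real.mul_rpow hl.le (abs_nonneg _),
      Real.mul_rpow hb.le (norm_nonneg _)] at h5
    have h6 := mul_le_mul_of_nonneg_right h5 (Real.exp_pos (-‖z‖ ^ 2)).le
    change (lineOp s G (D z) + lineOp s G (D (T z))) * _ ≤ _ at h6
    simp only
    linarith
  rw [integral_add h2 h4, integral_add (hi1.const_mul _) (hi2.const_mul _), integral_const_mul,
    integral_const_mul, h3, hI1, hI2, h1] at key
  rw [show (1 + 2 * s) / 2 = s + 1 / 2 by ring,
    show ((finrank ℝ E : ℝ) - 1 + 2 * s) / 2 = ((finrank ℝ E : ℝ) - 1) / 2 + s by ring] at key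
  linarith

end Marginals

/-! ### The operators L_A as Gaussian averages; eigenvalues and stretching matrices. -/

section MatrixAverages

variable {n : ℕ}

lemma det_toEuclideanLin (A : Matrix (Fin n) (Fin n) ℝ) :
    LinearMap.det (Matrix.toEuclideanLin A) = A.det := by
  rw [Matrix.toEuclideanLin, Matrix.toLpLin_eq_toLin, LinearMap.det_toLin]

lemma continuous_toEuclideanLin (A : Matrix (Fin n) (Fin n) ℝ) :
    Continuous (Matrix.toEuclideanLin A) :=
  LinearMap.continuous_of_finiteDimensional _

lemma toEuclideanLin_inv_apply {A : Matrix (Fin n) (Fin n) ℝ} (hA : A.det = 1) (z : EuclideanSpace ℝ (Fin n)) :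
    Matrix.toEuclideanLin A⁻¹ (Matrix.toEuclideanLin A z) = z := by
  ext i
  simp only [Matrix.ofLp_toLpLin, Matrix.toLin'_apply, Matrix.mulVec_mulVec]
  rw [Matrix.nonsing_inv_mul _ (by simp [hA]), Matrix.one_mulVec]

lemma measurePreserving_toEuclideanLin {A : Matrix (Fin n) (Fin n) ℝ} (hA : A.det = 1) :
    MeasurePreserving (Matrix.toEuclideanLin A) (volume : Measure (EuclideanSpace ℝ (Fin n))) volume := by
  refine ⟨(continuous_toEuclideanLin A).measurable, ?_⟩
  rw [Measure.map_linearMap_addHaar_eq_smul_addHaar _ (by simp [hA]),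
    det_toEuclideanLin, hA]
  simp

lemma measurableEmbedding_toEuclideanLin {A : Matrix (Fin n) (Fin n) ℝ} (hA : A.det = 1) :
    MeasurableEmbedding (Matrix.toEuclideanLin A : EuclideanSpace ℝ (Fin n) → EuclideanSpace ℝ (Fin n)) :=
  (continuous_toEuclideanLin A).measurableEmbedding
    (Function.LeftInverse.injective (toEuclideanLin_inv_apply hA))

variable {s : ℝ} {A : Matrix (Fin n) (Fin n) ℝ} {u : EuclideanSpace ℝ (Fin n) → ℝ} {x : EuclideanSpace ℝ (Fin n)}

lemma integrand_toEuclideanLin (hA : A.det = 1) (z : EuclideanSpace ℝ (Fin n)) :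
    integrand s A u x (Matrix.toEuclideanLin A z) =
      secondIncr u x (Matrix.toEuclideanLin A z) / ‖z‖ ^ ((finrank ℝ (EuclideanSpace ℝ (Fin n)) : ℝ) + 2 * s) := by
  rw [integrand, toEuclideanLin_inv_apply hA, finrank_euclideanSpace_fin]

lemma integrable_integrand_iff (hA : A.det = 1) :
    Integrable (integrand s A u x) ↔ Integrable fun z : EuclideanSpace ℝ (Fin n) =>
      secondIncr u x (Matrix.toEuclideanLin A z) / ‖z‖ ^ ((finrank ℝ (EuclideanSpace ℝ (Fin n)) : ℝ) + 2 * s) := by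
  rw [← (measurePreserving_toEuclideanLin hA).integrable_comp_emb
    (measurableEmbedding_toEuclideanLin hA)]
  exact integrable_congr (Eventually.of_forall fun z => integrand_toEuclideanLin hA z)

lemma linOp_eq (hA : A.det = 1) :
    linOp s A u x = 1 / 2 * ∫ z : EuclideanSpace ℝ (Fin n),
      secondIncr u x (Matrix.toEuclideanLin A z) / ‖z‖ ^ ((finrank ℝ (EuclideanSpace ℝ (Fin n)) : ℝ) + 2 * s) := by
  rw [linOp, ← (measurePreserving_toEuclideanLin hA).integral_comp
    (measurableEmbedding_toEuclideanLin hA)]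
  simp only [integrand_toEuclideanLin hA]

lemma measurable_secondIncr (hu : Measurable u) (x : EuclideanSpace ℝ (Fin n)) : Measurable (secondIncr u x) := by
  unfold secondIncr
  fun_prop

lemma secondIncr_zero (u : EuclideanSpace ℝ (Fin n) → ℝ) (x : EuclideanSpace ℝ (Fin n)) : secondIncr u x 0 = 0 := by
  simp [secondIncr]; ring

lemma secondIncr_neg (u : EuclideanSpace ℝ (Fin n) → ℝ) (x y : EuclideanSpace ℝ (Fin n)) : secondIncr u x (-y) = secondIncr u x y := by
  simp only [secondIncr, sub_neg_eq_add, ← sub_eq_add_neg]; ring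

lemma lineOp_comp_toEuclideanLin (G : EuclideanSpace ℝ (Fin n) → ℝ) (A : Matrix (Fin n) (Fin n) ℝ) (z : EuclideanSpace ℝ (Fin n)) :
    lineOp s (fun z => G (Matrix.toEuclideanLin A z)) z = lineOp s G (Matrix.toEuclideanLin A z) := by
  simp only [lineOp, map_smul]

lemma integrable_lineOp_toEuclideanLin [NeZero n] (hs : 0 < s) (hu : Measurable u)
    (hA : A.det = 1) (h : Integrable (integrand s A u x)) :
    Integrable fun z : EuclideanSpace ℝ (Fin n) =>
      lineOp s (secondIncr u x) (Matrix.toEuclideanLin A z) * Real.exp (-‖z‖ ^ 2) := by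
  simp only [← lineOp_comp_toEuclideanLin]
  exact integrable_lineOp_mul_gaussian hs
    ((measurable_secondIncr hu x).comp (continuous_toEuclideanLin A).measurable)
    ((integrable_integrand_iff hA).1 h)

/-- `L_A u(x)` is a Gaussian average of the integrals over the rays. -/
lemma gamma_mul_linOp [NeZero n] (hs : 0 < s) (hu : Measurable u)
    (hA : A.det = 1) (h : Integrable (integrand s A u x)) :
    Real.Gamma ((n : ℝ) / 2 + s) * linOp s A u x = ∫ z : EuclideanSpace ℝ (Fin n),
      lineOp s (secondIncr u x) (Matrix.toEuclideanLin A z) * Real.exp (-‖z‖ ^ 2) := by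
  simp only [← lineOp_comp_toEuclideanLin]
  rw [integral_lineOp_mul_gaussian
    (G := fun z => secondIncr u x (Matrix.toEuclideanLin A z)) hs
    ((measurable_secondIncr hu x).comp (continuous_toEuclideanLin A).measurable)
    ((integrable_integrand_iff hA).1 h), linOp_eq hA, finrank_euclideanSpace_fin]
  ring

lemma inner_eigenvector (hA : A.IsHermitian) (i : Fin n) (z : EuclideanSpace ℝ (Fin n)) :
    ⟪hA.eigenvectorBasis i, Matrix.toEuclideanLin A z⟫ =
      hA.eigenvalues i * ⟪hA.eigenvectorBasis i, z⟫ := by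
  have h1 := Matrix.isSymmetric_toEuclideanLin_iff.2 hA (hA.eigenvectorBasis i) z
  have h2 : Matrix.toEuclideanLin A (hA.eigenvectorBasis i) =
      hA.eigenvalues i • hA.eigenvectorBasis i := by
    ext j
    have := congrFun (hA.mulVec_eigenvectorBasis i) j
    simpa using this
  rw [← h1, h2, inner_smul_left]
  simp

lemma eigenvalue_mul_le_norm (hA : A.PosDef) (i : Fin n) (z : EuclideanSpace ℝ (Fin n)) :
    hA.isHermitian.eigenvalues i * |⟪hA.isHermitian.eigenvectorBasis i, z⟫| ≤
      ‖Matrix.toEuclideanLin A z‖ := by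
  have h := abs_along_le (hA.isHermitian.eigenvectorBasis.norm_eq_one i)
    (Matrix.toEuclideanLin A z)
  rwa [inner_eigenvector, abs_mul, abs_of_pos (hA.eigenvalues_pos i)] at h

/-- A positive lower bound over rays gives a lower bound of `L_A u(x)` that grows with the
eigenvalues of `A`. -/
lemma le_gamma_mul_linOp [NeZero n] (hs : 0 < s) (hu : Measurable u) (hA : A.PosDef)
    (hdet : A.det = 1) (h : Integrable (integrand s A u x)) {q : ℝ} (hq : 0 ≤ q)
    (hlow : ∀ v, q * ‖v‖ ^ (2 * s) ≤ lineOp s (secondIncr u x) v) {e : EuclideanSpace ℝ (Fin n)} (he : ‖e‖ = 1)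
    (i : Fin n) :
    q * hA.isHermitian.eigenvalues i ^ (2 * s) *
        (∫ z : EuclideanSpace ℝ (Fin n), |⟪e, z⟫| ^ (2 * s) * Real.exp (-‖z‖ ^ 2)) ≤
      Real.Gamma ((n : ℝ) / 2 + s) * linOp s A u x := by
  have hs2 : 0 ≤ 2 * s := by linarith
  have hei := hA.isHermitian.eigenvectorBasis.norm_eq_one i
  rw [gamma_mul_linOp hs hu hdet h, integral_along_eq he hei, ← integral_const_mul]
  refine integral_mono ((integrable_along_rpow_mul_gaussian hei hs2).const_mul _)
    (integrable_lineOp_toEuclideanLin hs hu hdet h) fun z => ?_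
  simp only
  rw [← mul_assoc]
  gcongr
  refine le_trans ?_ (hlow _)
  rw [mul_assoc, ← Real.mul_rpow (hA.eigenvalues_pos i).le (abs_nonneg _)]
  have := eigenvalue_mul_le_norm hA i z
  have := (hA.eigenvalues_pos i).le
  gcongr

/-- The identity is the competitor against which degenerate matrices are compared, so an upper bound
is needed for it alone. -/
lemma gamma_mul_linOp_one_le [NeZero n] (hs : 0 < s) (hu : Measurable u)
    (h : Integrable (integrand s 1 u x)) {M : ℝ}
    (hup : ∀ v, lineOp s (secondIncr u x) v ≤ ‖v‖ ^ (2 * s) * M) :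
    Real.Gamma ((n : ℝ) / 2 + s) * linOp s 1 u x ≤
      M * ∫ z : EuclideanSpace ℝ (Fin n), ‖z‖ ^ (2 * s) * Real.exp (-‖z‖ ^ 2) := by
  have hs2 : 0 ≤ 2 * s := by linarith
  have h1 : (1 : Matrix (Fin n) (Fin n) ℝ).det = 1 := Matrix.det_one
  rw [gamma_mul_linOp hs hu h1 h, ← integral_const_mul]
  refine integral_mono (integrable_lineOp_toEuclideanLin hs hu h1 h)
    ((integrable_norm_rpow_mul_gaussian hs2).const_mul _) fun z => ?_
  simp only
  rw [← mul_assoc]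
  gcongr
  have h2 : Matrix.toEuclideanLin (1 : Matrix (Fin n) (Fin n) ℝ) z = z := by
    ext i; simp
  rw [h2, mul_comm M]
  exact hup z

/-- The matrix that stretches by `l` along `e` and by `b` across it. -/
def stretchMatrix (e : EuclideanSpace ℝ (Fin n)) (l b : ℝ) : Matrix (Fin n) (Fin n) ℝ :=
  b • (1 + Matrix.replicateCol Unit (((l - b) / b) • e.ofLp) * Matrix.replicateRow Unit e.ofLp)

lemma toEuclideanLin_stretchMatrix (e : EuclideanSpace ℝ (Fin n)) {l b : ℝ} (hb : b ≠ 0) (z : EuclideanSpace ℝ (Fin n)) :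
    Matrix.toEuclideanLin (stretchMatrix e l b) z = stretch e l b z := by
  have h : ⟪e, z⟫ = ∑ j, e j * z j := by
    simp [PiLp.inner_apply, mul_comm]
  ext i
  simp only [Matrix.ofLp_toLpLin, Matrix.toLin'_apply, stretchMatrix, stretch, Matrix.smul_mulVec,
    Matrix.add_mulVec, Matrix.one_mulVec, Pi.smul_apply, Pi.add_apply, smul_eq_mul, PiLp.add_apply,
    PiLp.smul_apply, PiLp.sub_apply, h]
  simp only [Matrix.mulVec, dotProduct, Matrix.mul_apply, Matrix.replicateCol_apply,
    Matrix.replicateRow_apply, Finset.univ_unique, Finset.sum_singleton, Pi.smul_apply,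
    smul_eq_mul, mul_assoc, ← Finset.mul_sum]
  field_simp
  ring

lemma det_stretchMatrix {e : EuclideanSpace ℝ (Fin n)} (he : ‖e‖ = 1) {l b : ℝ} (hb : b ≠ 0) :
    (stretchMatrix e l b).det = b ^ n * (l / b) := by
  have h : e.ofLp ⬝ᵥ e.ofLp = 1 := by
    have := EuclideanSpace.inner_eq_star_dotProduct e e
    rw [real_inner_self_eq_norm_sq, he] at this
    simpa using this.symm
  rw [stretchMatrix, Matrix.det_smul, Fintype.card_fin,
    Matrix.det_one_add_replicateCol_mul_replicateRow, dotProduct_smul, h]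
  congr 1
  simp only [smul_eq_mul]
  field_simp
  ring

lemma posDef_stretchMatrix {e : EuclideanSpace ℝ (Fin n)} (he : ‖e‖ = 1) {l b : ℝ} (hl : 0 < l) (hb : 0 < b) :
    (stretchMatrix e l b).PosDef := by
  refine Matrix.PosDef.of_dotProduct_mulVec_pos ?_ fun y hy => ?_
  · ext i j
    simp only [stretchMatrix, Matrix.conjTranspose_apply, Matrix.smul_apply, Matrix.add_apply,
      Matrix.mul_apply, Matrix.replicateCol_apply, Matrix.replicateRow_apply, Finset.univ_unique,
      Finset.sum_singleton, Pi.smul_apply, smul_eq_mul, star_trivial, Matrix.one_apply, eq_comm]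
    ring
  · set z : EuclideanSpace ℝ (Fin n) := WithLp.toLp 2 y
    have hz : z ≠ 0 := by
      intro h
      apply hy
      have := congrArg WithLp.ofLp h
      simpa [z] using this
    have h1 : star y ⬝ᵥ (stretchMatrix e l b).mulVec y =
        ⟪z, Matrix.toEuclideanLin (stretchMatrix e l b) z⟫ := by
      rw [EuclideanSpace.inner_eq_star_dotProduct, dotProduct_comm]
      simp [z]
    have h2 := norm_sq_eq_inner_sq_add he z
    have h3 : ⟪z, z - ⟪e, z⟫ • e⟫ = ‖z - ⟪e, z⟫ • e‖ ^ 2 := by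
      rw [sq_abs] at h2
      rw [inner_sub_right, inner_smul_right, real_inner_self_eq_norm_sq, real_inner_comm e z]
      linarith
    rw [h1, toEuclideanLin_stretchMatrix e hb.ne', stretch, inner_add_right, inner_smul_right,
      inner_smul_right, h3, real_inner_comm e z]
    have h4 : 0 < ‖z‖ ^ 2 := by positivity
    have h5 : l * ⟪e, z⟫ * ⟪e, z⟫ = l * |⟪e, z⟫| ^ 2 := by rw [sq_abs]; ring
    rw [h5]
    rcases (sq_nonneg |⟪e, z⟫|).eq_or_lt with h6 | h6
    · rw [← h6] at h2 ⊢
      rw [zero_add] at h2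
      rw [← h2]
      positivity
    · have : 0 < l * |⟪e, z⟫| ^ 2 := mul_pos hl h6
      positivity

end MatrixAverages

/-! ### From lower bounds for all L_A to lower bounds over rays. -/

section Coercivity

variable {n : ℕ} {s C : ℝ} {L : ℝ≥0} {w : EuclideanSpace ℝ (Fin n) → ℝ} {x : EuclideanSpace ℝ (Fin n)}

/-- The second increment in y of δ(w,x,y) is a sum of second increments of w at x + y and x - y.
Thus bounds on δ(w) give the midpoint inequality for δ(w,x,·). -/
lemma secondIncr_add_sub (w : EuclideanSpace ℝ (Fin n) → ℝ) (x y y' : EuclideanSpace ℝ (Fin n)) :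
    secondIncr w x (y + y') + secondIncr w x (y - y') =
      2 * secondIncr w x y + (secondIncr w (x + y) y' + secondIncr w (x - y) y') := by
  simp only [secondIncr]
  rw [show x + (y + y') = x + y + y' by abel, show x - (y + y') = x - y - y' by abel,
    show x + (y - y') = x + y - y' by abel, show x - (y - y') = x - y + y' by abel]
  ring

lemma secondIncr_le_capFun (hw : LipschitzWith L w) (hC : ∀ x y, secondIncr w x y ≤ C * ‖y‖ ^ 2)
    (x y : EuclideanSpace ℝ (Fin n)) : secondIncr w x y ≤ capFun C L y := by
  refine le_min (hC x y) ?_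
  have h1 := (le_abs_self _).trans (hw.dist_le_mul (x + y) x)
  have h2 := (le_abs_self _).trans (hw.dist_le_mul (x - y) x)
  simp only [dist_eq_norm, add_sub_cancel_left, sub_sub_cancel_left, norm_neg] at h1 h2
  simp only [secondIncr]
  linarith

lemma secondIncr_midpoint_le (hw : LipschitzWith L w)
    (hC : ∀ x y, secondIncr w x y ≤ C * ‖y‖ ^ 2) (x y y' : EuclideanSpace ℝ (Fin n)) :
    secondIncr w x (y + y') + secondIncr w x (y - y') ≤
      2 * secondIncr w x y + 2 * capFun C L y' := by
  have h1 := secondIncr_le_capFun hw hC (x + y) y'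
  have h2 := secondIncr_le_capFun hw hC (x - y) y'
  rw [secondIncr_add_sub]
  linarith

/-- A semiconcave Lipschitz function for which the operator converges absolutely is integrable
along every ray. -/
lemma lineIntegrable_secondIncr [NeZero n] (hs : 1 / 2 < s) (hs' : s < 1) (hC0 : 0 < C)
    (hL : 0 < L) (hw : LipschitzWith L w) (hC : ∀ x y, secondIncr w x y ≤ C * ‖y‖ ^ 2)
    (h : Integrable (integrand s 1 w x)) (v : EuclideanSpace ℝ (Fin n)) : LineIntegrable s (secondIncr w x) v := by
  refine lineIntegrable_of_midpoint hs hs' hC0 (NNReal.coe_pos.2 hL)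
    (measurable_secondIncr hw.continuous.measurable x) ?_ (secondIncr_le_capFun hw hC x)
    (secondIncr_midpoint_le hw hC x) v
  refine ((integrable_integrand_iff (Matrix.det_one)).1 h).congr (Eventually.of_forall fun z => ?_)
  have : Matrix.toEuclideanLin (1 : Matrix (Fin n) (Fin n) ℝ) z = z := by
    ext i; simp
  simp only [this]

lemma lineOp_secondIncr_le [NeZero n] (hs : 1 / 2 < s) (hs' : s < 1) (hC0 : 0 < C)
    (hL : 0 < L) (hw : LipschitzWith L w) (hC : ∀ x y, secondIncr w x y ≤ C * ‖y‖ ^ 2)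
    (h : Integrable (integrand s 1 w x)) (v : EuclideanSpace ℝ (Fin n)) :
    lineOp s (secondIncr w x) v ≤ ‖v‖ ^ (2 * s) * (mu1 s L C / (1 - s)) := by
  rw [← lineOp_capFun hs hs' hC0 (NNReal.coe_pos.2 hL) v]
  exact lineOp_mono (lineIntegrable_secondIncr hs hs' hC0 hL hw hC h v)
    (lineIntegrable_capFun hs hs' hC0 (NNReal.coe_pos.2 hL) v) (secondIncr_le_capFun hw hC x)

lemma sphereArea_pred (hn : 2 ≤ n) : sphereArea (n - 1) =
    2 * Real.pi ^ (((n : ℝ) - 1) / 2) / Real.Gamma (((n : ℝ) - 1) / 2) := by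
  rw [sphereArea, Nat.cast_pred (by omega)]

lemma gamma_pred_pos (hn : 2 ≤ n) : 0 < Real.Gamma (((n : ℝ) - 1) / 2) := by
  have : (2 : ℝ) ≤ n := by exact_mod_cast hn
  exact Real.Gamma_pos_of_pos (by linarith)

lemma gamma_mul_const2 (hn : 2 ≤ n) (hs : 0 < s) : Real.Gamma ((n : ℝ) / 2 + s) * const2 n s =
    Real.pi ^ (((n : ℝ) - 1) / 2) * Real.Gamma (s + 1 / 2) := by
  have h1 := gamma_pred_pos hn
  have h2 : 0 < Real.Gamma ((n : ℝ) / 2 + s) := Real.Gamma_pos_of_pos (by positivity)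
  rw [const2, sphereArea_pred hn]
  field_simp

lemma gamma_mul_const1 (hn : 2 ≤ n) (hs : 0 < s) (L C : ℝ) :
    Real.Gamma ((n : ℝ) / 2 + s) * const1 n s L C =
      mu1 s L C * (√Real.pi * (Real.pi ^ (((n : ℝ) - 1) / 2) *
        Real.Gamma (((n : ℝ) - 1) / 2 + s) / Real.Gamma (((n : ℝ) - 1) / 2))) := by
  have h1 := gamma_pred_pos hn
  have h2 : 0 < Real.Gamma ((n : ℝ) / 2 + s) := Real.Gamma_pos_of_pos (by positivity)
  rw [const1, sphereArea_pred hn]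
  field_simp

lemma mu1_pos (hs : 1 / 2 < s) {L C : ℝ} (hL : 0 < L) (hC : 0 < C) : 0 < mu1 s L C := by
  have : 0 < 2 * s - 1 := by linarith
  unfold mu1
  positivity

lemma const1_pos (hn : 2 ≤ n) (hs : 1 / 2 < s) {L C : ℝ} (hL : 0 < L) (hC : 0 < C) :
    0 < const1 n s L C := by
  have h2 : 0 < Real.Gamma ((n : ℝ) / 2 + s) :=
    Real.Gamma_pos_of_pos (by have : 0 < s := by linarith
                              positivity)
  have h1 := gamma_pred_pos hn
  have h3 : (2 : ℝ) ≤ n := by exact_mod_cast hn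
  have h4 : 0 < Real.Gamma (((n : ℝ) - 1) / 2 + s) := Real.Gamma_pos_of_pos (by linarith)
  have h5 := mu1_pos hs hL hC
  have h6 := Real.pi_pos
  refine pos_of_mul_pos_right (a := Real.Gamma ((n : ℝ) / 2 + s)) ?_ h2.le
  rw [gamma_mul_const1 hn (by linarith)]
  positivity

lemma const2_pos (hn : 2 ≤ n) (hs : 0 < s) : 0 < const2 n s := by
  have h2 : 0 < Real.Gamma ((n : ℝ) / 2 + s) := Real.Gamma_pos_of_pos (by positivity)
  have h4 : 0 < Real.Gamma (s + 1 / 2) := Real.Gamma_pos_of_pos (by positivity)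
  have h6 := Real.pi_pos
  refine pos_of_mul_pos_right (a := Real.Gamma ((n : ℝ) / 2 + s)) ?_ h2.le
  rw [gamma_mul_const2 hn hs]
  positivity

lemma mu0_pos (hn : 2 ≤ n) (hs : 1 / 2 < s) {L C η : ℝ} (hL : 0 < L) (hC : 0 < C) (hη : 0 < η) :
    0 < mu0 n s L C η := by
  have h1 := const1_pos hn hs hL hC
  have h2 := const2_pos hn (s := s) (by linarith)
  unfold mu0
  positivity

/-- If `(1 - s) L_A w(x) ≥ η` for all `A`, then the integral over each ray is at least `μ₀`. -/
lemma mu0_le_lineOp (hn : 2 ≤ n) (hs : 1 / 2 < s) (hs' : s < 1) (hC0 : 0 < C)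
    (hL : 0 < L) (hw : LipschitzWith L w) (hC : ∀ x y, secondIncr w x y ≤ C * ‖y‖ ^ 2)
    {η : ℝ} (hη : 0 < η)
    (h : ∀ A : Matrix (Fin n) (Fin n) ℝ, A.PosDef → A.det = 1 →
      Integrable (integrand s A w x) ∧ η / (1 - s) ≤ linOp s A w x) {e : EuclideanSpace ℝ (Fin n)} (he : ‖e‖ = 1) :
    mu0 n s L C η / (1 - s) ≤ lineOp s (secondIncr w x) e := by
  have : NeZero n := ⟨by omega⟩
  have hs0 : 0 < s := by linarith
  have hs1 : 0 < 1 - s := by linarith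
  have hL' : 0 < (L : ℝ) := NNReal.coe_pos.2 hL
  have hC1 := const1_pos hn hs hL' hC0
  have hC2 := const2_pos hn hs0
  have hn' : (0 : ℝ) < (n : ℝ) - 1 := by
    have : (2 : ℝ) ≤ n := by exact_mod_cast hn
    linarith
  -- The error across e is C₁ b^(2s)/(1-s). With b^(2s) = K⁻¹ it equals half of the lower bound
  -- η/(1-s); then l is forced by determinant one, that is l b^(n-1) = 1.
  set K := 2 * const1 n s L C / η with hK
  have hK0 : 0 < K := by positivity
  set b := K ^ (-1 / (2 * s)) with hb
  set l := K ^ (((n : ℝ) - 1) / (2 * s)) with hl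
  have hb0 : 0 < b := by positivity
  have hl0 : 0 < l := by positivity
  have hb2 : b ^ (2 * s) = K⁻¹ := by
    rw [hb, ← Real.rpow_mul hK0.le, div_mul_cancel₀ _ (by positivity), Real.rpow_neg_one]
  have hl2 : l ^ (2 * s) = K ^ (n - 1) := by
    rw [hl, ← Real.rpow_mul hK0.le, div_mul_cancel₀ _ (by positivity), ← Real.rpow_natCast,
      Nat.cast_pred (by omega)]
  have hdet : b ^ n * (l / b) = 1 := by
    rw [hb, hl, ← Real.rpow_mul_natCast hK0.le, ← Real.rpow_sub hK0, ← Real.rpow_add hK0]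
    rw [show -1 / (2 * s) * (n : ℝ) + (((n : ℝ) - 1) / (2 * s) - -1 / (2 * s)) = 0 by
      field_simp; ring, Real.rpow_zero]
  have hd1 : (stretchMatrix e l b).det = 1 := by rw [det_stretchMatrix he hb0.ne', hdet]
  obtain ⟨hi, hle⟩ := h _ (posDef_stretchMatrix he hl0 hb0) hd1
  have hi' := (integrable_integrand_iff hd1).1 hi
  rw [linOp_eq hd1] at hle
  simp only [toEuclideanLin_stretchMatrix e hb0.ne'] at hi' hle
  have hone := (h 1 Matrix.PosDef.one Matrix.det_one).1
  have hline := lineIntegrable_secondIncr hs hs' hC0 hL hw hC hone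
  have key := average_stretch_le (by rwa [finrank_euclideanSpace_fin]) hs hs' hC0 hL'
    (measurable_secondIncr hw.continuous.measurable x) (secondIncr_zero w x) (secondIncr_neg w x)
    (secondIncr_midpoint_le hw hC x) hline he hl0 hb0 hi'
  have hΓ : 0 < Real.Gamma ((n : ℝ) / 2 + s) := Real.Gamma_pos_of_pos (by positivity)
  have key2 := (mul_le_mul_of_nonneg_left hle
    (by rw [finrank_euclideanSpace_fin]; exact hΓ.le)).trans key
  simp only [finrank_euclideanSpace_fin] at key2
  rw [← gamma_mul_const2 hn hs0, hb2, hl2] at key2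
  have h1 := gamma_mul_const1 hn hs0 L C
  have key3 : η / (1 - s) ≤ K ^ (n - 1) * lineOp s (secondIncr w x) e * const2 n s +
      K⁻¹ * (const1 n s L C / (1 - s)) := by
    refine le_of_mul_le_mul_left ?_ hΓ
    refine key2.trans (le_of_eq ?_)
    rw [mul_add]
    congr 1
    · ring
    · rw [show Real.Gamma ((n : ℝ) / 2 + s) * (K⁻¹ * (const1 n s L C / (1 - s))) =
        K⁻¹ * (Real.Gamma ((n : ℝ) / 2 + s) * const1 n s L C) / (1 - s) by ring, h1]
      ring
  have h2 : K⁻¹ * (const1 n s L C / (1 - s)) = η / 2 / (1 - s) := by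
    rw [hK]; field_simp
  have h3 : mu0 n s L C η = η / 2 / (K ^ (n - 1) * const2 n s) := by
    obtain ⟨m, rfl⟩ : ∃ m, n = m + 1 := ⟨n - 1, by omega⟩
    rw [mu0, show (1 : ℤ) - ((m + 1 : ℕ) : ℤ) = -(m : ℤ) by push_cast; ring, zpow_neg, zpow_natCast,
      Nat.add_sub_cancel, hK, div_pow, div_pow, mul_pow, pow_succ η, pow_succ (2 : ℝ)]
    field_simp
  rw [h3, div_div, div_le_iff₀ (by positivity)]
  rw [h2] at key3
  have h4 : η / (1 - s) - η / 2 / (1 - s) = η / 2 / (1 - s) := by ring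
  have h5 : η / 2 / (1 - s) ≤ K ^ (n - 1) * lineOp s (secondIncr w x) e * const2 n s := by linarith
  rw [div_le_iff₀ hs1] at h5
  linarith

lemma mul_rpow_norm_le_lineOp (hs : 0 < s) {G : EuclideanSpace ℝ (Fin n) → ℝ} (h0 : G 0 = 0) {q : ℝ}
    (h : ∀ e : EuclideanSpace ℝ (Fin n), ‖e‖ = 1 → q ≤ lineOp s G e) (v : EuclideanSpace ℝ (Fin n)) : q * ‖v‖ ^ (2 * s) ≤ lineOp s G v := by
  by_cases hv : v = 0
  · have : 2 * s ≠ 0 := by positivity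
    simp [hv, lineOp, h0, this]
  have hv' := norm_pos_iff.2 hv
  have h1 : ‖(‖v‖⁻¹ • v)‖ = 1 := by
    rw [norm_smul, norm_inv, norm_norm, inv_mul_cancel₀ hv'.ne']
  have h2 := lineOp_smul (s := s) G (‖v‖⁻¹ • v) hv'
  rw [smul_inv_smul₀ hv'.ne'] at h2
  rw [h2, mul_comm]
  gcongr
  exact h _ h1

/-- If the operators `L_A w(x)` have a common positive lower bound, then so have the integrals
over the rays. -/
lemma exists_lineOp_lower_bound [NeZero n] (hs : 1 / 2 < s) (hs' : s < 1) (hC0 : 0 < C)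
    (hL : 0 < L) (hw : LipschitzWith L w) (hC : ∀ x y, secondIncr w x y ≤ C * ‖y‖ ^ 2)
    {F : ℝ} (hF : 0 < F)
    (h : ∀ A : Matrix (Fin n) (Fin n) ℝ, A.PosDef → A.det = 1 →
      Integrable (integrand s A w x) ∧ F ≤ linOp s A w x) :
    ∃ q : ℝ, 0 < q ∧ ∀ v, q * ‖v‖ ^ (2 * s) ≤ lineOp s (secondIncr w x) v := by
  have hs0 : 0 < s := by linarith
  have hs1 : 0 < 1 - s := by linarith
  rcases Nat.lt_or_ge n 2 with hn | hn
  · have hn1 : n = 1 := by have := NeZero.ne n; omega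
    subst hn1
    obtain ⟨hi, hle⟩ := h 1 Matrix.PosDef.one Matrix.det_one
    set e : EuclideanSpace ℝ (Fin 1) := EuclideanSpace.single 0 1
    have he : ‖e‖ = 1 := by simp [e]
    have hv : ∀ v : EuclideanSpace ℝ (Fin 1), v = v 0 • e := by
      intro v
      ext i
      fin_cases i
      simp [e]
    have hnorm : ∀ v : EuclideanSpace ℝ (Fin 1), ‖v‖ = |v 0| := by
      intro v
      conv_lhs => rw [hv v, norm_smul, he, mul_one, Real.norm_eq_abs]
    -- In dimension one there is nothing to elongate. The ray integral is a fixed multiple of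
    -- |v|^(2s), and positivity of L_1 w(x) makes that multiple positive.
    have hall : ∀ v, lineOp s (secondIncr w x) v =
        ‖v‖ ^ (2 * s) * lineOp s (secondIncr w x) e := by
      intro v
      conv_lhs => rw [hv v]
      rw [lineOp_smul_of_even hs0 (secondIncr_zero w x) (secondIncr_neg w x), hnorm]
    have h1 := gamma_mul_linOp_one_le hs0 hw.continuous.measurable hi (fun v => (hall v).le)
    have hΓ : 0 < Real.Gamma (((1 : ℕ) : ℝ) / 2 + s) := Real.Gamma_pos_of_pos (by positivity)
    have h2 : 0 < Real.Gamma (((1 : ℕ) : ℝ) / 2 + s) * linOp s 1 w x :=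
      mul_pos hΓ (hF.trans_le hle)
    have h3 := integral_norm_rpow_mul_gaussian_pos (E := EuclideanSpace ℝ (Fin 1)) (p := 2 * s)
      (by linarith)
    refine ⟨lineOp s (secondIncr w x) e, pos_of_mul_pos_left (h2.trans_le h1) h3.le, fun v => ?_⟩
    rw [hall v, mul_comm]
  · have hη : (1 - s) * F / (1 - s) = F := by field_simp
    refine ⟨mu0 n s L C ((1 - s) * F) / (1 - s),
      div_pos (mu0_pos hn hs (NNReal.coe_pos.2 hL) hC0 (by positivity)) hs1, ?_⟩
    refine mul_rpow_norm_le_lineOp hs0 (secondIncr_zero w x) fun e he => ?_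
    refine mu0_le_lineOp hn hs hs' hC0 hL hw hC (by positivity) (fun A hA hA1 => ?_) he
    rw [hη]
    exact h A hA hA1

/-- A matrix of determinant one with a small eigenvalue has a large one. -/
lemma exists_large_eigenvalue (hn : 2 ≤ n) {A : Matrix (Fin n) (Fin n) ℝ} (hA : A.PosDef)
    (hdet : A.det = 1) {θ : ℝ} (hθ : 0 < θ) {i : Fin n}
    (hi : hA.isHermitian.eigenvalues i < θ) :
    ∃ j, θ ^ (-1 / ((n : ℝ) - 1)) ≤ hA.isHermitian.eigenvalues j := by
  by_contra! hcon
  have h1 := hA.isHermitian.det_eq_prod_eigenvalues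
  rw [hdet, ← Finset.mul_prod_erase _ _ (Finset.mem_univ i)] at h1
  have hn' : (n : ℝ) - 1 ≠ 0 := by
    have : (2 : ℝ) ≤ n := by exact_mod_cast hn
    linarith
  have h2 : ∏ j ∈ Finset.univ.erase i, hA.isHermitian.eigenvalues j ≤ θ⁻¹ := by
    calc ∏ j ∈ Finset.univ.erase i, hA.isHermitian.eigenvalues j
        ≤ ∏ j ∈ Finset.univ.erase i, θ ^ (-1 / ((n : ℝ) - 1)) :=
          Finset.prod_le_prod (fun j _ => (hA.eigenvalues_pos j).le) fun j _ => (hcon j).le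
      _ = θ⁻¹ := by
          rw [Finset.prod_const, Finset.card_erase_of_mem (Finset.mem_univ i), Finset.card_univ,
            Fintype.card_fin, ← Real.rpow_mul_natCast hθ.le, Nat.cast_pred (by omega),
            div_mul_cancel₀ _ hn', Real.rpow_neg_one]
  have h3 := hA.eigenvalues_pos i
  have h4 : hA.isHermitian.eigenvalues i *
      ∏ j ∈ Finset.univ.erase i, hA.isHermitian.eigenvalues j < 1 := by
    calc _ ≤ hA.isHermitian.eigenvalues i * θ⁻¹ := by gcongr
      _ < θ * θ⁻¹ := by gcongr
      _ = 1 := mul_inv_cancel₀ hθ.ne'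
  simp only [RCLike.ofReal_real_eq_id, id] at h1
  linarith

/-- A matrix of determinant one has an eigenvalue at least one. -/
lemma exists_one_le_eigenvalue [NeZero n] {A : Matrix (Fin n) (Fin n) ℝ} (hA : A.PosDef)
    (hdet : A.det = 1) : ∃ j, 1 ≤ hA.isHermitian.eigenvalues j := by
  by_contra! hcon
  have h1 := hA.isHermitian.det_eq_prod_eigenvalues
  simp only [RCLike.ofReal_real_eq_id, id] at h1
  rw [hdet] at h1
  have : ∏ j, hA.isHermitian.eigenvalues j < ∏ _j : Fin n, (1 : ℝ) :=
    Finset.prod_lt_prod_of_nonempty (fun j _ => hA.eigenvalues_pos j) (fun j _ => hcon j)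
      ⟨0, Finset.mem_univ 0⟩
  simp at this
  linarith

end Coercivity

/-! ### From viscosity tests to classical inequalities, and the truncation of the infimum. -/

section Viscosity

variable {n : ℕ} {s : ℝ} {u : EuclideanSpace ℝ (Fin n) → ℝ} {x : EuclideanSpace ℝ (Fin n)}

lemma secondIncr_glue_of_lt {r : ℝ} {ψ : EuclideanSpace ℝ (Fin n) → ℝ} {z : EuclideanSpace ℝ (Fin n)} (hz : ‖z‖ < r) :
    secondIncr (glue (Metric.ball x r) ψ u) x z = secondIncr ψ x z := by
  have hr : 0 < r := (norm_nonneg z).trans_lt hz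
  have h1 : x + z ∈ Metric.ball x r := by simpa using hz
  have h2 : x - z ∈ Metric.ball x r := by simpa [Metric.mem_ball, dist_eq_norm] using hz
  simp only [secondIncr, glue, if_pos h1, if_pos h2, if_pos (Metric.mem_ball_self hr)]

lemma secondIncr_glue_of_le {r : ℝ} (hr : 0 < r) {ψ : EuclideanSpace ℝ (Fin n) → ℝ} (hψ : ψ x = u x) {z : EuclideanSpace ℝ (Fin n)}
    (hz : r ≤ ‖z‖) : secondIncr (glue (Metric.ball x r) ψ u) x z = secondIncr u x z := by
  have h1 : x + z ∉ Metric.ball x r := by simpa using hz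
  have h2 : x - z ∉ Metric.ball x r := by simpa [Metric.mem_ball, dist_eq_norm] using hz
  simp only [secondIncr, glue, if_neg h1, if_neg h2, if_pos (Metric.mem_ball_self hr), hψ]

lemma measurable_glue {N : Set (EuclideanSpace ℝ (Fin n))} (hN : IsOpen N) {ψ : EuclideanSpace ℝ (Fin n) → ℝ} (hψ : Measurable ψ)
    (hu : Measurable u) : Measurable (glue N ψ u) :=
  Measurable.ite hN.measurableSet hψ hu

lemma abs_secondIncr_le {K : ℝ} (hu : ∀ y, |u y| ≤ K * (1 + ‖y‖)) (x z : EuclideanSpace ℝ (Fin n)) :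
    |secondIncr u x z| ≤ 4 * K * (1 + ‖x‖) * (1 + ‖z‖) := by
  have hK : 0 ≤ K := by simpa using (abs_nonneg _).trans (hu 0)
  have h1 := hu (x + z)
  have h2 := hu (x - z)
  have h3 := hu x
  have h4 : K * (1 + ‖x + z‖) ≤ K * (1 + (‖x‖ + ‖z‖)) := by gcongr; exact norm_add_le _ _
  have h5 : K * (1 + ‖x - z‖) ≤ K * (1 + (‖x‖ + ‖z‖)) := by gcongr; exact norm_sub_le _ _
  have h6 : 0 ≤ K * (‖x‖ * ‖z‖) := by positivity
  have h7 : 0 ≤ K * ‖z‖ := by positivity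
  rw [abs_le] at h1 h2 h3 ⊢
  unfold secondIncr
  constructor <;> nlinarith

lemma exists_quadLinBound {G : EuclideanSpace ℝ (Fin n) → ℝ} {a K r : ℝ} (ha : 0 ≤ a) (hK : 0 ≤ K) (hr : 0 < r)
    (h1 : ∀ z, ‖z‖ < r → |G z| ≤ a * ‖z‖ ^ 2) (h2 : ∀ z, r ≤ ‖z‖ → |G z| ≤ K * (1 + ‖z‖)) :
    ∃ C, QuadLinBound C G := by
  refine ⟨a + a * r + K * (1 / r ^ 2 + 1 / r) + K * (1 / r + 1), fun z => ?_⟩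
  have hz := norm_nonneg z
  have e1 : 0 ≤ K * (1 / r ^ 2 + 1 / r) := by positivity
  have e2 : 0 ≤ K * (1 / r + 1) := by positivity
  have e3 : 0 ≤ a * r := by positivity
  rcases lt_or_ge ‖z‖ r with h | h
  · have h3 := h1 z h
    constructor
    · refine h3.trans ?_
      gcongr
      linarith
    · calc |G z| ≤ a * ‖z‖ ^ 2 := h3
        _ = a * ‖z‖ * ‖z‖ := by ring
        _ ≤ a * r * ‖z‖ := by gcongr
        _ ≤ _ := by gcongr; linarith
  · have h3 := h2 z h
    have h4 : 1 ≤ 1 / r * ‖z‖ := by rw [one_div, inv_mul_eq_div, one_le_div hr]; exact h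
    have h5 : ‖z‖ ≤ 1 / r * ‖z‖ ^ 2 := by nlinarith
    have h6 : 1 ≤ 1 / r ^ 2 * ‖z‖ ^ 2 := by
      calc (1 : ℝ) ≤ (1 / r * ‖z‖) ^ 2 := one_le_pow₀ h4
        _ = _ := by ring
    constructor
    · calc |G z| ≤ K * (1 + ‖z‖) := h3
        _ ≤ K * (1 / r ^ 2 * ‖z‖ ^ 2 + 1 / r * ‖z‖ ^ 2) := by gcongr
        _ = K * (1 / r ^ 2 + 1 / r) * ‖z‖ ^ 2 := by ring
        _ ≤ _ := by gcongr; linarith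
    · calc |G z| ≤ K * (1 + ‖z‖) := h3
        _ ≤ K * (1 / r * ‖z‖ + ‖z‖) := by gcongr
        _ = K * (1 / r + 1) * ‖z‖ := by ring
        _ ≤ _ := by gcongr; linarith

lemma QuadLinBound.integrable_integrand [NeZero n] (hs : 1 / 2 < s) (hs' : s < 1)
    (hu : Measurable u) {C : ℝ} (h : QuadLinBound C (secondIncr u x))
    {A : Matrix (Fin n) (Fin n) ℝ} (hA : A.det = 1) : Integrable (integrand s A u x) := by
  rw [integrable_integrand_iff hA]
  set T := LinearMap.toContinuousLinearMap (Matrix.toEuclideanLin A)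
  have hT : ∀ z, ‖Matrix.toEuclideanLin A z‖ ≤ ‖T‖ * ‖z‖ := T.le_opNorm
  refine QuadLinBound.integrable_div (C := |C| * ‖T‖ ^ 2 + |C| * ‖T‖) hs hs'
    (G := fun z => secondIncr u x (Matrix.toEuclideanLin A z))
    ((measurable_secondIncr hu x).comp (continuous_toEuclideanLin A).measurable) fun z => ?_
  obtain ⟨h1, h2⟩ := h (Matrix.toEuclideanLin A z)
  have h3 := hT z
  constructor
  · calc _ ≤ C * ‖Matrix.toEuclideanLin A z‖ ^ 2 := h1
      _ ≤ |C| * (‖T‖ * ‖z‖) ^ 2 := by gcongr; exact le_abs_self C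
      _ = |C| * ‖T‖ ^ 2 * ‖z‖ ^ 2 := by ring
      _ ≤ _ := by gcongr; linarith [mul_nonneg (abs_nonneg C) (norm_nonneg T)]
  · calc _ ≤ C * ‖Matrix.toEuclideanLin A z‖ := h2
      _ ≤ |C| * (‖T‖ * ‖z‖) := by gcongr; exact le_abs_self C
      _ = |C| * ‖T‖ * ‖z‖ := by ring
      _ ≤ _ := by gcongr; linarith [mul_nonneg (abs_nonneg C) (sq_nonneg ‖T‖)]

/-- The quadratic polynomial with value `a`, gradient `p` and leading coefficient `c` at `x`. -/
def paraboloid (x : EuclideanSpace ℝ (Fin n)) (a : ℝ) (p : EuclideanSpace ℝ (Fin n)) (c : ℝ) (y : EuclideanSpace ℝ (Fin n)) : ℝ :=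
  a + ⟪p, y - x⟫ + c * ‖y - x‖ ^ 2

lemma contDiff_paraboloid (x : EuclideanSpace ℝ (Fin n)) (a : ℝ) (p : EuclideanSpace ℝ (Fin n)) (c : ℝ) :
    ContDiff ℝ 2 (paraboloid x a p c) := by
  unfold paraboloid
  have h1 : ContDiff ℝ 2 fun y : EuclideanSpace ℝ (Fin n) => y - x := contDiff_id.sub contDiff_const
  exact (contDiff_const.add (contDiff_const.inner ℝ h1)).add (contDiff_const.mul (h1.norm_sq ℝ))

lemma paraboloid_self (x : EuclideanSpace ℝ (Fin n)) (a : ℝ) (p : EuclideanSpace ℝ (Fin n)) (c : ℝ) : paraboloid x a p c x = a := by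
  simp [paraboloid]

lemma paraboloid_add (x : EuclideanSpace ℝ (Fin n)) (a : ℝ) (p : EuclideanSpace ℝ (Fin n)) (c : ℝ) (z : EuclideanSpace ℝ (Fin n)) :
    paraboloid x a p c (x + z) = a + ⟪p, z⟫ + c * ‖z‖ ^ 2 := by
  simp [paraboloid]

lemma secondIncr_paraboloid (x : EuclideanSpace ℝ (Fin n)) (a : ℝ) (p : EuclideanSpace ℝ (Fin n)) (c : ℝ) (z : EuclideanSpace ℝ (Fin n)) :
    secondIncr (paraboloid x a p c) x z = 2 * c * ‖z‖ ^ 2 := by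
  rw [secondIncr, sub_eq_add_neg x z, paraboloid_add, paraboloid_add, paraboloid_self, inner_neg_right,
    norm_neg]
  ring

lemma c2OnClosure_of_contDiff {N : Set (EuclideanSpace ℝ (Fin n))} {ψ : EuclideanSpace ℝ (Fin n) → ℝ} (h : ContDiff ℝ 2 ψ) : C2OnClosure N ψ :=
  ⟨univ, isOpen_univ, subset_univ _, h.contDiffOn⟩

lemma exists_quadLinBound_glue {K : ℝ} (hu : ∀ y, |u y| ≤ K * (1 + ‖y‖)) {r : ℝ} (hr : 0 < r)
    (p : EuclideanSpace ℝ (Fin n)) (c : ℝ) :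
    ∃ C, QuadLinBound C (secondIncr (glue (Metric.ball x r) (paraboloid x (u x) p c) u) x) := by
  have hK : 0 ≤ K := by simpa using (abs_nonneg _).trans (hu 0)
  refine exists_quadLinBound (a := 2 * |c|) (K := 4 * K * (1 + ‖x‖)) (by positivity)
    (by positivity) hr (fun z hz => ?_) fun z hz => ?_
  · rw [secondIncr_glue_of_lt hz, secondIncr_paraboloid, abs_mul, abs_mul, abs_two,
      abs_of_nonneg (sq_nonneg ‖z‖)]
  · rw [secondIncr_glue_of_le hr (paraboloid_self _ _ _ _) hz]
    exact abs_secondIncr_le hu x z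

/-- Fatou's lemma for nonnegative integrable functions with bounded integrals. -/
lemma integrable_and_integral_le_of_tendsto {α : Type*} [MeasurableSpace α] {μ : Measure α}
    {g : ℕ → α → ℝ} {f : α → ℝ} {M : ℝ} (hg : ∀ k, Integrable (g k) μ) (h0 : ∀ k y, 0 ≤ g k y)
    (ht : ∀ y, Tendsto (fun k => g k y) atTop (𝓝 (f y))) (hM : ∀ k, ∫ y, g k y ∂μ ≤ M) :
    Integrable f μ ∧ ∫ y, f y ∂μ ≤ M := by
  have hf0 : ∀ y, 0 ≤ f y := fun y => ge_of_tendsto' (ht y) fun k => h0 k y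
  have hfm : AEStronglyMeasurable f μ :=
    aestronglyMeasurable_of_tendsto_ae atTop (fun k => (hg k).aestronglyMeasurable)
      (Eventually.of_forall ht)
  have hM0 : 0 ≤ M := (integral_nonneg (h0 0)).trans (hM 0)
  have h1 : ∫⁻ y, ENNReal.ofReal (f y) ∂μ ≤ ENNReal.ofReal M := by
    calc ∫⁻ y, ENNReal.ofReal (f y) ∂μ
        = ∫⁻ y, liminf (fun k => ENNReal.ofReal (g k y)) atTop ∂μ := by
          congr 1
          ext y
          exact ((ENNReal.continuous_ofReal.tendsto _).comp (ht y)).liminf_eq.symm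
      _ ≤ liminf (fun k => ∫⁻ y, ENNReal.ofReal (g k y) ∂μ) atTop :=
          lintegral_liminf_le' fun k => (hg k).aestronglyMeasurable.aemeasurable.ennreal_ofReal
      _ ≤ liminf (fun _ : ℕ => ENNReal.ofReal M) atTop := by
          refine liminf_le_liminf (Eventually.of_forall fun k => ?_)
          rw [← ofReal_integral_eq_lintegral_ofReal (hg k) (Eventually.of_forall (h0 k))]
          exact ENNReal.ofReal_le_ofReal (hM k)
      _ = ENNReal.ofReal M := by simp
  refine ⟨⟨hfm, ?_⟩, ?_⟩
  · rw [hasFiniteIntegral_iff_ofReal (Eventually.of_forall hf0)]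
    exact h1.trans_lt ENNReal.ofReal_lt_top
  · rw [integral_eq_lintegral_of_nonneg_ae (Eventually.of_forall hf0) hfm]
    exact ENNReal.toReal_le_of_le_ofReal hM0 h1

lemma fracMA_le_linOp {A : Matrix (Fin n) (Fin n) ℝ} (hA : A.PosDef) (h1 : A.det = 1) :
    fracMA s u x ≤ linOp s A u x :=
  iInf₂_le A ⟨hA, h1⟩

lemma integrand_le_integrand {v : EuclideanSpace ℝ (Fin n) → ℝ} {x' : EuclideanSpace ℝ (Fin n)} {A : Matrix (Fin n) (Fin n) ℝ} {y : EuclideanSpace ℝ (Fin n)}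
    (h : secondIncr u x y ≤ secondIncr v x' y) : integrand s A u x y ≤ integrand s A v x' y := by
  unfold integrand
  gcongr

/-- At a point where a subsolution is touched from above by a paraboloid, the operator converges
absolutely and the inequality holds in the classical sense. -/
lemma IsSubsolutionOn.pointwise [NeZero n] (hs : 1 / 2 < s) (hs' : s < 1) {Ω : Set (EuclideanSpace ℝ (Fin n))}
    (hΩ : IsOpen Ω) {f : EuclideanSpace ℝ (Fin n) → ℝ} (hsub : IsSubsolutionOn s Ω f u) (hu : Continuous u) {K : ℝ}
    (hgrow : ∀ y, |u y| ≤ K * (1 + ‖y‖)) (hx : x ∈ Ω) {p : EuclideanSpace ℝ (Fin n)} {c : ℝ}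
    (htouch : ∀ z, u (x + z) ≤ u x + ⟪p, z⟫ + c * ‖z‖ ^ 2)
    {A : Matrix (Fin n) (Fin n) ℝ} (hA : A.PosDef) (hdet : A.det = 1) :
    Integrable (integrand s A u x) ∧ f x ≤ linOp s A u x := by
  obtain ⟨r₀, hr₀, hball⟩ := Metric.isOpen_iff.1 hΩ x hx
  set r : ℕ → ℝ := fun k => r₀ / (k + 1)
  have hr : ∀ k, 0 < r k := fun k => by positivity
  have hrle : ∀ k, r k ≤ r₀ := fun k => div_le_self hr₀.le (by simp)
  -- The extra 1 makes the contact strict, as the test requires.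
  set ψ := paraboloid x (u x) p (c + 1)
  have hψ : ∀ y, y ≠ x → u y < ψ y := by
    intro y hy
    have h1 := htouch (y - x)
    have h2 : 0 < ‖y - x‖ ^ 2 := by
      have := norm_pos_iff.2 (sub_ne_zero.2 hy)
      positivity
    rw [add_sub_cancel] at h1
    simp only [ψ, paraboloid]
    linarith
  set v : ℕ → EuclideanSpace ℝ (Fin n) → ℝ := fun k => glue (Metric.ball x (r k)) ψ u
  have hv : ∀ k, Measurable (v k) := fun k =>
    measurable_glue Metric.isOpen_ball (contDiff_paraboloid _ _ _ _).continuous.measurable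
      hu.measurable
  have hvi : ∀ k, Integrable (integrand s A (v k) x) := by
    intro k
    obtain ⟨C, hC⟩ := exists_quadLinBound_glue (x := x) hgrow (hr k) p (c + 1)
    exact hC.integrable_integrand hs hs' (hv k) hdet
  have hvf : ∀ k, f x ≤ linOp s A (v k) x := by
    intro k
    have h1 := hsub.2 x hx (Metric.ball x (r k)) Metric.isOpen_ball Metric.isBounded_ball
      ((Metric.ball_subset_ball (hrle k)).trans hball) (Metric.mem_ball_self (hr k)) ψ
      (c2OnClosure_of_contDiff (contDiff_paraboloid _ _ _ _)) (paraboloid_self _ _ _ _)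
      fun y _ hy => hψ y hy
    exact EReal.coe_le_coe_iff.1 (h1.trans (fracMA_le_linOp hA hdet))
  have hlt : ∀ k z, ‖z‖ < r k → secondIncr (v k) x z = 2 * (c + 1) * ‖z‖ ^ 2 := fun k z hz => by
    rw [secondIncr_glue_of_lt hz, secondIncr_paraboloid]
  have hge : ∀ k z, r k ≤ ‖z‖ → secondIncr (v k) x z = secondIncr u x z := fun k z hz =>
    secondIncr_glue_of_le (hr k) (paraboloid_self _ _ _ _) hz
  have hup : ∀ z, secondIncr u x z ≤ 2 * (c + 1) * ‖z‖ ^ 2 := by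
    intro z
    have h1 := htouch z
    have h2 := htouch (-z)
    rw [inner_neg_right, norm_neg, ← sub_eq_add_neg] at h2
    unfold secondIncr
    nlinarith [sq_nonneg ‖z‖]
  have hr0 : ∀ k, r k ≤ r 0 := fun k => by simpa [r] using hrle k
  -- On the shell between the two radii the paraboloid is replaced by u, which has the smaller
  -- increments.
  have hanti : ∀ k z, secondIncr (v k) x z ≤ secondIncr (v 0) x z := by
    intro k z
    rcases lt_or_ge ‖z‖ (r 0) with h | h
    · rw [hlt 0 z h]
      rcases lt_or_ge ‖z‖ (r k) with h' | h'
      · rw [hlt k z h']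
      · rw [hge k z h']; exact hup z
    · rw [hge 0 z h, hge k z ((hr0 k).trans h)]
  have htend : ∀ z, Tendsto (fun k => integrand s A (v k) x z) atTop
      (𝓝 (integrand s A u x z)) := by
    intro z
    by_cases hz : z = 0
    · simp [hz, integrand, secondIncr_zero]
    · refine tendsto_const_nhds.congr' ?_
      have h1 : Tendsto r atTop (𝓝 0) := by
        have := (tendsto_const_div_atTop_nhds_zero_nat r₀).comp (tendsto_add_atTop_nat 1)
        simpa [Function.comp_def, r] using this
      filter_upwards [h1.eventually (gt_mem_nhds (norm_pos_iff.2 hz))] with k hk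
      unfold integrand
      rw [hge k z hk.le]
  -- The differences from the first glued function are nonnegative, and the viscosity inequality
  -- bounds their integrals from above. Fatou then excludes a divergence of L_A u(x) to -∞ and keeps
  -- the bound.
  obtain ⟨hi, hle⟩ := integrable_and_integral_le_of_tendsto
    (g := fun k z => integrand s A (v 0) x z - integrand s A (v k) x z)
    (f := fun z => integrand s A (v 0) x z - integrand s A u x z)
    (M := (∫ z, integrand s A (v 0) x z) - 2 * f x)
    (fun k => (hvi 0).sub (hvi k)) (fun k z => sub_nonneg.2 (integrand_le_integrand (hanti k z)))
    (fun z => tendsto_const_nhds.sub (htend z)) (fun k => by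
      rw [integral_sub (hvi 0) (hvi k)]
      have := hvf k
      unfold linOp at this
      linarith)
  have hui : Integrable (integrand s A u x) := by
    refine ((hvi 0).sub hi).congr (Eventually.of_forall fun z => ?_)
    simp
  refine ⟨hui, ?_⟩
  rw [integral_sub (hvi 0) hui] at hle
  unfold linOp
  linarith

/-- Testing a supersolution from below against a semiconcave Lipschitz function with smaller second
increments, for which the operator is positive. -/
lemma IsSupersolutionOn.ge_of_touching [NeZero n] (hs : 1 / 2 < s) (hs' : s < 1) {g : EuclideanSpace ℝ (Fin n) → ℝ}
    (hsup : IsSupersolutionOn s univ g u) (hu : Continuous u) {K : ℝ}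
    (hgrow : ∀ y, |u y| ≤ K * (1 + ‖y‖)) {p : EuclideanSpace ℝ (Fin n)} {c : ℝ} (hc : 0 ≤ c)
    (htouch : ∀ z, u x + ⟪p, z⟫ - c * ‖z‖ ^ 2 ≤ u (x + z))
    {w : EuclideanSpace ℝ (Fin n) → ℝ} {L : ℝ≥0} (hL : 0 < L) (hw : LipschitzWith L w) {C : ℝ} (hC0 : 0 < C)
    (hC : ∀ x y, secondIncr w x y ≤ C * ‖y‖ ^ 2) {x' : EuclideanSpace ℝ (Fin n)}
    (hcomp : ∀ z, secondIncr w x' z ≤ secondIncr u x z) {F : ℝ} (hF : 0 < F)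
    (h : ∀ A : Matrix (Fin n) (Fin n) ℝ, A.PosDef → A.det = 1 →
      Integrable (integrand s A w x') ∧ F ≤ linOp s A w x') : F ≤ g x := by
  by_contra! hlt
  have hs0 : 0 < s := by linarith
  -- The bound q is independent of A; it converts an additive error m|z|^(2s) over rays into the
  -- relative error m/q.
  obtain ⟨q, hq, hlow⟩ := exists_lineOp_lower_bound hs hs' hC0 hL hw hC hF h
  -- Inside the ball the increment of w exceeds that of the test function by at most B|z|². The cap
  -- with constants B and Br/2 equals B|z|² exactly up to |z| = r, and its ray integral is of order
  -- r^(2-2s), which vanishes with r.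
  set B := 2 * (c + 1) + C
  have hB : 0 < B := by positivity
  have hone := (h 1 Matrix.PosDef.one Matrix.det_one).1
  obtain ⟨r, hr, hrF⟩ : ∃ r : ℝ, 0 < r ∧
      -- The maximum with 0 also ensures that the factor 1 - m/q is positive, so that it may
      -- multiply lower bounds.
      max (g x) 0 < (1 - mu1 s (B * r / 2) B / (1 - s) / q) * F := by
    have h1 : Tendsto (fun r : ℝ => (1 - mu1 s (B * r / 2) B / (1 - s) / q) * F) (𝓝[>] 0)
        (𝓝 ((1 - mu1 s (B * 0 / 2) B / (1 - s) / q) * F)) := by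
      refine Tendsto.mono_left ?_ nhdsWithin_le_nhds
      have : ContinuousAt (fun r : ℝ => (B * r / 2) ^ (2 - 2 * s)) 0 :=
        ContinuousAt.rpow_const (by fun_prop) (Or.inr (by linarith))
      unfold mu1
      exact ((tendsto_const_nhds.sub ((((this.tendsto.div_const _).mul_const _).div_const _
        ).div_const _))).mul_const _
    have h2 : mu1 s (B * 0 / 2) B = 0 := by
      rw [mu1, mul_zero, zero_div, Real.zero_rpow (by linarith), zero_div, zero_mul]
    rw [h2] at h1
    simp only [zero_div, sub_zero, one_mul] at h1
    obtain ⟨r, hr1, hr2⟩ := ((h1.eventually (lt_mem_nhds (max_lt hlt hF))).and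
      self_mem_nhdsWithin).exists
    exact ⟨r, hr2, hr1⟩
  set m := mu1 s (B * r / 2) B / (1 - s)
  have hm : 0 ≤ m := div_nonneg (mu1_pos hs (by positivity) hB).le (by linarith)
  set ψ := paraboloid x (u x) p (-(c + 1))
  set v := glue (Metric.ball x r) ψ u
  have hvm : Measurable v := measurable_glue Metric.isOpen_ball
    (contDiff_paraboloid _ _ _ _).continuous.measurable hu.measurable
  obtain ⟨Cv, hCv⟩ := exists_quadLinBound_glue (x := x) hgrow hr p (-(c + 1))
  have htest : fracMA s v x ≤ g x := by
    refine hsup.2 x (mem_univ x) (Metric.ball x r) Metric.isOpen_ball Metric.isBounded_ball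
      (subset_univ _) (Metric.mem_ball_self hr) ψ
      (c2OnClosure_of_contDiff (contDiff_paraboloid _ _ _ _)) (paraboloid_self _ _ _ _)
      fun y _ hy => ?_
    have h1 := htouch (y - x)
    have h2 : 0 < ‖y - x‖ ^ 2 := by
      have := norm_pos_iff.2 (sub_ne_zero.2 hy)
      positivity
    rw [add_sub_cancel] at h1
    simp only [ψ, paraboloid]
    linarith
  have hGcomp : ∀ z, secondIncr w x' z ≤ secondIncr v x z + capFun B (B * r / 2) z := by
    intro z
    rcases lt_or_ge ‖z‖ r with hz | hz
    · rw [secondIncr_glue_of_lt hz, secondIncr_paraboloid]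
      have h1 : capFun B (B * r / 2) z = B * ‖z‖ ^ 2 := by
        refine min_eq_left ?_
        calc B * ‖z‖ ^ 2 = B * ‖z‖ * ‖z‖ := by ring
          _ ≤ B * r * ‖z‖ := by gcongr
          _ = _ := by ring
      rw [h1]
      have := hC x' z
      simp only [B]
      linarith
    · rw [secondIncr_glue_of_le hr (paraboloid_self _ _ _ _) hz]
      have := capFun_nonneg hB.le (L := B * r / 2) (by positivity) z
      linarith [hcomp z]
  have hlineV : ∀ z, LineIntegrable s (secondIncr v x) z :=
    hCv.lineIntegrable hs hs' (measurable_secondIncr hvm x)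
  have hlineW := lineIntegrable_secondIncr hs hs' hC0 hL hw hC hone
  have hlinecap : ∀ z : EuclideanSpace ℝ (Fin n), LineIntegrable s (capFun B (B * r / 2)) z :=
    lineIntegrable_capFun hs hs' hB (by positivity)
  have hlineOp : ∀ z, (1 - m / q) * lineOp s (secondIncr w x') z ≤
      lineOp s (secondIncr v x) z := by
    intro z
    have h1 : lineOp s (secondIncr w x') z ≤
        lineOp s (secondIncr v x) z + ‖z‖ ^ (2 * s) * m := by
      rw [← lineOp_capFun hs hs' hB (by positivity)]
      have h2 : LineIntegrable s (fun z => secondIncr v x z + capFun B (B * r / 2) z) z := by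
        refine ((hlineV z).add (hlinecap z)).congr (Eventually.of_forall fun τ => ?_)
        simp only [Pi.add_apply, add_mul]
      refine (lineOp_mono (hlineW z) h2 hGcomp).trans (le_of_eq ?_)
      unfold lineOp
      rw [← integral_add (hlineV z) (hlinecap z)]
      simp only [add_mul]
    have h3 : ‖z‖ ^ (2 * s) * m ≤ m / q * lineOp s (secondIncr w x') z := by
      calc ‖z‖ ^ (2 * s) * m = m / q * (q * ‖z‖ ^ (2 * s)) := by field_simp
        _ ≤ _ := by gcongr; exact hlow z
    linarith
  have hpos : 0 < 1 - m / q :=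
    pos_of_mul_pos_left ((le_max_right _ _).trans_lt hrF) hF.le
  have hΓ : 0 < Real.Gamma ((n : ℝ) / 2 + s) := Real.Gamma_pos_of_pos (by positivity)
  -- The inequality over rays is averaged against the Gaussian for every A with the same radius r,
  -- so it survives the infimum.
  have hfin : (((1 - m / q) * F : ℝ) : EReal) ≤ fracMA s v x := by
    refine le_iInf₂ fun A hA => EReal.coe_le_coe_iff.2 ?_
    obtain ⟨hA, hdet⟩ := hA
    obtain ⟨hwi, hwF⟩ := h A hA hdet
    have hvi := hCv.integrable_integrand hs hs' hvm hdet
    have h1 : (1 - m / q) * (Real.Gamma ((n : ℝ) / 2 + s) * linOp s A w x') ≤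
        Real.Gamma ((n : ℝ) / 2 + s) * linOp s A v x := by
      rw [gamma_mul_linOp hs0 hw.continuous.measurable hdet hwi,
        gamma_mul_linOp hs0 hvm hdet hvi, ← integral_const_mul]
      refine integral_mono ((integrable_lineOp_toEuclideanLin hs0 hw.continuous.measurable hdet
        hwi).const_mul _) (integrable_lineOp_toEuclideanLin hs0 hvm hdet hvi) fun z => ?_
      simp only
      rw [← mul_assoc]
      gcongr
      exact hlineOp _
    have h2 : (1 - m / q) * F ≤ (1 - m / q) * linOp s A w x' := by gcongr
    refine h2.trans (le_of_mul_le_mul_left ?_ hΓ)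
    linarith
  have := EReal.coe_le_coe_iff.1 (hfin.trans htest)
  linarith [le_max_left (g x) 0]

lemma eigenvalues_one (h : (1 : Matrix (Fin n) (Fin n) ℝ).IsHermitian) (i : Fin n) :
    h.eigenvalues i = 1 := by
  have h1 := inner_eigenvector h i (h.eigenvectorBasis i)
  have h2 : Matrix.toEuclideanLin (1 : Matrix (Fin n) (Fin n) ℝ) (h.eigenvectorBasis i) =
      h.eigenvectorBasis i := by
    ext j; simp
  rw [h2, real_inner_self_eq_norm_sq, h.eigenvectorBasis.norm_eq_one] at h1
  linarith

/-- Quantitative uniform ellipticity along a semiconcave Lipschitz function at a point where the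
operators have a common positive lower bound. -/
lemma fracMA_eq_fracMATrunc (hn : 2 ≤ n) (hs : 1 / 2 < s) (hs' : s < 1) {C : ℝ} (hC0 : 0 < C)
    {L : ℝ≥0} (hL : 0 < L) (hu : LipschitzWith L u) (hC : ∀ x y, secondIncr u x y ≤ C * ‖y‖ ^ 2)
    {η : ℝ} (hη : 0 < η)
    (h : ∀ A : Matrix (Fin n) (Fin n) ℝ, A.PosDef → A.det = 1 →
      Integrable (integrand s A u x) ∧ η / (1 - s) ≤ linOp s A u x)
    {θ : ℝ} (hθ : 0 < θ) (hθ' : θ < threshold n s L C η) :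
    fracMA s u x = fracMATrunc s θ u x := by
  have : NeZero n := ⟨by omega⟩
  have hs0 : 0 < s := by linarith
  have hs1 : 0 < 1 - s := by linarith
  have hL' : 0 < (L : ℝ) := NNReal.coe_pos.2 hL
  have hum := hu.continuous.measurable
  have hone := (h 1 Matrix.PosDef.one Matrix.det_one).1
  have hmu0 := mu0_pos hn hs hL' hC0 hη
  have hmu1 := mu1_pos hs hL' hC0
  have hn1 : (1 : ℝ) < n := by exact_mod_cast hn
  have hnpos : (0 : ℝ) < n := by linarith
  have hn' : 0 < (n : ℝ) - 1 := by linarith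
  have hray : ∀ e : EuclideanSpace ℝ (Fin n), ‖e‖ = 1 → mu0 n s L C η / (1 - s) ≤ lineOp s (secondIncr u x) e :=
    fun e he => mu0_le_lineOp hn hs hs' hC0 hL hu hC hη h he
  have hlow := mul_rpow_norm_le_lineOp hs0 (secondIncr_zero u x) hray
  have hup := lineOp_secondIncr_le hs hs' hC0 hL hu hC hone
  set e : EuclideanSpace ℝ (Fin n) := EuclideanSpace.single 0 1
  have he : ‖e‖ = 1 := by simp [e]
  -- Comparing the two bounds on one ray gives μ₀ ≤ μ₁, hence θ ≤ 1, and the identity belongs to the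
  -- truncated class.
  have hmu : mu0 n s L C η ≤ mu1 s L C := by
    have h1 := (hray e he).trans (hup e)
    rw [he, Real.one_rpow, one_mul] at h1
    exact (div_le_div_iff_of_pos_right hs1).1 h1
  set ρ := mu0 n s L C η / (n * mu1 s L C) with hρ
  have hρ0 : 0 < ρ := by positivity
  have hρ1 : ρ ≤ 1 := by
    rw [hρ, div_le_one (by positivity)]
    nlinarith
  have hθ1 : θ ≤ 1 := hθ'.le.trans (Real.rpow_le_one hρ0.le hρ1 (by positivity))
  set I := ∫ z : EuclideanSpace ℝ (Fin n), |⟪e, z⟫| ^ (2 * s) * Real.exp (-‖z‖ ^ 2)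
  set J := ∫ z : EuclideanSpace ℝ (Fin n), ‖z‖ ^ (2 * s) * Real.exp (-‖z‖ ^ 2)
  have hIJ : J ≤ n * I := by
    have := integral_norm_le_mul_integral_along hs0 hs'.le he
    rwa [finrank_euclideanSpace_fin] at this
  have hI : 0 < I := integral_along_pos hs0 hs'.le he
  have hΓ : 0 < Real.Gamma ((n : ℝ) / 2 + s) := Real.Gamma_pos_of_pos (by positivity)
  -- The large eigenvalue is at least θ^(-1/(n-1)), and the threshold on θ makes its power 2s at
  -- least nμ₁/μ₀. The factor n pays for passing from the radial moment in the bound for the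
  -- identity to the moment along one direction.
  have hbad : ∀ A : Matrix (Fin n) (Fin n) ℝ, ∀ hA : A.PosDef, A.det = 1 →
      (∃ i, hA.isHermitian.eigenvalues i < θ) → linOp s 1 u x ≤ linOp s A u x := by
    rintro A hA hdet ⟨i, hi⟩
    obtain ⟨j, hj⟩ := exists_large_eigenvalue hn hA hdet hθ hi
    have h1 := le_gamma_mul_linOp hs0 hum hA hdet (h A hA hdet).1 (by positivity) hlow he j
    have h2 := gamma_mul_linOp_one_le hs0 hum hone hup
    have h3 : ρ⁻¹ ≤ hA.isHermitian.eigenvalues j ^ (2 * s) := by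
      calc ρ⁻¹ = (threshold n s L C η ^ (-1 / ((n : ℝ) - 1))) ^ (2 * s) := by
            rw [threshold, ← Real.rpow_mul hρ0.le, ← Real.rpow_mul hρ0.le,
              show ((n : ℝ) - 1) / (2 * s) * (-1 / ((n : ℝ) - 1)) * (2 * s) = -1 by field_simp,
              Real.rpow_neg_one]
        _ ≤ (θ ^ (-1 / ((n : ℝ) - 1))) ^ (2 * s) := by
            refine Real.rpow_le_rpow (Real.rpow_nonneg (hθ.le.trans hθ'.le) _) ?_ (by positivity)
            exact Real.rpow_le_rpow_of_nonpos hθ hθ'.le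
              (div_nonpos_of_nonpos_of_nonneg (by norm_num) hn'.le)
        _ ≤ _ := by gcongr
    refine le_of_mul_le_mul_left ?_ hΓ
    calc _ ≤ mu1 s L C / (1 - s) * J := h2
      _ ≤ mu1 s L C / (1 - s) * (n * I) := by gcongr
      _ = mu0 n s L C η / (1 - s) * ρ⁻¹ * I := by rw [hρ]; field_simp
      _ ≤ mu0 n s L C η / (1 - s) * hA.isHermitian.eigenvalues j ^ (2 * s) * I := by gcongr
      _ ≤ _ := h1
  refine le_antisymm (le_iInf₂ fun A hA => ?_) (le_iInf₂ fun A hA => ?_)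
  · obtain ⟨hA, hdet, -⟩ := hA
    exact fracMA_le_linOp hA hdet
  · obtain ⟨hA, hdet⟩ := hA
    by_cases hall : ∀ i, θ ≤ hA.isHermitian.eigenvalues i
    · exact iInf₂_le A ⟨hA, hdet, hall⟩
    · push Not at hall
      refine le_trans (iInf₂_le 1 ⟨Matrix.PosDef.one, Matrix.det_one, fun i => ?_⟩)
        (EReal.coe_le_coe_iff.2 (hbad A hA hdet hall))
      rw [eigenvalues_one]
      exact hθ1

end Viscosity

/-! ### Lipschitz bounds, supergradients, and the derivatives of the data at infinity. -/

section Regularity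

variable {n : ℕ}

/-- A semiconcave function at bounded distance from a Lipschitz function is Lipschitz. -/
lemma exists_lipschitzWith_of_semiconcave {u φ : EuclideanSpace ℝ (Fin n) → ℝ} {B C : ℝ} {L : ℝ≥0} (hC0 : 0 ≤ C)
    (hC : ∀ x y, secondIncr u x y ≤ C * ‖y‖ ^ 2) (hφ : LipschitzWith L φ)
    (hB : ∀ x, |u x - φ x| ≤ B) : ∃ L' : ℝ≥0, 0 < L' ∧ LipschitzWith L' u := by
  have hB0 : 0 ≤ B := (abs_nonneg _).trans (hB 0)
  have hosc : ∀ x y, u x - u y ≤ 2 * B + L * ‖x - y‖ := by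
    intro x y
    have h1 := abs_le.1 (hB x)
    have h2 := abs_le.1 (hB y)
    have h3 := (le_abs_self _).trans (hφ.dist_le_mul x y)
    rw [dist_eq_norm] at h3
    linarith
  -- Going backwards along steps of size z, successive increments fall by at most C|z|². Hence N
  -- copies of the last increment are bounded by a telescoping sum of N increments plus the
  -- accumulated errors.
  have hstep : ∀ (x z : EuclideanSpace ℝ (Fin n)) (N : ℕ), N * (u (x + z) - u x) ≤
      u (x + z) - u (x + z - (N : ℝ) • z) + N ^ 2 * (C * ‖z‖ ^ 2) := by
    intro x z N
    have h1 : ∀ j : ℕ, u (x + z) - u x ≤ u (x + z - (j : ℝ) • z) -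
        u (x + z - ((j + 1 : ℕ) : ℝ) • z) + j * (C * ‖z‖ ^ 2) := by
      intro j
      induction j with
      | zero => simp
      | succ j ih =>
        have h2 := hC (x + z - ((j + 1 : ℕ) : ℝ) • z) z
        simp only [secondIncr] at h2
        rw [show x + z - ((j + 1 : ℕ) : ℝ) • z + z = x + z - (j : ℝ) • z by push_cast; module,
          show x + z - ((j + 1 : ℕ) : ℝ) • z - z = x + z - ((j + 1 + 1 : ℕ) : ℝ) • z by
            push_cast; module] at h2
        push_cast at ih h2 ⊢
        linarith
    induction N with
    | zero => simp
    | succ N ih =>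
      have h2 := h1 N
      have h3 : 0 ≤ C * ‖z‖ ^ 2 := by positivity
      have h4 : (0 : ℝ) ≤ N := N.cast_nonneg
      push_cast at h2 ih ⊢
      nlinarith
  have hmain : ∀ x z, u (x + z) - u x ≤ (2 * B + L + 2 * C) * ‖z‖ := by
    intro x z
    have hL : 0 ≤ (L : ℝ) * ‖z‖ := by positivity
    have hCz : 0 ≤ C * ‖z‖ := by positivity
    rcases lt_or_ge 1 ‖z‖ with hz | hz
    · have h1 := hosc (x + z) x
      rw [add_sub_cancel_left] at h1
      nlinarith
    · rcases (norm_nonneg z).eq_or_lt with h0 | h0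
      · rw [norm_eq_zero.1 h0.symm]; simp
      -- The N steps cover a distance between 1 and 2, over which u has bounded oscillation.
      set N := ⌈1 / ‖z‖⌉₊
      have hN1 : 1 / ‖z‖ ≤ N := Nat.le_ceil _
      have hN2 : (N : ℝ) < 1 / ‖z‖ + 1 := Nat.ceil_lt_add_one (by positivity)
      have h2 : 1 ≤ N * ‖z‖ := by rwa [div_le_iff₀ h0] at hN1
      have h3 : N * ‖z‖ ≤ 2 := by
        have : (N : ℝ) * ‖z‖ ≤ (1 / ‖z‖ + 1) * ‖z‖ := by gcongr
        rw [add_mul, one_div, inv_mul_cancel₀ h0.ne', one_mul] at this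
        linarith
      have hN0 : (0 : ℝ) < N := by
        have : 0 < 1 / ‖z‖ := by positivity
        linarith
      have h4 := hstep x z N
      have h5 := hosc (x + z) (x + z - (N : ℝ) • z)
      rw [sub_sub_cancel, norm_smul, Real.norm_of_nonneg hN0.le] at h5
      refine le_of_mul_le_mul_left ?_ hN0
      calc N * (u (x + z) - u x) ≤ 2 * B + L * (N * ‖z‖) + N ^ 2 * (C * ‖z‖ ^ 2) := by linarith
        _ = 2 * B * 1 + L * (N * ‖z‖) + C * (N * ‖z‖) * (N * ‖z‖) := by ring
        _ ≤ 2 * B * (N * ‖z‖) + L * (N * ‖z‖) + C * 2 * (N * ‖z‖) := by gcongr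
        _ = N * ((2 * B + L + 2 * C) * ‖z‖) := by ring
  refine ⟨(2 * B + L + 2 * C).toNNReal + 1, by positivity,
    LipschitzWith.of_le_add_mul _ fun x y => ?_⟩
  have h1 := hmain y (x - y)
  rw [add_sub_cancel] at h1
  have h2 := norm_nonneg (x - y)
  rw [dist_eq_norm, NNReal.coe_add, Real.coe_toNNReal _ (by positivity), NNReal.coe_one]
  linarith

/-- Semiconcavity at y + z/2^(j+1) compares the difference quotients of steps z/2^j and z/2^(j+1).
The errors form a geometric series with sum at most C|z|², and the quotients tend to the derivative.
-/
lemma le_add_fderiv_of_semiconcave {u : EuclideanSpace ℝ (Fin n) → ℝ} {C : ℝ} (hC0 : 0 ≤ C)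
    (hC : ∀ x y, secondIncr u x y ≤ C * ‖y‖ ^ 2) {y : EuclideanSpace ℝ (Fin n)} (hy : DifferentiableAt ℝ u y) (z : EuclideanSpace ℝ (Fin n)) :
    u (y + z) ≤ u y + fderiv ℝ u y z + C * ‖z‖ ^ 2 := by
  have h1 : ∀ j : ℕ, u (y + z) - u y ≤
      (2 : ℝ) ^ j * (u (y + ((2 : ℝ) ^ j)⁻¹ • z) - u y) + C * ‖z‖ ^ 2 * (1 - ((2 : ℝ) ^ j)⁻¹) := by
    intro j
    induction j with
    | zero => simp
    | succ j ih =>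
      have h2 := hC (y + ((2 : ℝ) ^ (j + 1))⁻¹ • z) (((2 : ℝ) ^ (j + 1))⁻¹ • z)
      simp only [secondIncr] at h2
      have e1 : ((2 : ℝ) ^ j)⁻¹ = 2 * ((2 : ℝ) ^ (j + 1))⁻¹ := by
        rw [pow_succ]; field_simp
      rw [add_sub_cancel_right, add_assoc, ← two_smul ℝ, smul_smul, ← e1, norm_smul,
        Real.norm_of_nonneg (by positivity), mul_pow] at h2
      have h3 : (2 : ℝ) ^ j * (u (y + ((2 : ℝ) ^ j)⁻¹ • z) + u y -
          2 * u (y + ((2 : ℝ) ^ (j + 1))⁻¹ • z)) ≤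
          (2 : ℝ) ^ j * (C * (((2 : ℝ) ^ (j + 1))⁻¹ ^ 2 * ‖z‖ ^ 2)) := by gcongr
      have e2 : (2 : ℝ) ^ j * (C * (((2 : ℝ) ^ (j + 1))⁻¹ ^ 2 * ‖z‖ ^ 2)) =
          C * ‖z‖ ^ 2 * ((2 : ℝ) ^ (j + 1))⁻¹ / 2 := by
        rw [pow_succ (2 : ℝ) j]; field_simp
      have e3 : 0 ≤ C * ‖z‖ ^ 2 * ((2 : ℝ) ^ (j + 1))⁻¹ := by positivity
      rw [e1] at ih
      rw [e1] at h3
      have e4 : (2 : ℝ) ^ (j + 1) * (u (y + ((2 : ℝ) ^ (j + 1))⁻¹ • z) - u y) =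
          2 * (2 ^ j * u (y + ((2 : ℝ) ^ (j + 1))⁻¹ • z)) - 2 * (2 ^ j * u y) := by ring
      rw [e2] at h3
      rw [e4]
      linarith
  have h2 : ∀ j : ℕ, u (y + z) - u y - C * ‖z‖ ^ 2 ≤
      (2 : ℝ) ^ j • (u (y + ((2 : ℝ) ^ j)⁻¹ • z) - u y) := by
    intro j
    have : 0 ≤ C * ‖z‖ ^ 2 * ((2 : ℝ) ^ j)⁻¹ := by positivity
    have := h1 j
    rw [smul_eq_mul]
    nlinarith
  have h3 : Tendsto (fun j : ℕ => ‖(2 : ℝ) ^ j‖) atTop atTop := by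
    simpa using tendsto_pow_atTop_atTop_of_one_lt (one_lt_two (α := ℝ))
  have h4 := ge_of_tendsto' (hy.hasFDerivAt.lim z h3) h2
  linarith

/-- A semiconcave Lipschitz function is touched from above by a paraboloid at every point. -/
lemma exists_supergradient {u : EuclideanSpace ℝ (Fin n) → ℝ} {C : ℝ} {L : ℝ≥0} (hC0 : 0 ≤ C) (hu : LipschitzWith L u)
    (hC : ∀ x y, secondIncr u x y ≤ C * ‖y‖ ^ 2) (x : EuclideanSpace ℝ (Fin n)) :
    ∃ p : EuclideanSpace ℝ (Fin n), ∀ z, u (x + z) ≤ u x + ⟪p, z⟫ + C * ‖z‖ ^ 2 := by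
  -- By Rademacher's theorem x is a limit of points of differentiability. Their gradients are
  -- bounded by L, and any limit of them is a supergradient, because the constant C does not depend
  -- on the point.
  have hd : Dense {y : EuclideanSpace ℝ (Fin n) | DifferentiableAt ℝ u y} :=
    Measure.dense_of_ae (hu.ae_differentiableAt (μ := volume))
  obtain ⟨y, hy, hyx⟩ := mem_closure_iff_seq_limit.1 (hd x)
  set p : ℕ → EuclideanSpace ℝ (Fin n) := fun k => (InnerProductSpace.toDual ℝ _).symm (fderiv ℝ u (y k))
  have hp : ∀ k, p k ∈ Metric.closedBall (0 : EuclideanSpace ℝ (Fin n)) L := by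
    intro k
    rw [mem_closedBall_zero_iff, LinearIsometryEquiv.norm_map]
    exact norm_fderiv_le_of_lipschitz ℝ hu
  obtain ⟨q, -, σ, hσ, hlim⟩ := tendsto_subseq_of_bounded Metric.isBounded_closedBall hp
  refine ⟨q, fun z => ?_⟩
  have hyσ := hyx.comp hσ.tendsto_atTop
  have h1 : ∀ k, u ((y ∘ σ) k + z) ≤ u ((y ∘ σ) k) + ⟪(p ∘ σ) k, z⟫ + C * ‖z‖ ^ 2 := by
    intro k
    have := le_add_fderiv_of_semiconcave hC0 hC (hy (σ k)) z
    simpa [p, InnerProductSpace.toDual_symm_apply] using this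
  have hc := hu.continuous
  refine le_of_tendsto_of_tendsto' ((hc.tendsto _).comp (hyσ.add_const z))
    ((((hc.tendsto _).comp hyσ).add (hlim.inner tendsto_const_nhds)).add_const _) h1

lemma exists_norm_le_of_continuous {F : Type*} [NormedAddCommGroup F] {f : EuclideanSpace ℝ (Fin n) → F}
    (hf : Continuous f) {R M : ℝ} (h : ∀ x, R ≤ ‖x‖ → ‖f x‖ ≤ M) : ∃ M', ∀ x, ‖f x‖ ≤ M' := by
  obtain ⟨M', hM'⟩ := (isCompact_closedBall (0 : EuclideanSpace ℝ (Fin n)) R).exists_bound_of_continuousOn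
    hf.continuousOn
  refine ⟨max M M', fun x => ?_⟩
  rcases le_total R ‖x‖ with hx | hx
  · exact (h x hx).trans (le_max_left _ _)
  · exact (hM' x (by simpa using hx)).trans (le_max_right _ _)

/-- The first two derivatives of a positively homogeneous function of degree one are bounded away
from the vertex. -/
lemma exists_bound_of_homogeneous {F : EuclideanSpace ℝ (Fin n) → ℝ} (hF : ∀ (x : EuclideanSpace ℝ (Fin n)) (t : ℝ), 0 < t → F (t • x) = t * F x)
    {R : ℝ} (hR : 0 < R) (hd : ∀ x, R < ‖x‖ → ContDiffAt ℝ 2 F x) :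
    ∃ M, ∀ x, 2 * R ≤ ‖x‖ → ‖fderiv ℝ F x‖ ≤ M ∧ ‖fderiv ℝ (fderiv ℝ F) x‖ ≤ M := by
  -- The gradient is homogeneous of degree 0 and the Hessian of degree -1, so both are controlled
  -- outside the sphere of radius 2R by their maxima on it.
  have h1 : ∀ (x : EuclideanSpace ℝ (Fin n)) (t : ℝ), 0 < t → fderiv ℝ F (t • x) = fderiv ℝ F x := by
    intro x t ht
    have e1 := fderiv_comp_smul (𝕜 := ℝ) (f := F) (x := x) t
    have e2 : (F <| t • ·) = t • F := by ext y; simp [hF y t ht]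
    rw [e2, fderiv_const_smul_field] at e1
    exact (smul_right_injective _ ht.ne' e1).symm
  have h2 : ∀ (x : EuclideanSpace ℝ (Fin n)) (t : ℝ), 0 < t →
      t • fderiv ℝ (fderiv ℝ F) (t • x) = fderiv ℝ (fderiv ℝ F) x := by
    intro x t ht
    have e1 := fderiv_comp_smul (𝕜 := ℝ) (f := fderiv ℝ F) (x := x) t
    have e2 : (fderiv ℝ F <| t • ·) = fderiv ℝ F := by ext1 y; exact h1 y t ht
    rw [← e1, e2]
  have hsub : ∀ x ∈ Metric.sphere (0 : EuclideanSpace ℝ (Fin n)) (2 * R), R < ‖x‖ := by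
    intro x hx
    rw [mem_sphere_zero_iff_norm] at hx
    linarith
  have hc1 : ContinuousOn (fderiv ℝ F) (Metric.sphere 0 (2 * R)) := fun x hx =>
    ((hd x (hsub x hx)).fderiv_right (m := 1) (by norm_num)).continuousAt.continuousWithinAt
  have hc2 : ContinuousOn (fderiv ℝ (fderiv ℝ F)) (Metric.sphere 0 (2 * R)) := fun x hx =>
    (((hd x (hsub x hx)).fderiv_right (m := 1) (by norm_num)).fderiv_right (m := 0)
      (by norm_num)).continuousAt.continuousWithinAt
  obtain ⟨M1, hM1⟩ := (isCompact_sphere (0 : EuclideanSpace ℝ (Fin n)) (2 * R)).exists_bound_of_continuousOn hc1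
  obtain ⟨M2, hM2⟩ := (isCompact_sphere (0 : EuclideanSpace ℝ (Fin n)) (2 * R)).exists_bound_of_continuousOn
    (ContinuousOn.norm (E := EuclideanSpace ℝ (Fin n) →L[ℝ] EuclideanSpace ℝ (Fin n) →L[ℝ] ℝ) hc2)
  simp only [norm_norm] at hM2
  refine ⟨max M1 M2, fun x hx => ?_⟩
  have hx0 : 0 < ‖x‖ := by linarith
  set t := 2 * R / ‖x‖
  have ht : 0 < t := by positivity
  have ht1 : t ≤ 1 := (div_le_one hx0).2 hx
  have hmem : t • x ∈ Metric.sphere (0 : EuclideanSpace ℝ (Fin n)) (2 * R) := by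
    rw [mem_sphere_zero_iff_norm, norm_smul, Real.norm_of_nonneg ht.le, div_mul_cancel₀ _ hx0.ne']
  constructor
  · rw [← h1 x t ht]
    exact (hM1 _ hmem).trans (le_max_left _ _)
  · rw [← h2 x t ht]
    refine (ContinuousLinearMap.opNorm_smul_le t _).trans ?_
    rw [Real.norm_of_nonneg ht.le]
    calc t * ‖fderiv ℝ (fderiv ℝ F) (t • x)‖ ≤ 1 * ‖fderiv ℝ (fderiv ℝ F) (t • x)‖ := by gcongr
      _ ≤ max M1 M2 := by rw [one_mul]; exact (hM2 _ hmem).trans (le_max_right _ _)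

lemma norm_fderiv_fderiv_eq (f : EuclideanSpace ℝ (Fin n) → ℝ) (x : EuclideanSpace ℝ (Fin n)) :
    ‖fderiv ℝ (fderiv ℝ f) x‖ = ‖iteratedFDeriv ℝ 2 f x‖ := by
  rw [← norm_iteratedFDeriv_one, norm_iteratedFDeriv_fderiv]

/-- The data at infinity have bounded first and second derivatives. -/
lemma IsDatum.exists_fderiv_bounds {α : ℝ≥0} {φ : EuclideanSpace ℝ (Fin n) → ℝ} (h : IsDatum α φ) :
    ∃ M, ∀ x, ‖fderiv ℝ φ x‖ ≤ M ∧ ‖fderiv ℝ (fderiv ℝ φ) x‖ ≤ M := by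
  obtain ⟨Γ, η, a, ε, R, ha, hε, -, hR, ⟨p, c, hcone⟩, hη, hφ⟩ := h.asymptotic
  have hopen : IsOpen {x : EuclideanSpace ℝ (Fin n) | R < ‖x‖} := isOpen_lt continuous_const continuous_norm
  have hηat : ∀ x, R < ‖x‖ → ContDiffAt ℝ 2 η x := fun x hx =>
    hη.contDiffAt (hopen.mem_nhds hx)
  -- No smoothness of the cone is assumed; far out it is the difference of φ and η.
  have hΓat : ∀ x, R < ‖x‖ → ContDiffAt ℝ 2 Γ x := by
    intro x hx
    refine (h.contDiff.contDiffAt.sub (hηat x hx)).congr_of_eventuallyEq ?_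
    filter_upwards [hopen.mem_nhds hx] with y hy
    rw [(hφ y hy).1, add_sub_cancel_right]
  -- Moving the vertex to the origin gives a positively homogeneous function, smooth outside a
  -- slightly larger ball.
  set F : EuclideanSpace ℝ (Fin n) → ℝ := fun x => Γ (p + x) - c
  have hFhom : ∀ (x : EuclideanSpace ℝ (Fin n)) (t : ℝ), 0 < t → F (t • x) = t * F x := fun x t ht => hcone x t ht
  have hfar : ∀ x, R + ‖p‖ < ‖x‖ → R < ‖p + x‖ := by
    intro x hx
    have := norm_sub_norm_le x (-p)
    rw [sub_neg_eq_add, norm_neg, add_comm x p] at this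
    linarith
  have hFat : ∀ x, R + ‖p‖ < ‖x‖ → ContDiffAt ℝ 2 F x := by
    intro x hx
    have h1 : ContDiffAt ℝ 2 (fun y : EuclideanSpace ℝ (Fin n) => p + y) x := contDiffAt_const.add contDiffAt_id
    exact ((hΓat _ (hfar x hx)).comp x h1).sub contDiffAt_const
  have hRp : 0 < R + ‖p‖ := by positivity
  obtain ⟨M, hM⟩ := exists_bound_of_homogeneous hFhom hRp hFat
  have hF1 : ∀ x, fderiv ℝ F x = fderiv ℝ Γ (p + x) := by
    intro x
    simp only [F]
    rw [fderiv_sub_const, fderiv_comp_add_left]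
  have hF2 : ∀ x, fderiv ℝ (fderiv ℝ F) x = fderiv ℝ (fderiv ℝ Γ) (p + x) := by
    intro x
    rw [show fderiv ℝ F = fun x => fderiv ℝ Γ (p + x) from funext hF1, fderiv_comp_add_left]
  have hsmall : ∀ x : EuclideanSpace ℝ (Fin n), 1 ≤ ‖x‖ → ∀ b : ℝ, 0 < b → a * ‖x‖ ^ (-b) ≤ a := by
    intro x hx b hb
    exact mul_le_of_le_one_right ha.le (Real.rpow_le_one_of_one_le_of_nonpos hx (by linarith))
  have hbound : ∀ x, 2 * (R + ‖p‖) + ‖p‖ + 1 ≤ ‖x‖ →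
      ‖fderiv ℝ φ x‖ ≤ M + a ∧ ‖fderiv ℝ (fderiv ℝ φ) x‖ ≤ M + a := by
    intro x hx
    have hp0 := norm_nonneg p
    have hxR : R < ‖x‖ := by linarith
    have hx1 : 1 ≤ ‖x‖ := by linarith
    have hxp : 2 * (R + ‖p‖) ≤ ‖x - p‖ := by
      have := norm_sub_norm_le x p
      linarith
    obtain ⟨hM1, hM2⟩ := hM _ hxp
    rw [hF1, add_sub_cancel] at hM1
    rw [hF2, add_sub_cancel] at hM2
    obtain ⟨-, -, h1, h2⟩ := hφ x hxR
    have e1 : ∀ y, R < ‖y‖ → fderiv ℝ φ y = fderiv ℝ Γ y + fderiv ℝ η y := by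
      intro y hy
      rw [← fderiv_add ((hΓat y hy).differentiableAt two_ne_zero)
        ((hηat y hy).differentiableAt two_ne_zero)]
      refine Filter.EventuallyEq.fderiv_eq ?_
      filter_upwards [hopen.mem_nhds hy] with z hz
      exact (hφ z hz).1
    have e2 : fderiv ℝ (fderiv ℝ φ) x = fderiv ℝ (fderiv ℝ Γ) x + fderiv ℝ (fderiv ℝ η) x := by
      rw [← fderiv_add (((hΓat x hxR).fderiv_right (m := 1) (by norm_num)).differentiableAt
        one_ne_zero) (((hηat x hxR).fderiv_right (m := 1) (by norm_num)).differentiableAt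
        one_ne_zero)]
      refine Filter.EventuallyEq.fderiv_eq ?_
      filter_upwards [hopen.mem_nhds hxR] with z hz
      exact e1 z hz
    rw [e1 x hxR, e2]
    rw [← norm_fderiv_fderiv_eq] at h2
    exact ⟨(norm_add_le _ _).trans (add_le_add hM1 (h1.trans (hsmall x hx1 _ (by linarith)))),
      (ContinuousLinearMap.opNorm_add_le _ _).trans
        (add_le_add hM2 (h2.trans (hsmall x hx1 _ (by linarith))))⟩
  have hc1 : ContDiff ℝ 1 (fderiv ℝ φ) := h.contDiff.fderiv_right (by norm_num)
  obtain ⟨M1, hM1⟩ := exists_norm_le_of_continuous hc1.continuous fun x hx => (hbound x hx).1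
  obtain ⟨M2, hM2⟩ := exists_norm_le_of_continuous
    (hc1.fderiv_right (m := 0) (by norm_num)).continuous fun x hx => (hbound x hx).2
  exact ⟨max M1 M2, fun x => ⟨(hM1 x).trans (le_max_left _ _), (hM2 x).trans (le_max_right _ _)⟩⟩

/-- The data at infinity are Lipschitz and semiconcave. -/
lemma IsDatum.exists_bounds {α : ℝ≥0} {φ : EuclideanSpace ℝ (Fin n) → ℝ} (h : IsDatum α φ) :
    ∃ (L : ℝ≥0) (K : ℝ), 0 < L ∧ LipschitzWith L φ ∧ 0 ≤ K ∧
      ∀ x y, secondIncr φ x y ≤ K * ‖y‖ ^ 2 := by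
  obtain ⟨M, hM⟩ := h.exists_fderiv_bounds
  have hM0 : 0 ≤ M := (norm_nonneg _).trans (hM 0).1
  have hd : Differentiable ℝ φ := h.contDiff.differentiable two_ne_zero
  have hc1 : ContDiff ℝ 1 (fderiv ℝ φ) := h.contDiff.fderiv_right (by norm_num)
  set M' : ℝ≥0 := ⟨M, hM0⟩
  have hlip : LipschitzWith M' (fderiv ℝ φ) :=
    lipschitzWith_of_nnnorm_fderiv_le (𝕜 := ℝ) (hc1.differentiable one_ne_zero)
      fun x => (hM x).2
  have hlip0 : LipschitzWith M' φ :=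
    lipschitzWith_of_nnnorm_fderiv_le (𝕜 := ℝ) hd fun x => (hM x).1
  have hmv : ∀ x y : EuclideanSpace ℝ (Fin n), |φ (x + y) - φ x - fderiv ℝ φ x y| ≤ M * ‖y‖ * ‖y‖ := by
    intro x y
    have := (convex_closedBall x ‖y‖).norm_image_sub_le_of_norm_fderiv_le' (𝕜 := ℝ)
      (f := φ) (φ := fderiv ℝ φ x) (C := M * ‖y‖) (x := x) (y := x + y) (fun z _ => hd z)
      (fun z hz => by
        have h1 := hlip.dist_le_mul z x
        rw [dist_eq_norm] at h1
        refine h1.trans ?_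
        exact mul_le_mul_of_nonneg_left hz hM0) (by simp) (by simp)
    rwa [add_sub_cancel_left, Real.norm_eq_abs] at this
  refine ⟨M' + 1, 2 * M, by positivity, hlip0.weaken (by simp), by positivity,
    fun x y => ?_⟩
  have h1 := abs_le.1 (hmv x y)
  have h2 := abs_le.1 (hmv x (-y))
  rw [norm_neg, map_neg, ← sub_eq_add_neg] at h2
  unfold secondIncr
  nlinarith

end Regularity

/-! ### Positivity of the operator on strictly convex functions, and the strict inequality u > φ. -/

section Solution

variable {n : ℕ}

lemma continuous_of_sub_of_super {s : ℝ} {f g u : EuclideanSpace ℝ (Fin n) → ℝ} (h : IsSubsolutionOn s univ f u)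
    (h' : IsSupersolutionOn s univ g u) : Continuous u := by
  have h1 := h.1
  have h2 := h'.1
  rw [closure_univ] at h1 h2
  rw [← continuousOn_univ]
  exact continuousOn_iff_lower_upperSemicontinuousOn.2 ⟨h2, h1⟩

lemma exists_forall_abs_lt_of_tendsto_cobounded {g : EuclideanSpace ℝ (Fin n) → ℝ}
    (h : Tendsto g (Bornology.cobounded (EuclideanSpace ℝ (Fin n))) (𝓝 0)) {δ : ℝ} (hδ : 0 < δ) :
    ∃ R, ∀ x, R ≤ ‖x‖ → |g x| < δ := by
  obtain ⟨R, -, hR⟩ := (Metric.hasBasis_cobounded_compl_ball (0 : EuclideanSpace ℝ (Fin n))).eventually_iff.1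
    (Metric.tendsto_nhds.1 h δ hδ)
  exact ⟨R, fun x hx => by simpa using @hR x (by simpa using hx)⟩

lemma exists_abs_le_of_tendsto_cobounded {g : EuclideanSpace ℝ (Fin n) → ℝ} (hg : Continuous g)
    (h : Tendsto g (Bornology.cobounded (EuclideanSpace ℝ (Fin n))) (𝓝 0)) : ∃ B, ∀ x, |g x| ≤ B := by
  obtain ⟨R, hR⟩ := exists_forall_abs_lt_of_tendsto_cobounded h one_pos
  exact exists_norm_le_of_continuous hg fun x hx => (hR x hx).le

lemma abs_le_of_lipschitzWith {u φ : EuclideanSpace ℝ (Fin n) → ℝ} {L : ℝ≥0} {B : ℝ} (hφ : LipschitzWith L φ)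
    (hB : ∀ x, |u x - φ x| ≤ B) (y : EuclideanSpace ℝ (Fin n)) : |u y| ≤ (|φ 0| + L + B) * (1 + ‖y‖) := by
  have h1 := hφ.dist_le_mul y 0
  rw [Real.dist_eq, dist_zero_right] at h1
  have h2 := hB y
  have h3 : 0 ≤ B := (abs_nonneg _).trans h2
  have h4 := norm_nonneg y
  have h5 := abs_nonneg (φ 0)
  have h6 : |u y| ≤ |u y - φ y| + |φ y - φ 0| + |φ 0| := by
    calc |u y| = |(u y - φ y) + (φ y - φ 0) + φ 0| := by ring_nf
      _ ≤ _ := (abs_add_le _ _).trans (add_le_add_left (abs_add_le _ _) _)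
  have h7 : 0 ≤ (L : ℝ) := L.2
  nlinarith [mul_nonneg h5 h4, mul_nonneg h3 h4]

/-- A differentiable strictly convex function lies strictly above its tangent hyperplanes. -/
lemma _root_.StrictConvexOn.add_fderiv_lt {φ : EuclideanSpace ℝ (Fin n) → ℝ} (h : StrictConvexOn ℝ univ φ) {x : EuclideanSpace ℝ (Fin n)}
    (hd : DifferentiableAt ℝ φ x) {z : EuclideanSpace ℝ (Fin n)} (hz : z ≠ 0) : φ x + fderiv ℝ φ x z < φ (x + z) := by
  have h1 : ∀ z : EuclideanSpace ℝ (Fin n), fderiv ℝ φ x z ≤ φ (x + z) - φ x := by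
    intro z
    have h3 : Tendsto (fun j : ℕ => ‖(2 : ℝ) ^ j‖) atTop atTop := by
      simpa using tendsto_pow_atTop_atTop_of_one_lt (one_lt_two (α := ℝ))
    refine le_of_tendsto' (hd.hasFDerivAt.lim z h3) fun j => ?_
    have hj : (1 : ℝ) ≤ 2 ^ j := one_le_pow₀ one_le_two
    have h4 := h.convexOn.2 (mem_univ x) (mem_univ (x + z))
      (sub_nonneg.2 (inv_le_one_of_one_le₀ hj)) (show (0 : ℝ) ≤ ((2 : ℝ) ^ j)⁻¹ by positivity)
      (by ring)
    rw [show (1 - ((2 : ℝ) ^ j)⁻¹) • x + ((2 : ℝ) ^ j)⁻¹ • (x + z) = x + ((2 : ℝ) ^ j)⁻¹ • z by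
      module, smul_eq_mul, smul_eq_mul] at h4
    rw [smul_eq_mul]
    calc (2 : ℝ) ^ j * (φ (x + ((2 : ℝ) ^ j)⁻¹ • z) - φ x)
        ≤ (2 : ℝ) ^ j * (((2 : ℝ) ^ j)⁻¹ * (φ (x + z) - φ x)) := by gcongr; linarith
      _ = φ (x + z) - φ x := by rw [mul_inv_cancel_left₀ (by positivity)]
  have h2 := h1 ((2⁻¹ : ℝ) • z)
  have h5 := h.2 (mem_univ x) (mem_univ (x + z)) (by simpa using hz)
    (show (0 : ℝ) < 2⁻¹ by norm_num) (show (0 : ℝ) < 2⁻¹ by norm_num) (by norm_num)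
  rw [show (2⁻¹ : ℝ) • x + (2⁻¹ : ℝ) • (x + z) = x + (2⁻¹ : ℝ) • z by module, smul_eq_mul,
    smul_eq_mul] at h5
  rw [map_smul, smul_eq_mul] at h2
  linarith

lemma _root_.StrictConvexOn.secondIncr_pos {φ : EuclideanSpace ℝ (Fin n) → ℝ} (h : StrictConvexOn ℝ univ φ) (x : EuclideanSpace ℝ (Fin n))
    {z : EuclideanSpace ℝ (Fin n)} (hz : z ≠ 0) : 0 < secondIncr φ x z := by
  have h1 := h.2 (mem_univ (x + z)) (mem_univ (x - z))
    (fun h => hz (by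
      have h2 : (2 : ℝ) • z = 0 := by
        calc (2 : ℝ) • z = (x + z) - (x - z) := by module
          _ = 0 := sub_eq_zero.2 h
      simpa using h2)) (show (0 : ℝ) < 2⁻¹ by norm_num) (show (0 : ℝ) < 2⁻¹ by norm_num)
    (by norm_num)
  rw [show (2⁻¹ : ℝ) • (x + z) + (2⁻¹ : ℝ) • (x - z) = x by module, smul_eq_mul,
    smul_eq_mul] at h1
  unfold secondIncr
  linarith

lemma secondIncr_nonneg_of_convexOn {φ : EuclideanSpace ℝ (Fin n) → ℝ} (h : ConvexOn ℝ univ φ) (x z : EuclideanSpace ℝ (Fin n)) :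
    0 ≤ secondIncr φ x z := by
  have h1 := h.2 (mem_univ (x + z)) (mem_univ (x - z))
    (show (0 : ℝ) ≤ 2⁻¹ by norm_num) (show (0 : ℝ) ≤ 2⁻¹ by norm_num) (by norm_num)
  rw [show (2⁻¹ : ℝ) • (x + z) + (2⁻¹ : ℝ) • (x - z) = x by module, smul_eq_mul,
    smul_eq_mul] at h1
  unfold secondIncr
  linarith

/-- With t = 1/|z| this bounds the increments from below, linearly in |z|, by their minimum on the
unit sphere. -/
lemma secondIncr_smul_le_of_convexOn {φ : EuclideanSpace ℝ (Fin n) → ℝ} (h : ConvexOn ℝ univ φ) (x z : EuclideanSpace ℝ (Fin n)) {t : ℝ}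
    (h0 : 0 ≤ t) (h1 : t ≤ 1) : secondIncr φ x (t • z) ≤ t * secondIncr φ x z := by
  have e1 := h.2 (mem_univ x) (mem_univ (x + z)) (sub_nonneg.2 h1) h0 (by ring)
  have e2 := h.2 (mem_univ x) (mem_univ (x - z)) (sub_nonneg.2 h1) h0 (by ring)
  rw [show (1 - t) • x + t • (x + z) = x + t • z by module, smul_eq_mul, smul_eq_mul] at e1
  rw [show (1 - t) • x + t • (x - z) = x - t • z by module, smul_eq_mul, smul_eq_mul] at e2
  unfold secondIncr
  linarith

/-- The fractional Monge–Ampère operator is bounded below by a positive constant at each point of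
a strictly convex, Lipschitz and semiconcave function. -/
lemma exists_le_linOp_of_strictConvexOn [NeZero n] {s : ℝ} (hs : 1 / 2 < s) (hs' : s < 1)
    {φ : EuclideanSpace ℝ (Fin n) → ℝ} {L : ℝ≥0} (hφ : LipschitzWith L φ) {K : ℝ}
    (hK : ∀ x y, secondIncr φ x y ≤ K * ‖y‖ ^ 2) (hconv : StrictConvexOn ℝ univ φ) (x : EuclideanSpace ℝ (Fin n)) :
    ∃ F, 0 < F ∧ ∀ A : Matrix (Fin n) (Fin n) ℝ, A.PosDef → A.det = 1 →
      Integrable (integrand s A φ x) ∧ F ≤ linOp s A φ x := by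
  have hs0 : 0 < s := by linarith
  have hcont : Continuous (secondIncr φ x) := by
    have := hφ.continuous
    unfold secondIncr
    fun_prop
  have hnn := secondIncr_nonneg_of_convexOn hconv.convexOn x
  have hquad : QuadLinBound (max K (2 * L)) (secondIncr φ x) := by
    intro y
    have h1 := secondIncr_le_capFun hφ hK x y
    rw [abs_of_nonneg (hnn y)]
    refine ⟨(h1.trans (min_le_left _ _)).trans ?_, (h1.trans (min_le_right _ _)).trans ?_⟩
    · gcongr; exact le_max_left _ _
    · gcongr; exact le_max_right _ _
  obtain ⟨e, he⟩ := exists_norm_eq (EuclideanSpace ℝ (Fin n)) zero_le_one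
  obtain ⟨e₁, he₁, hmin⟩ := (isCompact_sphere (0 : EuclideanSpace ℝ (Fin n)) 1).exists_isMinOn
    ⟨e, by simpa using he⟩ hcont.continuousOn
  set m := secondIncr φ x e₁
  have hm : 0 < m := by
    refine hconv.secondIncr_pos x fun h => ?_
    simp [h] at he₁
  have hfar : ∀ z, 1 ≤ ‖z‖ → m * ‖z‖ ≤ secondIncr φ x z := by
    intro z hz
    have hz0 : 0 < ‖z‖ := by linarith
    have h1 := secondIncr_smul_le_of_convexOn hconv.convexOn x z (t := ‖z‖⁻¹) (by positivity)
      (inv_le_one_of_one_le₀ hz)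
    have h2 : m ≤ secondIncr φ x (‖z‖⁻¹ • z) := hmin (by
      rw [mem_sphere_zero_iff_norm, norm_smul, norm_inv, norm_norm, inv_mul_cancel₀ hz0.ne'])
    have h3 := h2.trans h1
    rwa [inv_mul_eq_div, le_div_iff₀ hz0] at h3
  -- Only distances at least 1, that is τ ≤ 1, are kept. There the linear growth gives m ∫₀¹
  -- τ^(2s-2) dτ, finite as s > 1/2.
  have hline : ∀ v : EuclideanSpace ℝ (Fin n), ‖v‖ = 1 → m / (2 * s - 1) ≤ lineOp s (secondIncr φ x) v := by
    intro v hv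
    have hli : LineIntegrable s (secondIncr φ x) v :=
      hquad.lineIntegrable hs hs' hcont.measurable v
    have hI : IntegrableOn (fun τ : ℝ => m * τ ^ (2 * s - 2)) (Ioc 0 1) :=
      (integrableOn_Ioc_rpow (by linarith) zero_le_one).const_mul _
    calc m / (2 * s - 1) = ∫ τ in Ioc (0 : ℝ) 1, m * τ ^ (2 * s - 2) := by
          rw [integral_const_mul, ← intervalIntegral.integral_of_le zero_le_one,
            integral_rpow (Or.inl (by linarith)), Real.one_rpow,
            Real.zero_rpow (by linarith), show 2 * s - 2 + 1 = 2 * s - 1 by ring, sub_zero,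
            mul_one_div]
      _ ≤ ∫ τ in Ioc (0 : ℝ) 1, secondIncr φ x (τ⁻¹ • v) * τ ^ (2 * s - 1) := by
          refine setIntegral_mono_on hI (hli.mono_set Ioc_subset_Ioi_self) measurableSet_Ioc
            fun τ hτ => ?_
          have hτ0 : 0 < τ := hτ.1
          have h1 : ‖τ⁻¹ • v‖ = τ⁻¹ := by
            rw [norm_smul, hv, mul_one, Real.norm_of_nonneg (by positivity)]
          have h2 := hfar (τ⁻¹ • v) (by rw [h1]; exact (one_le_inv₀ hτ0).2 hτ.2)
          rw [h1] at h2
          calc m * τ ^ (2 * s - 2) = m * τ⁻¹ * τ ^ (2 * s - 1) := by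
                rw [show 2 * s - 1 = (2 * s - 2) + 1 by ring, Real.rpow_add_one hτ0.ne']
                field_simp
            _ ≤ _ := by gcongr
      _ ≤ lineOp s (secondIncr φ x) v := by
          refine setIntegral_mono_set hli ?_ Ioc_subset_Ioi_self.eventuallyLE
          filter_upwards [ae_restrict_mem measurableSet_Ioi] with τ hτ
          exact mul_nonneg (hnn _) (Real.rpow_nonneg (le_of_lt hτ) _)
  have hq : 0 < m / (2 * s - 1) := div_pos hm (by linarith)
  have hJ := integral_along_pos hs0 hs'.le he
  have hΓ : 0 < Real.Gamma ((n : ℝ) / 2 + s) := Real.Gamma_pos_of_pos (by positivity)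
  refine ⟨m / (2 * s - 1) * (∫ z : EuclideanSpace ℝ (Fin n), |⟪e, z⟫| ^ (2 * s) * Real.exp (-‖z‖ ^ 2)) /
    Real.Gamma ((n : ℝ) / 2 + s), by positivity, fun A hA hdet => ?_⟩
  have hi := hquad.integrable_integrand hs hs' hφ.continuous.measurable hdet
  refine ⟨hi, ?_⟩
  -- Determinant one forces an eigenvalue at least 1, which makes the lower bound uniform in A.
  obtain ⟨j, hj⟩ := exists_one_le_eigenvalue hA hdet
  have h1 := le_gamma_mul_linOp hs0 hφ.continuous.measurable hA hdet hi hq.le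
    (mul_rpow_norm_le_lineOp hs0 (secondIncr_zero _ _) hline) he j
  rw [div_le_iff₀' hΓ]
  refine le_trans ?_ h1
  gcongr
  exact le_mul_of_one_le_right hq.le (Real.one_le_rpow hj (by positivity))

/-- A supersolution that approaches the datum at infinity lies strictly above it. -/
lemma lt_of_isSupersolutionOn [NeZero n] {s : ℝ} (hs : 1 / 2 < s) (hs' : s < 1)
    {φ u : EuclideanSpace ℝ (Fin n) → ℝ} {L : ℝ≥0} (hL : 0 < L) (hφ : LipschitzWith L φ) {K : ℝ} (hK0 : 0 ≤ K)
    (hK : ∀ x y, secondIncr φ x y ≤ K * ‖y‖ ^ 2) (hd : Differentiable ℝ φ)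
    (hconv : StrictConvexOn ℝ univ φ) (hu : Continuous u)
    (hsup : IsSupersolutionOn s univ (fun x => u x - φ x) u)
    (hlim : Tendsto (fun x => u x - φ x) (Bornology.cobounded (EuclideanSpace ℝ (Fin n))) (𝓝 0)) (x : EuclideanSpace ℝ (Fin n)) : φ x < u x := by
  have hg : Continuous fun x => u x - φ x := hu.sub hφ.continuous
  obtain ⟨B, hB⟩ := exists_abs_le_of_tendsto_cobounded hg hlim
  by_contra! hx
  -- A negative value of u - φ is attained as a minimum because u - φ vanishes at infinity. Without
  -- negative values the given point already is a minimum, with value 0.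
  obtain ⟨x₀, hx₀, hmin⟩ : ∃ x₀, u x₀ - φ x₀ ≤ 0 ∧ ∀ y, u x₀ - φ x₀ ≤ u y - φ y := by
    by_cases h : ∃ x₁, u x₁ - φ x₁ < 0
    · obtain ⟨x₁, hx₁⟩ := h
      rw [Metric.cobounded_eq_cocompact] at hlim
      obtain ⟨x₀, h0⟩ := hg.exists_forall_le' x₁
        ((hlim.eventually (lt_mem_nhds hx₁)).mono fun y hy => hy.le)
      exact ⟨x₀, (h0 x₁).trans hx₁.le, h0⟩
    · push Not at h
      exact ⟨x, by linarith, fun y => by linarith [h y]⟩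
  obtain ⟨F, hF, hA⟩ := exists_le_linOp_of_strictConvexOn hs hs' hφ hK hconv x₀
  -- The comparison function is φ itself. Its tangent plane, moved to the height of u at the minimum
  -- point, lies below u by convexity, so the opening c = 0 suffices.
  have h1 := hsup.ge_of_touching hs hs' hu (abs_le_of_lipschitzWith hφ hB) (x := x₀)
    (p := (InnerProductSpace.toDual ℝ (EuclideanSpace ℝ (Fin n))).symm (fderiv ℝ φ x₀)) (c := 0) le_rfl (fun z => by
      rw [InnerProductSpace.toDual_symm_apply, zero_mul, sub_zero]
      have h2 := hmin (x₀ + z)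
      rcases eq_or_ne z 0 with rfl | hz
      · simp
      · linarith [hconv.add_fderiv_lt (hd x₀) hz]) hL hφ (C := K + 1) (by positivity)
    (fun x y => (hK x y).trans (by gcongr; linarith)) (x' := x₀) (fun z => by
      have h2 := hmin (x₀ + z)
      have h3 := hmin (x₀ - z)
      unfold secondIncr
      linarith) hF hA
  linarith

end Solution

/-! ### Inf-convolution as a semiconcave comparison function. -/

section InfConvolution

variable {n : ℕ}

/-- The infimal convolution of `u` with the paraboloid `κ |x|²`. -/
def infConv (κ : ℝ) (u : EuclideanSpace ℝ (Fin n) → ℝ) (x : EuclideanSpace ℝ (Fin n)) : ℝ := ⨅ y, (u y + κ * ‖x - y‖ ^ 2)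

variable {u φ : EuclideanSpace ℝ (Fin n) → ℝ} {L : ℝ≥0} {B κ : ℝ}

lemma sub_le_add_mul_norm_sq (hκ : 0 < κ) (hφ : LipschitzWith L φ) (hB : ∀ x, |u x - φ x| ≤ B)
    (x y : EuclideanSpace ℝ (Fin n)) : φ x - (B + L ^ 2 / (4 * κ)) ≤ u y + κ * ‖x - y‖ ^ 2 := by
  have h1 := (abs_le.1 (hB y)).1
  have h2 := (le_abs_self _).trans (hφ.dist_le_mul x y)
  rw [dist_eq_norm] at h2
  have h3 : 0 ≤ κ * (‖x - y‖ - L / (2 * κ)) ^ 2 := by positivity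
  have h4 : κ * (‖x - y‖ - L / (2 * κ)) ^ 2 =
      κ * ‖x - y‖ ^ 2 - L * ‖x - y‖ + L ^ 2 / (4 * κ) := by
    field_simp
    ring
  linarith

lemma bddBelow_infConv (hκ : 0 < κ) (hφ : LipschitzWith L φ) (hB : ∀ x, |u x - φ x| ≤ B) (x : EuclideanSpace ℝ (Fin n)) :
    BddBelow (range fun y => u y + κ * ‖x - y‖ ^ 2) :=
  ⟨_, forall_mem_range.2 (sub_le_add_mul_norm_sq hκ hφ hB x)⟩

lemma abs_infConv_sub_le (hκ : 0 < κ) (hφ : LipschitzWith L φ) (hB : ∀ x, |u x - φ x| ≤ B)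
    (x : EuclideanSpace ℝ (Fin n)) : |infConv κ u x - φ x| ≤ B + L ^ 2 / (4 * κ) := by
  have h1 : infConv κ u x ≤ u x + κ * ‖x - x‖ ^ 2 := ciInf_le (bddBelow_infConv hκ hφ hB x) x
  have h2 : φ x - (B + L ^ 2 / (4 * κ)) ≤ infConv κ u x :=
    le_ciInf (sub_le_add_mul_norm_sq hκ hφ hB x)
  have h3 := (abs_le.1 (hB x)).2
  have h4 : 0 ≤ (L : ℝ) ^ 2 / (4 * κ) := by positivity
  rw [sub_self, norm_zero] at h1
  rw [abs_le]
  constructor <;> linarith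

/-- An infimum of functions with the common second increment 2κ|z|² has at most that increment; the
parallelogram law computes it. -/
lemma secondIncr_infConv_le (hκ : 0 < κ) (hφ : LipschitzWith L φ) (hB : ∀ x, |u x - φ x| ≤ B)
    (x z : EuclideanSpace ℝ (Fin n)) : secondIncr (infConv κ u) x z ≤ 2 * κ * ‖z‖ ^ 2 := by
  have h : (infConv κ u (x + z) + infConv κ u (x - z) - 2 * κ * ‖z‖ ^ 2) / 2 ≤ infConv κ u x := by
    refine le_ciInf fun y => ?_
    have h1 : infConv κ u (x + z) ≤ u y + κ * ‖x + z - y‖ ^ 2 :=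
      ciInf_le (bddBelow_infConv hκ hφ hB _) y
    have h2 : infConv κ u (x - z) ≤ u y + κ * ‖x - z - y‖ ^ 2 :=
      ciInf_le (bddBelow_infConv hκ hφ hB _) y
    have h3 := parallelogram_law_with_norm ℝ (x - y) z
    rw [show x - y + z = x + z - y by abel, show x - y - z = x - z - y by abel] at h3
    nlinarith
  unfold secondIncr
  linarith

lemma infConv_eq_of_le {x y : EuclideanSpace ℝ (Fin n)} (hκ : 0 < κ) (hφ : LipschitzWith L φ)
    (hB : ∀ x, |u x - φ x| ≤ B)
    (h : ∀ y', u y + κ * ‖x - y‖ ^ 2 ≤ u y' + κ * ‖x - y'‖ ^ 2) :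
    infConv κ u x = u y + κ * ‖x - y‖ ^ 2 :=
  le_antisymm (ciInf_le (bddBelow_infConv hκ hφ hB _) y) (le_ciInf h)

/-- Moving the point and its minimiser by the same vector leaves the penalty unchanged, so the
inf-convolution is dominated by a translate of u with contact at x. -/
lemma secondIncr_infConv_le_of_eq {x y : EuclideanSpace ℝ (Fin n)} (hκ : 0 < κ) (hφ : LipschitzWith L φ)
    (hB : ∀ x, |u x - φ x| ≤ B) (h : infConv κ u x = u y + κ * ‖x - y‖ ^ 2) (z : EuclideanSpace ℝ (Fin n)) :
    secondIncr (infConv κ u) x z ≤ secondIncr u y z := by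
  have h1 : infConv κ u (x + z) ≤ u (y + z) + κ * ‖x + z - (y + z)‖ ^ 2 :=
    ciInf_le (bddBelow_infConv hκ hφ hB _) _
  have h2 : infConv κ u (x - z) ≤ u (y - z) + κ * ‖x - z - (y - z)‖ ^ 2 :=
    ciInf_le (bddBelow_infConv hκ hφ hB _) _
  rw [add_sub_add_right_eq_sub] at h1
  rw [sub_sub_sub_cancel_right] at h2
  unfold secondIncr
  linarith

end InfConvolution

/-! ### Doubling of variables and the semiconcavity of solutions. -/

section Semiconcavity

variable {n : ℕ} {s : ℝ}

lemma measurable_integrand {A : Matrix (Fin n) (Fin n) ℝ} {u : EuclideanSpace ℝ (Fin n) → ℝ} (hu : Measurable u) (x : EuclideanSpace ℝ (Fin n)) :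
    Measurable (integrand s A u x) := by
  unfold integrand
  exact (measurable_secondIncr hu x).div
    ((continuous_toEuclideanLin A⁻¹).measurable.norm.pow_const _)

/-- If the second increments of a Lipschitz semiconcave function dominate an average of those of
`u` at two points, then its integrals converge and are bounded below accordingly. -/
lemma integrable_and_le_linOp_of_average [NeZero n] (hs : 1 / 2 < s) (hs' : s < 1) {u w : EuclideanSpace ℝ (Fin n) → ℝ}
    {L : ℝ≥0} (hw : LipschitzWith L w) {C : ℝ} (hC0 : 0 ≤ C)
    (hC : ∀ x y, secondIncr w x y ≤ C * ‖y‖ ^ 2)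
    {x x₁ x₂ : EuclideanSpace ℝ (Fin n)} (h : ∀ z, 1 / 2 * (secondIncr u x₁ z + secondIncr u x₂ z) ≤ secondIncr w x z)
    {A : Matrix (Fin n) (Fin n) ℝ} (hdet : A.det = 1) {f₁ f₂ : ℝ}
    (h₁ : Integrable (integrand s A u x₁) ∧ f₁ ≤ linOp s A u x₁)
    (h₂ : Integrable (integrand s A u x₂) ∧ f₂ ≤ linOp s A u x₂) :
    Integrable (integrand s A w x) ∧ 1 / 2 * (f₁ + f₂) ≤ linOp s A w x := by
  -- The increment of b at x is exactly the cap. It serves as an integrable majorant for w, while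
  -- the average of the two increments of u is the integrable minorant.
  set b : EuclideanSpace ℝ (Fin n) → ℝ := fun y => 1 / 2 * capFun C L (y - x)
  have hb : ∀ z, secondIncr b x z = capFun C L z := by
    intro z
    simp only [secondIncr, b, add_sub_cancel_left, sub_sub_cancel_left, sub_self, capFun, norm_neg,
      norm_zero]
    norm_num
    ring
  have hbq : QuadLinBound (max C (2 * L)) (secondIncr b x) := by
    intro z
    rw [hb, abs_of_nonneg (capFun_nonneg hC0 L.coe_nonneg z)]
    constructor
    · exact (min_le_left _ _).trans (by gcongr; exact le_max_left _ _)
    · exact (min_le_right _ _).trans (by gcongr; exact le_max_right _ _)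
  have hbm : Measurable b :=
    (((continuous_capFun C L).comp (continuous_id.sub continuous_const)).const_mul _).measurable
  have hbi := hbq.integrable_integrand hs hs' hbm hdet
  have hlow : ∀ y, 1 / 2 * (integrand s A u x₁ y + integrand s A u x₂ y) ≤ integrand s A w x y := by
    intro y
    unfold integrand
    rw [← add_div, ← mul_div_assoc]
    gcongr
    exact h y
  have hli := (h₁.1.add h₂.1).const_mul (1 / 2)
  have hi : Integrable (integrand s A w x) := by
    refine integrable_of_le_of_le
      (measurable_integrand hw.continuous.measurable x).aestronglyMeasurable
      (Eventually.of_forall hlow) (Eventually.of_forall fun y => ?_) hli hbi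
    exact integrand_le_integrand ((secondIncr_le_capFun hw hC x y).trans_eq (hb y).symm)
  refine ⟨hi, ?_⟩
  have h3 := integral_mono hli hi hlow
  simp only [Pi.add_apply] at h3
  rw [integral_const_mul, integral_add h₁.1 h₂.1] at h3
  have h4 := h₁.2
  have h5 := h₂.2
  unfold linOp at h4 h5 ⊢
  linarith

/-- The functional whose maximum points witness a failure of semiconcavity. -/
def doubling (κ : ℝ) (u : EuclideanSpace ℝ (Fin n) → ℝ) (h : EuclideanSpace ℝ (Fin n)) (P : EuclideanSpace ℝ (Fin n) × EuclideanSpace ℝ (Fin n) × EuclideanSpace ℝ (Fin n)) : ℝ :=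
  1 / 2 * u P.1 + 1 / 2 * u P.2.1 - (u P.2.2 + κ * ‖(2⁻¹ : ℝ) • (P.1 + P.2.1) - P.2.2‖ ^ 2) -
    κ * ‖P.1 - P.2.1 - (2 : ℝ) • h‖ ^ 2

lemma continuous_doubling {κ : ℝ} {u : EuclideanSpace ℝ (Fin n) → ℝ} (hu : Continuous u) (h : EuclideanSpace ℝ (Fin n)) :
    Continuous (doubling κ u h) := by
  unfold doubling
  fun_prop

/-- In φ the points x₁, x₂, y are replaced by m + h, m - h, m, where m is the midpoint. Half of the
quadratic penalty absorbs the Lipschitz cost of this, at the price L²/κ. -/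
lemma doubling_le {κ : ℝ} (hκ : 0 < κ) {u φ : EuclideanSpace ℝ (Fin n) → ℝ} {L : ℝ≥0} (hφ : LipschitzWith L φ) {k : ℝ}
    {h : EuclideanSpace ℝ (Fin n)} (hk : ∀ x, 1 / 2 * secondIncr φ x h ≤ k) (x₁ x₂ y : EuclideanSpace ℝ (Fin n)) :
    doubling κ u h (x₁, x₂, y) ≤ k + L ^ 2 / κ + 1 / 2 * ((u x₁ - φ x₁) + (u x₂ - φ x₂)) -
      (u y - φ y) - κ / 2 * (‖(2⁻¹ : ℝ) • (x₁ + x₂) - y‖ ^ 2 +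
        ‖x₁ - x₂ - (2 : ℝ) • h‖ ^ 2) := by
  set m := (2⁻¹ : ℝ) • (x₁ + x₂)
  set d := x₁ - x₂ - (2 : ℝ) • h
  have h1 := (le_abs_self _).trans (hφ.dist_le_mul x₁ (m + h))
  have h2 := (le_abs_self _).trans (hφ.dist_le_mul x₂ (m - h))
  have h3 := (le_abs_self _).trans (hφ.dist_le_mul m y)
  rw [dist_eq_norm, show x₁ - (m + h) = (2⁻¹ : ℝ) • d by simp only [m, d]; module, norm_smul,
    Real.norm_of_nonneg (by norm_num)] at h1
  rw [dist_eq_norm, show x₂ - (m - h) = (-2⁻¹ : ℝ) • d by simp only [m, d]; module, norm_smul,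
    norm_neg, Real.norm_of_nonneg (by norm_num)] at h2
  rw [dist_eq_norm] at h3
  have h4 := hk m
  unfold secondIncr at h4
  have e1 : ∀ t : ℝ, L * t ≤ κ / 2 * t ^ 2 + L ^ 2 / (2 * κ) := by
    intro t
    have h5 : 0 ≤ κ / 2 * (t - L / κ) ^ 2 := by positivity
    have h6 : κ / 2 * (t - L / κ) ^ 2 = κ / 2 * t ^ 2 - L * t + L ^ 2 / (2 * κ) := by
      field_simp
      ring
    linarith
  have e2 := e1 ‖m - y‖
  have e3 := e1 ‖d‖
  have e4 : 0 ≤ (L : ℝ) * ‖d‖ := by positivity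
  have e5 : (L : ℝ) ^ 2 / κ = L ^ 2 / (2 * κ) + L ^ 2 / (2 * κ) := by field_simp; ring
  simp only [doubling]
  change 1 / 2 * u x₁ + 1 / 2 * u x₂ - (u y + κ * ‖m - y‖ ^ 2) - κ * ‖d‖ ^ 2 ≤ _
  linarith

/-- Where the functional is at least k + γ the previous bound confines all three points: the
penalties are bounded because u - φ is bounded and nonnegative, and x₁, x₂ cannot both be far out,
where u - φ < γ/2. -/
lemma exists_doubling_max {κ : ℝ} (hκ : 0 < κ) {u φ : EuclideanSpace ℝ (Fin n) → ℝ} {L : ℝ≥0} (hu : Continuous u)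
    (hφ : LipschitzWith L φ) {B : ℝ} (hB : ∀ x, |u x - φ x| ≤ B) (hpos : ∀ x, φ x ≤ u x)
    (hlim : Tendsto (fun x => u x - φ x) (Bornology.cobounded (EuclideanSpace ℝ (Fin n))) (𝓝 0)) {k γ : ℝ} {h x₀ : EuclideanSpace ℝ (Fin n)}
    (hk : ∀ x, 1 / 2 * secondIncr φ x h ≤ k) (hγ : 0 < γ) (hLκ : L ^ 2 / κ ≤ γ / 2)
    (hx₀ : k + γ ≤ 1 / 2 * secondIncr u x₀ h) :
    ∃ P, k + γ ≤ doubling κ u h P ∧ ∀ Q, doubling κ u h Q ≤ doubling κ u h P := by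
  have h0 : doubling κ u h (x₀ + h, x₀ - h, x₀) = 1 / 2 * secondIncr u x₀ h := by
    have e1 : (2⁻¹ : ℝ) • (x₀ + h + (x₀ - h)) - x₀ = 0 := by module
    have e2 : x₀ + h - (x₀ - h) - (2 : ℝ) • h = 0 := by module
    simp only [doubling, e1, e2, norm_zero, secondIncr]
    ring
  obtain ⟨R, hR⟩ := exists_forall_abs_lt_of_tendsto_cobounded hlim (half_pos hγ)
  set D := √(2 * B / κ)
  set r := |R| + 2 * ‖h‖ + 2 * D
  have hbdd : ∀ x₁ x₂ y, k + γ ≤ doubling κ u h (x₁, x₂, y) → ‖x₁‖ ≤ r ∧ ‖x₂‖ ≤ r ∧ ‖y‖ ≤ r := by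
    intro x₁ x₂ y hP
    have h1 := hP.trans (doubling_le hκ hφ hk x₁ x₂ y)
    set m := (2⁻¹ : ℝ) • (x₁ + x₂)
    set d := x₁ - x₂ - (2 : ℝ) • h
    have hB1 := (le_abs_self _).trans (hB x₁)
    have hB2 := (le_abs_self _).trans (hB x₂)
    have hpy := hpos y
    have hsq : ∀ t : ℝ, κ / 2 * t ^ 2 ≤ B → t ≤ D := by
      intro t ht
      refine Real.le_sqrt_of_sq_le ?_
      rw [le_div_iff₀ hκ]
      linarith
    have hm0 : 0 ≤ κ / 2 * ‖m - y‖ ^ 2 := by positivity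
    have hd0 : 0 ≤ κ / 2 * ‖d‖ ^ 2 := by positivity
    have hm := hsq ‖m - y‖ (by linarith)
    have hd := hsq ‖d‖ (by linarith)
    have e1 : ‖x₁ - x₂‖ ≤ D + 2 * ‖h‖ := by
      calc ‖x₁ - x₂‖ = ‖d + (2 : ℝ) • h‖ := by simp only [d]; congr 1; abel
        _ ≤ ‖d‖ + ‖(2 : ℝ) • h‖ := norm_add_le _ _
        _ ≤ _ := by rw [norm_smul, Real.norm_of_nonneg zero_le_two]; gcongr
    have hor : ‖x₁‖ ≤ |R| ∨ ‖x₂‖ ≤ |R| := by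
      by_contra! hcon
      have g1 := (le_abs_self _).trans_lt (hR x₁ ((le_abs_self R).trans hcon.1.le))
      have g2 := (le_abs_self _).trans_lt (hR x₂ ((le_abs_self R).trans hcon.2.le))
      linarith
    have hD : 0 ≤ D := Real.sqrt_nonneg _
    have hh := norm_nonneg h
    have e2 : ‖x₁‖ ≤ |R| + (D + 2 * ‖h‖) ∧ ‖x₂‖ ≤ |R| + (D + 2 * ‖h‖) := by
      have e3 := norm_sub_norm_le x₁ x₂
      have e4 := norm_sub_norm_le x₂ x₁
      rw [norm_sub_rev] at e4
      rcases hor with hx | hx <;> constructor <;> linarith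
    have e5 : ‖m‖ ≤ |R| + (D + 2 * ‖h‖) := by
      have e6 := norm_add_le x₁ x₂
      simp only [m]
      rw [norm_smul, Real.norm_of_nonneg (by norm_num)]
      linarith
    have e7 := norm_sub_norm_le y m
    rw [norm_sub_rev] at e7
    refine ⟨?_, ?_, ?_⟩ <;> simp only [r] <;> linarith
  have hev : ∀ᶠ P in cocompact (EuclideanSpace ℝ (Fin n) × EuclideanSpace ℝ (Fin n) × EuclideanSpace ℝ (Fin n)),
      doubling κ u h P ≤ doubling κ u h (x₀ + h, x₀ - h, x₀) := by
    have hc : IsCompact (Metric.closedBall (0 : EuclideanSpace ℝ (Fin n)) r ×ˢ (Metric.closedBall (0 : EuclideanSpace ℝ (Fin n)) r ×ˢ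
        Metric.closedBall (0 : EuclideanSpace ℝ (Fin n)) r)) :=
      (isCompact_closedBall _ _).prod ((isCompact_closedBall _ _).prod (isCompact_closedBall _ _))
    filter_upwards [hc.compl_mem_cocompact] with P hP
    by_contra! hcon
    rw [h0] at hcon
    have := hbdd P.1 P.2.1 P.2.2 (hx₀.trans hcon.le)
    exact hP (by simpa [mem_prod] using this)
  obtain ⟨P, hP⟩ := (continuous_doubling hu h).exists_forall_ge' _ hev
  exact ⟨P, (hx₀.trans h0.ge).trans (hP _), hP⟩

/-- Solutions inherit the semiconcavity of the data at infinity. -/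
lemma IsSolution.secondIncr_le [NeZero n] (hs : 1 / 2 < s) (hs' : s < 1) {φ u : EuclideanSpace ℝ (Fin n) → ℝ}
    (hsol : IsSolution s φ u) {L : ℝ≥0} (hφ : LipschitzWith L φ) {K : ℝ}
    (hK : ∀ x y, secondIncr φ x y ≤ K * ‖y‖ ^ 2) (hpos : ∀ x, φ x < u x) (x h : EuclideanSpace ℝ (Fin n)) :
    secondIncr u x h ≤ K * ‖h‖ ^ 2 := by
  have hu := continuous_of_sub_of_super hsol.sub hsol.super
  obtain ⟨B, hB⟩ := exists_abs_le_of_tendsto_cobounded (hu.sub hφ.continuous) hsol.tendsto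
  have hgrow := abs_le_of_lipschitzWith hφ hB
  by_contra! hcon
  set k := 1 / 2 * (K * ‖h‖ ^ 2)
  set γ := 1 / 2 * secondIncr u x h - k with hγdef
  have hγ : 0 < γ := by simp only [γ, k]; linarith
  -- The penalty is so strong that L²/κ costs at most half of the excess γ.
  set κ : ℝ := 2 * (L ^ 2 + 1) / γ
  have hκ : 0 < κ := by positivity
  have hLκ : (L : ℝ) ^ 2 / κ ≤ γ / 2 := by
    rw [div_le_iff₀ hκ]
    simp only [κ]
    field_simp
    linarith
  have hk : ∀ x, 1 / 2 * secondIncr φ x h ≤ k := fun x => by simp only [k]; linarith [hK x h]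
  obtain ⟨⟨x₁, x₂, y⟩, hP, hmax⟩ := exists_doubling_max hκ hu hφ hB (fun x => (hpos x).le)
    hsol.tendsto hk hγ hLκ (x₀ := x) (by linarith)
  have hle := hP.trans (doubling_le hκ hφ hk x₁ x₂ y)
  set m := (2⁻¹ : ℝ) • (x₁ + x₂) with hm
  set d := x₁ - x₂ - (2 : ℝ) • h with hd
  have hval : doubling κ u h (x₁, x₂, y) =
      1 / 2 * u x₁ + 1 / 2 * u x₂ - (u y + κ * ‖m - y‖ ^ 2) - κ * ‖d‖ ^ 2 := rfl
  have hsq : ∀ a z : EuclideanSpace ℝ (Fin n), ‖a + z‖ ^ 2 = ‖a‖ ^ 2 + 2 * ⟪a, z⟫ + ‖z‖ ^ 2 := norm_add_sq_real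
  -- With the other two variables frozen, maximality puts a paraboloid above u at x₁. Its opening is
  -- 2(κ/4 + κ), one term from each penalty.
  have htouch₁ : ∀ z, u (x₁ + z) ≤ u x₁ + ⟪(2 * κ) • (m - y) + (4 * κ) • d, z⟫ +
      5 / 2 * κ * ‖z‖ ^ 2 := by
    intro z
    have h1 := hmax (x₁ + z, x₂, y)
    rw [hval] at h1
    simp only [doubling] at h1
    rw [show (2⁻¹ : ℝ) • (x₁ + z + x₂) - y = (m - y) + (2⁻¹ : ℝ) • z by rw [hm]; module,
      show x₁ + z - x₂ - (2 : ℝ) • h = d + z by rw [hd]; module, hsq, hsq, norm_smul,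
      Real.norm_of_nonneg (by norm_num : (0 : ℝ) ≤ 2⁻¹), inner_smul_right] at h1
    rw [inner_add_left, real_inner_smul_left, real_inner_smul_left]
    nlinarith
  have htouch₂ : ∀ z, u (x₂ + z) ≤ u x₂ + ⟪(2 * κ) • (m - y) - (4 * κ) • d, z⟫ +
      5 / 2 * κ * ‖z‖ ^ 2 := by
    intro z
    have h1 := hmax (x₁, x₂ + z, y)
    rw [hval] at h1
    simp only [doubling] at h1
    rw [show (2⁻¹ : ℝ) • (x₁ + (x₂ + z)) - y = (m - y) + (2⁻¹ : ℝ) • z by rw [hm]; module,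
      show x₁ - (x₂ + z) - (2 : ℝ) • h = d + -z by rw [hd]; module, hsq, hsq, norm_smul,
      Real.norm_of_nonneg (by norm_num : (0 : ℝ) ≤ 2⁻¹), inner_smul_right, inner_neg_right,
      norm_neg] at h1
    rw [inner_sub_left, real_inner_smul_left, real_inner_smul_left]
    nlinarith
  have hatt : ∀ y', u y + κ * ‖m - y‖ ^ 2 ≤ u y' + κ * ‖m - y'‖ ^ 2 := by
    intro y'
    have h1 := hmax (x₁, x₂, y')
    rw [hval] at h1
    simp only [doubling] at h1
    rw [← hm, ← hd] at h1
    linarith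
  have htouch : ∀ z, u y + ⟪(2 * κ) • (m - y), z⟫ - κ * ‖z‖ ^ 2 ≤ u (y + z) := by
    intro z
    have h1 := hatt (y + z)
    rw [show m - (y + z) = (m - y) + -z by abel, hsq, inner_neg_right, norm_neg] at h1
    rw [real_inner_smul_left]
    nlinarith
  set w := infConv κ u
  have hwm : w m = u y + κ * ‖m - y‖ ^ 2 := infConv_eq_of_le hκ hφ hB hatt
  have hwC := secondIncr_infConv_le hκ hφ hB
  obtain ⟨L', hL', hw⟩ := exists_lipschitzWith_of_semiconcave (by positivity) hwC hφ
    (abs_infConv_sub_le hκ hφ hB)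
  -- Shifting x₁ and x₂ by the same z moves the midpoint by z and leaves their difference alone.
  -- Since y' is free, maximality becomes an inequality for the inf-convolution.
  have hstep : ∀ z, 1 / 2 * u (x₁ + z) + 1 / 2 * u (x₂ + z) - 1 / 2 * u x₁ - 1 / 2 * u x₂ + w m ≤
      w (m + z) := by
    intro z
    refine le_ciInf fun y' => ?_
    have h1 := hmax (x₁ + z, x₂ + z, y')
    rw [hval] at h1
    simp only [doubling] at h1
    rw [show (2⁻¹ : ℝ) • (x₁ + z + (x₂ + z)) = m + z by rw [hm]; module,
      show x₁ + z - (x₂ + z) - (2 : ℝ) • h = d by rw [hd]; module] at h1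
    rw [hwm]
    linarith
  have havg : ∀ z, 1 / 2 * (secondIncr u x₁ z + secondIncr u x₂ z) ≤ secondIncr w m z := by
    intro z
    have h1 := hstep z
    have h2 := hstep (-z)
    simp only [← sub_eq_add_neg] at h2
    unfold secondIncr
    linarith
  have hpx₁ := hpos x₁
  have hpx₂ := hpos x₂
  have hpy := hpos y
  -- The subsolution inequalities at x₁ and x₂ give the lower bound F for all L_A of the
  -- inf-convolution at m, and F > 0 because u > φ. The supersolution test at y then yields F ≤ u(y)
  -- - φ(y).
  have hfin := hsol.super.ge_of_touching hs hs' hu hgrow hκ.le htouch hL' hw (by positivity) hwC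
    (secondIncr_infConv_le_of_eq hκ hφ hB hwm)
    (F := 1 / 2 * ((u x₁ - φ x₁) + (u x₂ - φ x₂))) (by linarith) fun A hA hdet =>
      integrable_and_le_linOp_of_average hs hs' hw (by positivity) hwC havg hdet
        (hsol.sub.pointwise hs hs' isOpen_univ hu hgrow (mem_univ x₁) htouch₁ hA hdet)
        (hsol.sub.pointwise hs hs' isOpen_univ hu hgrow (mem_univ x₂) htouch₂ hA hdet)
  -- Inserted in the upper bound of the functional, this leaves k + γ ≤ k + L²/κ ≤ k + γ/2, which is
  -- absurd.
  have e1 : 0 ≤ κ / 2 * (‖m - y‖ ^ 2 + ‖d‖ ^ 2) := by positivity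
  linarith

end Semiconcavity

/-! ### Assembly, with dimension one treated apart. -/

section Main

variable {n : ℕ} {s : ℝ}

lemma threshold_pos (hn : 2 ≤ n) (hs : 1 / 2 < s) {L C η : ℝ} (hL : 0 < L) (hC : 0 < C)
    (hη : 0 < η) : 0 < threshold n s L C η := by
  have h1 := mu0_pos hn hs hL hC hη
  have h2 := mu1_pos hs hL hC
  have h3 : (0 : ℝ) < n := Nat.cast_pos.2 (by omega)
  exact Real.rpow_pos_of_pos (by positivity) _

lemma IsSubsolutionOn.mono {Ω Ω' : Set (EuclideanSpace ℝ (Fin n))} {f f' u : EuclideanSpace ℝ (Fin n) → ℝ} (h : IsSubsolutionOn s Ω' f' u)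
    (hΩ : Ω ⊆ Ω') (hf : ∀ x ∈ Ω, f x ≤ f' x) : IsSubsolutionOn s Ω f u :=
  ⟨h.1.mono (closure_mono hΩ), fun x hx N hN hb hNΩ hxN ψ hψ hψx hlt =>
    (EReal.coe_le_coe_iff.2 (hf x hx)).trans
      (h.2 x (hΩ hx) N hN hb (hNΩ.trans hΩ) hxN ψ hψ hψx hlt)⟩

/-- In dimension one, determinant one leaves only the identity, so truncation at θ ≤ 1 removes
nothing. -/
lemma fracMA_eq_fracMATrunc_of_eq_one {u : EuclideanSpace ℝ (Fin 1) → ℝ} {θ : ℝ} (hθ : θ ≤ 1)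
    (x : EuclideanSpace ℝ (Fin 1)) : fracMA s u x = fracMATrunc s θ u x := by
  refine le_antisymm (le_iInf₂ fun A ⟨hA, hdet, _⟩ => iInf₂_le A ⟨hA, hdet⟩)
    (le_iInf₂ fun A ⟨hA, hdet⟩ => ?_)
  have h1 : A = 1 := by
    ext i j
    rw [Matrix.det_fin_one] at hdet
    rw [Subsingleton.elim i 0, Subsingleton.elim j 0, hdet, Matrix.one_apply_eq]
  subst h1
  exact iInf₂_le (1 : Matrix (Fin 1) (Fin 1) ℝ) ⟨hA, hdet, fun i => by rwa [eigenvalues_one]⟩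

end Main

end FracMA

end

theorem proposition6p3 (n : ℕ) (hn : 1 ≤ n) (s : ℝ) (hs : 1 / 2 < s) (hs' : s < 1)
    (α : ℝ≥0) (hα : 0 < α) (hα' : α ≤ 1)
    (φ u : EuclideanSpace ℝ (Fin n) → ℝ)
    (hφ : FracMA.IsDatum α φ) (hu : FracMA.IsSolution s φ u) :
    -- `u > φ` strictly
    (∀ x, φ x < u x) ∧
    -- `u` is Lipschitz and semiconcave
    (∃ L : ℝ≥0, LipschitzWith L u) ∧ (∃ C : ℝ, FracMA.IsSemiconcave C u) ∧
    -- `(1 - s) D_s u ≥ η₀ > 0` in the viscosity sense on bounded open sets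
    (∀ Ω : Set (EuclideanSpace ℝ (Fin n)), IsOpen Ω → Bornology.IsBounded Ω →
      ∃ η₀ : ℝ, 0 < η₀ ∧ FracMA.IsSubsolutionOn s Ω (fun _ => η₀ / (1 - s)) u) ∧
    -- quantitative uniform ellipticity where `(1 - s) D_s u ≥ η₀`
    (2 ≤ n → ∀ (L : ℝ≥0) (C η₀ : ℝ) (Ω : Set (EuclideanSpace ℝ (Fin n))),
      0 < L → 0 < C → 0 < η₀ → LipschitzWith L u → FracMA.IsSemiconcave C u → IsOpen Ω →
      FracMA.IsSubsolutionOn s Ω (fun _ => η₀ / (1 - s)) u →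
      ∀ θ : ℝ, 0 < θ → θ < FracMA.threshold n s L C η₀ →
        ∀ x ∈ Ω, FracMA.ClassicalAt s u x ∧ FracMA.fracMA s u x = FracMA.fracMATrunc s θ u x) ∧
    -- hence uniform ellipticity along `u` on every bounded set
    (∀ Ω : Set (EuclideanSpace ℝ (Fin n)), Bornology.IsBounded Ω →
      ∃ θ₀ : ℝ, 0 < θ₀ ∧ ∀ θ : ℝ, 0 < θ → θ ≤ θ₀ →
        ∀ x ∈ Ω, FracMA.ClassicalAt s u x ∧
          FracMA.fracMA s u x = FracMA.fracMATrunc s θ u x) := by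
  have : NeZero n := ⟨by omega⟩
  have hc := FracMA.continuous_of_sub_of_super hu.sub hu.super
  obtain ⟨L₀, K, hL₀, hφL, hK0, hφK⟩ := hφ.exists_bounds
  obtain ⟨B, hB⟩ := FracMA.exists_abs_le_of_tendsto_cobounded (hc.sub hφL.continuous) hu.tendsto
  have hgrow := FracMA.abs_le_of_lipschitzWith hφL hB
  have hpos := FracMA.lt_of_isSupersolutionOn hs hs' hL₀ hφL hK0 hφK
    (hφ.contDiff.differentiable two_ne_zero) hφ.strictConvex hc hu.super hu.tendsto
  have hsemi := hu.secondIncr_le hs hs' hφL hφK hpos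
  obtain ⟨L₁, hL₁, hL⟩ := FracMA.exists_lipschitzWith_of_semiconcave hK0 hsemi hφL hB
  -- The equation itself gives the bound: its right side u - φ is continuous and positive, hence
  -- bounded below by a positive constant on the compact closure.
  have hpart3 : ∀ Ω : Set (EuclideanSpace ℝ (Fin n)), IsOpen Ω → Bornology.IsBounded Ω →
      ∃ η₀ : ℝ, 0 < η₀ ∧ FracMA.IsSubsolutionOn s Ω (fun _ => η₀ / (1 - s)) u := by
    intro Ω _ hb
    have hs1 : 0 < 1 - s := by linarith
    obtain ⟨m, hm, hmΩ⟩ : ∃ m, 0 < m ∧ ∀ x ∈ Ω, m ≤ u x - φ x := by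
      rcases (closure Ω).eq_empty_or_nonempty with he | hne
      · exact ⟨1, one_pos, fun x hx => absurd (subset_closure hx) (by simp [he])⟩
      · obtain ⟨y, -, hy⟩ := hb.isCompact_closure.exists_isMinOn hne
          (hc.sub hφL.continuous).continuousOn
        exact ⟨u y - φ y, sub_pos.2 (hpos y), fun x hx => hy (subset_closure hx)⟩
    refine ⟨(1 - s) * m, by positivity, hu.sub.mono (Set.subset_univ Ω) fun x hx => ?_⟩
    rw [mul_div_cancel_left₀ _ hs1.ne']
    exact hmΩ x hx
  have hpart4 : 2 ≤ n → ∀ (L : ℝ≥0) (C η₀ : ℝ) (Ω : Set (EuclideanSpace ℝ (Fin n))),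
      0 < L → 0 < C → 0 < η₀ → LipschitzWith L u → FracMA.IsSemiconcave C u → IsOpen Ω →
      FracMA.IsSubsolutionOn s Ω (fun _ => η₀ / (1 - s)) u →
      ∀ θ : ℝ, 0 < θ → θ < FracMA.threshold n s L C η₀ →
        ∀ x ∈ Ω, FracMA.ClassicalAt s u x ∧ FracMA.fracMA s u x = FracMA.fracMATrunc s θ u x := by
    intro hn2 L C η₀ Ω hL hC hη hLu hCu hΩ hsub θ hθ hθ' x hx
    obtain ⟨p, hp⟩ := FracMA.exists_supergradient hC.le hLu hCu.2 x
    have h : ∀ A : Matrix (Fin n) (Fin n) ℝ, A.PosDef → A.det = 1 →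
        MeasureTheory.Integrable (FracMA.integrand s A u x) ∧ η₀ / (1 - s) ≤ FracMA.linOp s A u x :=
      fun A hA hdet => hsub.pointwise hs hs' hΩ hc hgrow hx hp hA hdet
    exact ⟨fun A hA hdet => (h A hA hdet).1,
      FracMA.fracMA_eq_fracMATrunc hn2 hs hs' hC hL hLu hCu.2 hη h hθ hθ'⟩
  refine ⟨hpos, ⟨L₁, hL⟩, ⟨K, hc, hsemi⟩, hpart3, hpart4, fun Ω hΩ => ?_⟩
  rcases hn.eq_or_lt with rfl | hn2
  · refine ⟨1, one_pos, fun θ _ hθ x _ => ⟨fun A hA hdet => ?_,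
      FracMA.fracMA_eq_fracMATrunc_of_eq_one hθ x⟩⟩
    obtain ⟨p, hp⟩ := FracMA.exists_supergradient hK0 hL hsemi x
    exact (hu.sub.pointwise hs hs' isOpen_univ hc hgrow (Set.mem_univ x) hp hA hdet).1
  · obtain ⟨R, hR⟩ := hΩ.subset_ball 0
    obtain ⟨η₀, hη, hsub⟩ := hpart3 (Metric.ball 0 R) Metric.isOpen_ball Metric.isBounded_ball
    have hC1 : 0 < K + 1 := by linarith
    have ht := FracMA.threshold_pos hn2 hs (NNReal.coe_pos.2 hL₁) hC1 hη
    -- Half of the threshold turns the strict condition on θ into a non-strict one; K + 1 replaces K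
    -- because the semiconcavity constant has to be positive.
    refine ⟨FracMA.threshold n s L₁ (K + 1) η₀ / 2, half_pos ht, fun θ hθ hθ' x hx => ?_⟩
    refine hpart4 hn2 L₁ (K + 1) η₀ (Metric.ball 0 R) hL₁ hC1 hη hL ⟨hc, fun y z => ?_⟩
      Metric.isOpen_ball hsub θ hθ (by linarith) x (hR hx)
    exact (hsemi y z).trans (by gcongr; linarith)
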